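/- Let $\mathbb T^3=(\mathbb R/\mathbb Z)^3$ be the torus with unit side length, with its Lebesgue measure of total mass one, and write $\langle x\rangle=\sqrt{1+x^2}$ and $\|f\|_{N,\infty}=\sup_{|\alpha|\le N}\|D^\alpha f\|_\infty$. A smooth function $\omega:\mathbb T^3\to\mathbb R$ is called a Morse function if all its critical points are isolated and non-degenerate. We say that $\omega:\mathbb T^3\to\mathbb R$ satisfies (DR1)--(DR4) with crossing exponent $\gamma$ if: (DR1) $\omega$ is smooth and $\omega(-k)=\omega(k)$ for all $k$; (DR2) $\min_k\omega(k)>0$ and $\max_k\omega(k)<\infty$; (DR3) there are $d_1\in\mathbb N$ and $c_\omega>0$ such that for all $t\in\mathbb R$ and $f\in C^\infty(\mathbb T^3)$ (complex-valued) $$\Bigl|\int_{\mathbb T^3}dk\,f(k)e^{-it\omega(k)}\Bigr|\le\frac{c_\omega}{\langle t\rangle^{3/2}}\|f\|_{d_1,\infty};$$ (DR4) $0<\gamma\le1$ and there are $c_2>0$ and $d_2\in\mathbb N$ such that for all $u\in\mathbb T^3$, $0<\beta\le1$, $\alpha\in\mathbb R^3$ and $\sigma\in\{\pm1\}^3$ $$\int_{(\mathbb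 T^3)^2}\frac{dk_1\,dk_2}{|\alpha_1-\sigma_1\omega(k_1)+i\beta|\,|\alpha_2-\sigma_2\omega(k_2)+i\beta|\,|\alpha_3-\sigma_3\omega(k_1-k_2+u)+i\beta|}\le c_2\,\beta^{\gamma-1}\langle\ln\beta\rangle^{d_2}.$$ Proposition. If $\omega$ is a Morse function satisfying (DR1)--(DR4) with crossing exponent $\gamma$, then $\sqrt\omega$ is also a Morse function satisfying (DR1)--(DR4), with the same crossing exponent $\gamma$ (the constants $d_1,c_\omega,c_2,d_2$ may change). This applies in particular to the nearest-neighbour dispersion relation $$\omega_{\rm nn}(k)=\Bigl[\omega_0^2+\sum_{\nu=1}^3 2\bigl(1-\cos(2\pi k^\nu)\bigr)\Bigr]^{1/2}:$$ for every $\omega_0>0$ there is $\gamma\in(0,1]$ such that both $\omega_{\rm nn}^2$ and $\omega_{\rm nn}=\sqrt{\omega_{\rm nn}^2}$ are Morse functions satisfying (DR1)--(DR4) with crossing exponent $\gamma$. -/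

import Mathlib

open scoped Topology
open MeasureTheory

noncomputable section

namespace Dispersion

/-- The three-dimensional torus `(ℝ/ℤ)³` with unit side length. Its `volume` is the product of the
length measures on `ℝ/ℤ`, of total mass one. -/
abbrev T3 : Type := UnitAddTorus (Fin 3)

/-- The `ℤ³`-periodic function on `ℝ³` that a function on the torus corresponds to. Derivatives on
the torus are derivatives of this periodic extension. -/
def periodicExt {E : Type*} (f : T3 → E) : (Fin 3 → ℝ) → E :=
  fun x => f (fun i => (x i : UnitAddCircle))

/-- `f ∈ C^∞(𝕋³)`. -/
def SmoothOnTorus {E : Type*} [NormedAddCommGroup E] [NormedSpace ℝ E] (f : T3 → E) : Prop :=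
  ContDiff ℝ (⊤ : ℕ∞) (periodicExt f)

/-- The partial derivative in the `i`-th coordinate direction. -/
def partialD (i : Fin 3) (F : (Fin 3 → ℝ) → ℂ) : (Fin 3 → ℝ) → ℂ :=
  fun x => fderiv ℝ F x (Pi.single i 1)

/-- The derivative `D^α F = ∂₀^{α₀} ∂₁^{α₁} ∂₂^{α₂} F` for a multi-index `α`. -/
def multiD (α : Fin 3 → ℕ) (F : (Fin 3 → ℝ) → ℂ) : (Fin 3 → ℝ) → ℂ :=
  (partialD 0)^[α 0] ((partialD 1)^[α 1] ((partialD 2)^[α 2] F))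

/-- `‖f‖_{N,∞} = sup_{|α| ≤ N} ‖D^α f‖_∞`. It is used for smooth `f` only, and then every supremum
is over a bounded set. -/
def supNorm (N : ℕ) (f : T3 → ℂ) : ℝ :=
  ⨆ α : {α : Fin 3 → ℕ // ∑ i, α i ≤ N}, ⨆ x : Fin 3 → ℝ, ‖multiD α.1 (periodicExt f) x‖

/-- The bracket `⟨x⟩ = √(1 + x²)`. -/
def bracket (x : ℝ) : ℝ := √(1 + x ^ 2)

/-- Morse functions on the torus: smooth functions all of whose critical points are isolated and
non-degenerate, that is, the second derivative there is a non-degenerate bilinear form. -/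
structure IsMorse (ω : T3 → ℝ) : Prop where
  smooth : SmoothOnTorus ω
  isolated : ∀ x : Fin 3 → ℝ, fderiv ℝ (periodicExt ω) x = 0 →
    ∀ᶠ y in 𝓝[≠] x, fderiv ℝ (periodicExt ω) y ≠ 0
  nondegenerate : ∀ x : Fin 3 → ℝ, fderiv ℝ (periodicExt ω) x = 0 →
    ∀ v : Fin 3 → ℝ,
      (∀ w : Fin 3 → ℝ, fderiv ℝ (fderiv ℝ (periodicExt ω)) x v w = 0) → v = 0

/-- Dispersivity: `|∫ f(k) e^{-i t ω(k)} dk| ≤ c ⟨t⟩^{-3/2} ‖f‖_{d₁,∞}`. -/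
def Dispersive (ω : T3 → ℝ) : Prop :=
  ∃ (d₁ : ℕ) (c : ℝ), 0 < c ∧ ∀ (t : ℝ) (f : T3 → ℂ), SmoothOnTorus f →
    ‖∫ k : T3, f k * Complex.exp (-Complex.I * t * ω k)‖
      ≤ c / bracket t ^ (3 / 2 : ℝ) * supNorm d₁ f

/-- Suppression of crossings, with exponent `γ`. -/
def CrossingsSuppressed (ω : T3 → ℝ) (γ : ℝ) : Prop :=
  0 < γ ∧ γ ≤ 1 ∧ ∃ (c₂ : ℝ) (d₂ : ℕ), 0 < c₂ ∧
    ∀ (u : T3) (β : ℝ), 0 < β → β ≤ 1 →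
    ∀ α σ : Fin 3 → ℝ, (∀ i, σ i = 1 ∨ σ i = -1) →
      ∫ k : T3 × T3,
          1 / (‖((α 0 - σ 0 * ω k.1 : ℝ) : ℂ) + Complex.I * β‖
            * ‖((α 1 - σ 1 * ω k.2 : ℝ) : ℂ) + Complex.I * β‖)
          * (1 / ‖((α 2 - σ 2 * ω (k.1 - k.2 + u) : ℝ) : ℂ) + Complex.I * β‖)
        ≤ c₂ * β ^ (γ - 1) * bracket (Real.log β) ^ d₂

/-- The four assumptions (DR1)-(DR4) on a dispersion relation, the last one with exponent `γ`. -/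
structure DispersionAssumptions (ω : T3 → ℝ) (γ : ℝ) : Prop where
  smooth : SmoothOnTorus ω
  symm : ∀ k, ω (-k) = ω k
  min_pos : ∃ k₀, (∀ k, ω k₀ ≤ ω k) ∧ 0 < ω k₀
  max_exists : ∃ k₁, ∀ k, ω k ≤ ω k₁
  dispersive : Dispersive ω
  crossings : CrossingsSuppressed ω γ

theorem cos_two_pi_periodic : Function.Periodic (fun x : ℝ => Real.cos (2 * Real.pi * x)) 1 := by
  intro x
  simp only [mul_add, mul_one, Real.cos_add_two_pi]

/-- The function `k ↦ cos(2πk)` on `ℝ/ℤ`. -/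
def cosTwoPi : UnitAddCircle → ℝ := cos_two_pi_periodic.lift

theorem cosTwoPi_coe (x : ℝ) : cosTwoPi (x : UnitAddCircle) = Real.cos (2 * Real.pi * x) :=
  cos_two_pi_periodic.lift_coe x

/-- `ω_nn(k)² = ω₀² + ∑_ν 2 (1 - cos(2πk^ν))`. -/
def omegaNNSq (ω₀ : ℝ) (k : T3) : ℝ := ω₀ ^ 2 + ∑ ν, 2 * (1 - cosTwoPi (k ν))

/-- The nearest-neighbour dispersion relation `ω_nn`. -/
def omegaNN (ω₀ : ℝ) (k : T3) : ℝ := √(omegaNNSq ω₀ k)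

end Dispersion

end

open scoped Topology
open MeasureTheory

noncomputable section

namespace Dispersion

/-! Square roots. Since `∇√ω = ∇ω / (2√ω)`, the functions `ω` and `√ω` have the same critical
points, with Hessians proportional there, so `√ω` is again Morse (`IsMorse.sqrt`). Dispersivity then
needs no comparison of the two functions, because every Morse function on the torus is dispersive
(`IsMorse.dispersive`). Two integrations by parts along `∇ω`, arranged so that each gains a factor
`(1 + t|∇ω|²)⁻¹` even at critical points, bound the oscillatory integral by `∫ (1 + t|∇ω|²)⁻²`.
Non-degeneracy makes `|∇ω|` grow linearly away from each critical point, and scaling in dimension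
three turns this into `t^(-3/2)`. The crossing estimate passes to `√ω` through `α² - w = (α + σ√w)(α
- σ√w)`: for bounded `α` the denominators of `√ω` dominate those of `ω` at the shifted value `α²`,
and for large `α` they are bounded below (`exists_resDenom_sqrt_le`).

Nearest neighbours. What remains is the crossing estimate for `ω_nn²`. For `p < 1`, the function
`1/|y + iβ|` is at most a constant times `β^(p-1) Re (β - iy)^(-p)`. This kernel is positive, and it
is the cosine transform of the positive density `s^(p-1) e^(-βs) / Γ(p)`. Because `ω_nn²` is a sum
over coordinates, the Fourier coefficients in `k` of the kernel at `α - ω_nn²(k)` are controlled by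
integrals of `|J_{n₀} J_{n₁} J_{n₂}|(2s)` against that density; `circleOsc m s` is `J_m(2s)` up to a
power of `i`.

Two facts about these coefficients carry the proof (`exists_integral_prod_le`). They are bounded
uniformly in `β`, `α` and `n`: positivity of the kernel makes the weighted second moment of `J_m`
largest at `m = 0`, where the decay `s^(-1/2)` makes it finite. They are also small for large `n`,
since `J_m(2s)` is `O(s/|m|)` and also `O(s^(-1/6))` uniformly in `m`.

The crossing integral is a convolution, so Parseval's identity writes it as a sum of products of
three coefficients (`integral_convolution_le`). Low frequencies are counted in a box; high
frequencies are small times the product of two `L²` norms, each costing `β^(-p/2)`. Balancing the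
two gives a power of `β` better than `β^(-1)`. -/

/-! ### Calculus on the torus -/

/-- The covering map `ℝ³ → 𝕋³`. -/
def torusMk (x : Fin 3 → ℝ) : T3 := fun i => (x i : UnitAddCircle)

theorem torusMk_add (x y : Fin 3 → ℝ) : torusMk (x + y) = torusMk x + torusMk y := by
  ext i; simp [torusMk]

theorem torusMk_single (i : Fin 3) (h : ℝ) :
    torusMk (Pi.single i h) = Pi.single i (h : UnitAddCircle) := by
  ext j
  by_cases hj : j = i
  · subst hj; simp [torusMk]
  · simp [torusMk, hj]

theorem isOpenQuotientMap_torusMk : IsOpenQuotientMap torusMk :=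
  IsOpenQuotientMap.piMap fun _ => QuotientAddGroup.isOpenQuotientMap_mk

theorem torusMk_surjective : Function.Surjective torusMk := isOpenQuotientMap_torusMk.surjective

theorem periodicExt_apply {E : Type*} (f : T3 → E) (x : Fin 3 → ℝ) :
    periodicExt f x = f (torusMk x) := rfl

section Smooth

variable {E : Type*} [NormedAddCommGroup E] [NormedSpace ℝ E]

/-- The derivative of a function on the torus in the `i`-th coordinate direction. -/
def torusD (i : Fin 3) (f : T3 → E) (k : T3) : E :=
  deriv (fun h : ℝ => f (k + Pi.single i (h : UnitAddCircle))) 0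

theorem SmoothOnTorus.continuous {f : T3 → E} (hf : SmoothOnTorus f) : Continuous f :=
  isOpenQuotientMap_torusMk.isQuotientMap.continuous_iff.2 (ContDiff.continuous hf)

theorem exists_bound_of_continuous {F : Type*} [NormedAddCommGroup F] {f : T3 → F}
    (hf : Continuous f) : ∃ C : ℝ, 0 ≤ C ∧ ∀ k, ‖f k‖ ≤ C := by
  obtain ⟨C, hC⟩ := isCompact_univ.exists_bound_of_continuousOn hf.continuousOn
  exact ⟨C, (norm_nonneg _).trans (hC 0 trivial), fun k => hC k trivial⟩

theorem periodicExt_add_single {F : Type*} {f : T3 → F} (x : Fin 3 → ℝ) (i : Fin 3) (h : ℝ) :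
    f (torusMk x + Pi.single i (h : UnitAddCircle)) =
      periodicExt f (x + h • Pi.single i (1 : ℝ)) := by
  rw [periodicExt_apply, torusMk_add, ← torusMk_single, ← Pi.single_smul, smul_eq_mul, mul_one]

theorem hasDerivAt_periodicExt {f : T3 → E} (hf : SmoothOnTorus f) (x : Fin 3 → ℝ) (i : Fin 3) :
    HasDerivAt (fun h : ℝ => f (torusMk x + Pi.single i (h : UnitAddCircle)))
      (fderiv ℝ (periodicExt f) x (Pi.single i 1)) 0 := by
  simp_rw [periodicExt_add_single]
  have h1 : HasFDerivAt (periodicExt f) (fderiv ℝ (periodicExt f) x)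
      (x + (0 : ℝ) • Pi.single i (1 : ℝ)) := by
    rw [zero_smul, add_zero]
    exact (ContDiff.differentiable hf (by simp) x).hasFDerivAt
  have h2 : HasDerivAt (fun h : ℝ => x + h • (Pi.single i (1 : ℝ) : Fin 3 → ℝ))
      (Pi.single i 1) 0 := by
    simpa using ((hasDerivAt_id (0 : ℝ)).smul_const (Pi.single i (1 : ℝ) : Fin 3 → ℝ)).const_add x
  exact h1.comp_hasDerivAt 0 h2

theorem torusD_torusMk {f : T3 → E} (hf : SmoothOnTorus f) (x : Fin 3 → ℝ) (i : Fin 3) :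
    torusD i f (torusMk x) = fderiv ℝ (periodicExt f) x (Pi.single i 1) :=
  (hasDerivAt_periodicExt hf x i).deriv

theorem SmoothOnTorus.hasDerivAt_zero {f : T3 → E} (hf : SmoothOnTorus f) (k : T3) (i : Fin 3) :
    HasDerivAt (fun h : ℝ => f (k + Pi.single i (h : UnitAddCircle))) (torusD i f k) 0 := by
  obtain ⟨x, rfl⟩ := torusMk_surjective k
  rw [torusD_torusMk hf]
  exact hasDerivAt_periodicExt hf x i

theorem SmoothOnTorus.hasDerivAt {f : T3 → E} (hf : SmoothOnTorus f) (k : T3) (i : Fin 3) (h : ℝ) :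
    HasDerivAt (fun h : ℝ => f (k + Pi.single i (h : UnitAddCircle)))
      (torusD i f (k + Pi.single i (h : UnitAddCircle))) h := by
  have h1 := hf.hasDerivAt_zero (k + Pi.single i (h : UnitAddCircle)) i
  have h2 : HasDerivAt (fun s : ℝ => s - h) 1 h := (hasDerivAt_id h).sub_const h
  have h3 := HasDerivAt.scomp (h := fun s : ℝ => s - h) h (by simpa using h1) h2
  simp only [one_smul] at h3
  refine h3.congr_of_eventuallyEq (Filter.Eventually.of_forall fun s => ?_)
  simp only [Function.comp, add_assoc, ← Pi.single_add, ← AddCircle.coe_add]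
  congr 3
  simp

theorem periodicExt_torusD {f : T3 → E} (hf : SmoothOnTorus f) (i : Fin 3) :
    periodicExt (torusD i f) = fun x => fderiv ℝ (periodicExt f) x (Pi.single i 1) :=
  funext fun x => torusD_torusMk hf x i

theorem SmoothOnTorus.torusD {f : T3 → E} (hf : SmoothOnTorus f) (i : Fin 3) :
    SmoothOnTorus (torusD i f) := by
  unfold SmoothOnTorus
  rw [periodicExt_torusD hf]
  exact (ContDiff.fderiv_right (m := (⊤ : ℕ∞)) hf (by simp)).clm_apply contDiff_const

theorem torusD_comm {f : T3 → E} (hf : SmoothOnTorus f) (i j : Fin 3) (k : T3) :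
    torusD i (torusD j f) k = torusD j (torusD i f) k := by
  obtain ⟨x, rfl⟩ := torusMk_surjective k
  rw [torusD_torusMk (hf.torusD j), torusD_torusMk (hf.torusD i), periodicExt_torusD hf,
    periodicExt_torusD hf]
  have hd : DifferentiableAt ℝ (fderiv ℝ (periodicExt f)) x :=
    (ContDiff.fderiv_right (m := (⊤ : ℕ∞)) hf (by simp)).differentiable (by simp) x
  have hs : IsSymmSndFDerivAt ℝ (periodicExt f) x :=
    (ContDiff.contDiffAt hf).isSymmSndFDerivAt
      (by rw [minSmoothness_of_isRCLikeNormedField]; exact WithTop.coe_le_coe.2 (le_top (a := (2 : ℕ∞))))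
  rw [fderiv_clm_apply hd (differentiableAt_const _), fderiv_clm_apply hd (differentiableAt_const _)]
  simpa using hs.eq _ _

theorem smoothOnTorus_const (c : E) : SmoothOnTorus fun _ => c := contDiff_const

theorem SmoothOnTorus.add {f g : T3 → E} (hf : SmoothOnTorus f) (hg : SmoothOnTorus g) :
    SmoothOnTorus fun k => f k + g k := ContDiff.add hf hg

theorem SmoothOnTorus.sum {f : Fin 3 → T3 → E} (hf : ∀ i, SmoothOnTorus (f i)) :
    SmoothOnTorus fun k => ∑ i, f i k := ContDiff.sum fun i _ => hf i

theorem torusD_const (i : Fin 3) (c : E) (k : T3) : torusD i (fun _ => c) k = 0 := by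
  simp [torusD]

theorem torusD_add {f g : T3 → E} (hf : SmoothOnTorus f) (hg : SmoothOnTorus g) (i : Fin 3)
    (k : T3) : torusD i (fun k => f k + g k) k = torusD i f k + torusD i g k :=
  ((hf.hasDerivAt_zero k i).add (hg.hasDerivAt_zero k i)).deriv

theorem torusD_sum {f : Fin 3 → T3 → E} (hf : ∀ i, SmoothOnTorus (f i)) (i : Fin 3)
    (k : T3) : torusD i (fun k => ∑ j, f j k) k = ∑ j, torusD i (f j) k :=
  (HasDerivAt.fun_sum fun j _ => (hf j).hasDerivAt_zero k i).deriv

end Smooth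

theorem SmoothOnTorus.mul {f g : T3 → ℂ} (hf : SmoothOnTorus f) (hg : SmoothOnTorus g) :
    SmoothOnTorus fun k => f k * g k := ContDiff.mul hf hg

theorem SmoothOnTorus.inv {f : T3 → ℂ} (hf : SmoothOnTorus f) (h : ∀ k, f k ≠ 0) :
    SmoothOnTorus fun k => (f k)⁻¹ := ContDiff.inv hf fun x => h (torusMk x)

theorem SmoothOnTorus.cexp {f : T3 → ℂ} (hf : SmoothOnTorus f) :
    SmoothOnTorus fun k => Complex.exp (f k) := ContDiff.cexp hf

theorem SmoothOnTorus.ofReal {f : T3 → ℝ} (hf : SmoothOnTorus f) :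
    SmoothOnTorus fun k => (f k : ℂ) := Complex.ofRealCLM.contDiff.comp hf

theorem torusD_mul {f g : T3 → ℂ} (hf : SmoothOnTorus f) (hg : SmoothOnTorus g) (i : Fin 3)
    (k : T3) : torusD i (fun k => f k * g k) k = torusD i f k * g k + f k * torusD i g k := by
  have := ((hf.hasDerivAt_zero k i).fun_mul (hg.hasDerivAt_zero k i)).deriv
  rw [torusD, this]; simp

theorem torusD_const_mul {f : T3 → ℂ} (hf : SmoothOnTorus f) (c : ℂ) (i : Fin 3)
    (k : T3) : torusD i (fun k => c * f k) k = c * torusD i f k :=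
  ((hf.hasDerivAt_zero k i).const_mul c).deriv

theorem torusD_inv {f : T3 → ℂ} (hf : SmoothOnTorus f) (h : ∀ k, f k ≠ 0) (i : Fin 3)
    (k : T3) : torusD i (fun k => (f k)⁻¹) k = -((f k)⁻¹ * (f k)⁻¹ * torusD i f k) := by
  have := ((hf.hasDerivAt_zero k i).fun_inv (h _)).deriv
  rw [torusD, this]
  simp only [AddCircle.coe_zero, Pi.single_zero, add_zero]
  field_simp

theorem torusD_cexp {f : T3 → ℂ} (hf : SmoothOnTorus f) (i : Fin 3) (k : T3) :
    torusD i (fun k => Complex.exp (f k)) k = Complex.exp (f k) * torusD i f k := by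
  have := ((hf.hasDerivAt_zero k i).cexp).deriv
  rw [torusD, this]; simp

theorem torusD_ofReal {f : T3 → ℝ} (hf : SmoothOnTorus f) (i : Fin 3) (k : T3) :
    torusD i (fun k => (f k : ℂ)) k = (torusD i f k : ℝ) :=
  ((hf.hasDerivAt_zero k i).ofReal_comp).deriv

theorem integrable_of_continuous {X F : Type*} [TopologicalSpace X] [CompactSpace X]
    [MeasurableSpace X] [OpensMeasurableSpace X] [NormedAddCommGroup F]
    [SecondCountableTopologyEither X F] (μ : Measure X) [IsFiniteMeasure μ] {f : X → F}
    (hf : Continuous f) : Integrable f μ := by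
  obtain ⟨C, hC⟩ := isCompact_univ.exists_bound_of_continuousOn hf.continuousOn
  exact Integrable.of_bound hf.aestronglyMeasurable C
    (Filter.Eventually.of_forall fun k => hC k trivial)

theorem integral_comp_add_right {F : Type*} [NormedAddCommGroup F] [NormedSpace ℝ F] (f : T3 → F)
    (a : T3) : ∫ k, f (k + a) = ∫ k, f k :=
  integral_add_right_eq_self f a

theorem hasDerivAt_integral_of_continuous {X : Type*} [TopologicalSpace X] [CompactSpace X]
    [MeasurableSpace X] [OpensMeasurableSpace X] (μ : Measure X) [IsFiniteMeasure μ]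
    {F F' : ℝ → X → ℂ} (hF : ∀ h, Continuous (F h)) (hF' : Continuous (F' 0)) {C : ℝ}
    (hC : ∀ h k, ‖F' h k‖ ≤ C) (hd : ∀ h k, HasDerivAt (fun h => F h k) (F' h k) h) :
    HasDerivAt (fun h => ∫ k, F h k ∂μ) (∫ k, F' 0 k ∂μ) 0 :=
  (hasDerivAt_integral_of_dominated_loc_of_deriv_le (bound := fun _ => C) Filter.univ_mem
    (Filter.Eventually.of_forall fun h => (hF h).aestronglyMeasurable)
    (integrable_of_continuous _ (hF 0)) hF'.aestronglyMeasurable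
    (Filter.Eventually.of_forall fun k h _ => hC h k) (integrable_const C)
    (Filter.Eventually.of_forall fun k h _ => hd h k)).2

/-- By translation invariance, the integral of `f` shifted by `h` does not depend on `h`;
differentiate at `h = 0`. This is the source of all integrations by parts on the torus, without
boundary terms. -/
theorem integral_torusD {f : T3 → ℂ} (hf : SmoothOnTorus f) (i : Fin 3) :
    ∫ k, torusD i f k = 0 := by
  obtain ⟨C, -, hC⟩ := exists_bound_of_continuous (hf.torusD i).continuous
  have hc : ∀ g : T3 → ℂ, Continuous g → ∀ h : ℝ,
      Continuous fun k : T3 => g (k + Pi.single i (h : UnitAddCircle)) :=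
    fun g hg h => hg.comp (continuous_id.add continuous_const)
  have key : HasDerivAt (fun h : ℝ => ∫ k : T3, f (k + Pi.single i (h : UnitAddCircle)))
      (∫ k : T3, torusD i f (k + Pi.single i ((0 : ℝ) : UnitAddCircle))) 0 :=
    hasDerivAt_integral_of_continuous volume (hc f hf.continuous) (hc _ (hf.torusD i).continuous 0)
      (fun h k => hC _) (fun h k => hf.hasDerivAt k i h)
  rw [integral_comp_add_right (torusD i f)] at key
  have h0 : (fun h : ℝ => ∫ k : T3, f (k + Pi.single i (h : UnitAddCircle))) = fun _ => ∫ k : T3, f k :=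
    funext fun h => integral_comp_add_right f _
  rw [h0] at key
  exact key.unique (hasDerivAt_const _ _)

theorem integral_torusD_mul {f g : T3 → ℂ} (hf : SmoothOnTorus f) (hg : SmoothOnTorus g)
    (i : Fin 3) : ∫ k, f k * torusD i g k = -∫ k, torusD i f k * g k := by
  have h := integral_torusD (hf.mul hg) i
  simp_rw [torusD_mul hf hg] at h
  rw [integral_add (integrable_of_continuous _ ((hf.torusD i).mul hg).continuous)
    (integrable_of_continuous _ (hf.mul (hg.torusD i)).continuous)] at h
  linear_combination h

theorem SmoothOnTorus.iterate_torusD {f : T3 → ℂ} (hf : SmoothOnTorus f) (i : Fin 3) (n : ℕ) :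
    SmoothOnTorus ((Dispersion.torusD i)^[n] f) ∧
      periodicExt ((Dispersion.torusD i)^[n] f) = (partialD i)^[n] (periodicExt f) := by
  induction n with
  | zero => exact ⟨hf, rfl⟩
  | succ n ih =>
    rw [Function.iterate_succ_apply', Function.iterate_succ_apply', periodicExt_torusD ih.1, ih.2]
    exact ⟨ih.1.torusD i, rfl⟩

/-- The derivative `D^α` of a function on the torus. -/
def torusMultiD (α : Fin 3 → ℕ) (f : T3 → ℂ) : T3 → ℂ :=
  (torusD 0)^[α 0] ((torusD 1)^[α 1] ((torusD 2)^[α 2] f))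

theorem SmoothOnTorus.torusMultiD {f : T3 → ℂ} (hf : SmoothOnTorus f) (α : Fin 3 → ℕ) :
    SmoothOnTorus (torusMultiD α f) :=
  (((hf.iterate_torusD 2 _).1.iterate_torusD 1 _).1.iterate_torusD 0 _).1

theorem multiD_periodicExt {f : T3 → ℂ} (hf : SmoothOnTorus f) (α : Fin 3 → ℕ) :
    multiD α (periodicExt f) = periodicExt (torusMultiD α f) := by
  have h2 := hf.iterate_torusD 2 (α 2)
  have h1 := h2.1.iterate_torusD 1 (α 1)
  rw [multiD, torusMultiD, (h1.1.iterate_torusD 0 (α 0)).2, h1.2, h2.2]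

/-- A real supremum dominates its terms only over a bounded set. Here there are finitely many
multi-indices, and each derivative is bounded by compactness of the torus. -/
theorem norm_torusMultiD_le_supNorm {f : T3 → ℂ} (hf : SmoothOnTorus f) {N : ℕ} {α : Fin 3 → ℕ}
    (hα : ∑ i, α i ≤ N) (k : T3) : ‖torusMultiD α f k‖ ≤ supNorm N f := by
  obtain ⟨x, rfl⟩ := torusMk_surjective k
  have hfin : Finite {α : Fin 3 → ℕ // ∑ i, α i ≤ N} := by
    refine Set.Finite.subset (Set.finite_Iic (fun _ : Fin 3 => N)) fun α hα i => ?_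
    exact (Finset.single_le_sum (f := α) (fun _ _ => Nat.zero_le _) (Finset.mem_univ i)).trans hα
  have hb : BddAbove (Set.range fun x : Fin 3 → ℝ => ‖multiD α (periodicExt f) x‖) := by
    obtain ⟨C, -, hC⟩ := exists_bound_of_continuous (hf.torusMultiD α).continuous
    refine ⟨C, ?_⟩
    rintro _ ⟨y, rfl⟩
    simp only [multiD_periodicExt hf]
    exact hC _
  calc ‖torusMultiD α f (torusMk x)‖ = ‖multiD α (periodicExt f) x‖ := by
        rw [multiD_periodicExt hf]; rfl
    _ ≤ ⨆ x : Fin 3 → ℝ, ‖multiD α (periodicExt f) x‖ := le_ciSup hb x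
    _ ≤ supNorm N f :=
        le_ciSup (f := fun α : {α : Fin 3 → ℕ // ∑ i, α i ≤ N} =>
          ⨆ x : Fin 3 → ℝ, ‖multiD α.1 (periodicExt f) x‖) (Set.finite_range _).bddAbove ⟨α, hα⟩

theorem norm_le_supNorm {f : T3 → ℂ} (hf : SmoothOnTorus f) (N : ℕ) (k : T3) :
    ‖f k‖ ≤ supNorm N f :=
  norm_torusMultiD_le_supNorm hf (α := 0) (by simp) k

theorem norm_torusD_le_supNorm {f : T3 → ℂ} (hf : SmoothOnTorus f) {N : ℕ} (hN : 1 ≤ N) (i : Fin 3)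
    (k : T3) : ‖torusD i f k‖ ≤ supNorm N f := by
  have h := norm_torusMultiD_le_supNorm hf (α := Pi.single i 1) (N := N) (by simpa using hN) k
  fin_cases i <;> simpa [torusMultiD, Pi.single_apply] using h

theorem norm_torusD_torusD_le_supNorm {f : T3 → ℂ} (hf : SmoothOnTorus f) {N : ℕ} (hN : 2 ≤ N)
    (i j : Fin 3) (k : T3) : ‖torusD i (torusD j f) k‖ ≤ supNorm N f := by
  have h := norm_torusMultiD_le_supNorm hf (α := Pi.single i 1 + Pi.single j 1) (N := N)
    (by simpa [Finset.sum_add_distrib] using hN) k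
  -- `multiD` always applies the coordinate with the smallest index last, so the opposite order has
  -- to be commuted first.
  fin_cases i <;> fin_cases j <;>
    first
    | simpa [torusMultiD, Pi.single_apply] using h
    | (rw [torusD_comm hf]; simpa [torusMultiD, Pi.single_apply] using h)

/-! ### Oscillatory integrals by integration by parts along the gradient -/

/-- The component `∂_i ω` of the gradient, as a complex function. -/
def gradC (ω : T3 → ℝ) (i : Fin 3) : T3 → ℂ := torusD i fun k => (ω k : ℂ)

/-- The squared length of the gradient. -/
def gradSq (ω : T3 → ℝ) (k : T3) : ℝ := ∑ i, torusD i ω k ^ 2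

/-- The directional derivative along the gradient of `ω`. -/
def gradD (ω : T3 → ℝ) (f : T3 → ℂ) (k : T3) : ℂ := ∑ i, gradC ω i k * torusD i f k

/-- The Laplacian of `ω`. -/
def laplC (ω : T3 → ℝ) (k : T3) : ℂ := ∑ i, torusD i (gradC ω i) k

/-- The weight `1 / (1 + t |∇ω|²)`. -/
def gradWeight (ω : T3 → ℝ) (t : ℝ) (k : T3) : ℂ := (1 + t * (gradSq ω k : ℂ))⁻¹

/-- The oscillating factor `e^{-itω}`. -/
def phase (ω : T3 → ℝ) (t : ℝ) (k : T3) : ℂ := Complex.exp (-Complex.I * t * ω k)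

section

variable {ω : T3 → ℝ}

theorem gradC_eq (hω : SmoothOnTorus ω) (i : Fin 3) (k : T3) :
    gradC ω i k = (torusD i ω k : ℝ) := torusD_ofReal hω i k

theorem smooth_gradC (hω : SmoothOnTorus ω) (i : Fin 3) : SmoothOnTorus (gradC ω i) :=
  hω.ofReal.torusD i

theorem gradSq_eq (hω : SmoothOnTorus ω) (k : T3) :
    (gradSq ω k : ℂ) = ∑ i, gradC ω i k * gradC ω i k := by
  simp [gradSq, gradC_eq hω, sq]

theorem gradSq_nonneg (ω : T3 → ℝ) (k : T3) : 0 ≤ gradSq ω k :=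
  Finset.sum_nonneg fun _ _ => sq_nonneg _

theorem smooth_gradSq (hω : SmoothOnTorus ω) : SmoothOnTorus fun k => (gradSq ω k : ℂ) := by
  simp_rw [gradSq_eq hω]
  exact SmoothOnTorus.sum fun i => (smooth_gradC hω i).mul (smooth_gradC hω i)

theorem smooth_gradD (hω : SmoothOnTorus ω) {f : T3 → ℂ} (hf : SmoothOnTorus f) :
    SmoothOnTorus (gradD ω f) :=
  SmoothOnTorus.sum fun i => (smooth_gradC hω i).mul (hf.torusD i)

theorem smooth_laplC (hω : SmoothOnTorus ω) : SmoothOnTorus (laplC ω) :=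
  SmoothOnTorus.sum fun i => (smooth_gradC hω i).torusD i

theorem one_add_mul_gradSq_ne_zero (ω : T3 → ℝ) {t : ℝ} (ht : 0 < t) (k : T3) :
    (1 + t * (gradSq ω k : ℂ)) ≠ 0 := by
  have h : 0 < 1 + t * gradSq ω k := by
    have := mul_nonneg ht.le (gradSq_nonneg ω k); linarith
  exact_mod_cast h.ne'

theorem smooth_one_add_mul_gradSq (hω : SmoothOnTorus ω) (t : ℝ) :
    SmoothOnTorus fun k => (1 + t * (gradSq ω k : ℂ)) :=
  (smoothOnTorus_const 1).add ((smoothOnTorus_const (t : ℂ)).mul (smooth_gradSq hω))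

theorem smooth_gradWeight (hω : SmoothOnTorus ω) {t : ℝ} (ht : 0 < t) :
    SmoothOnTorus (gradWeight ω t) :=
  (smooth_one_add_mul_gradSq hω t).inv (one_add_mul_gradSq_ne_zero ω ht)

theorem smooth_phase (hω : SmoothOnTorus ω) (t : ℝ) : SmoothOnTorus (phase ω t) :=
  ((smoothOnTorus_const (-Complex.I * (t : ℂ))).mul hω.ofReal).cexp

theorem norm_phase (ω : T3 → ℝ) (t : ℝ) (k : T3) : ‖phase ω t k‖ = 1 := by
  rw [phase, show -Complex.I * t * ω k = ((-(t * ω k) : ℝ) : ℂ) * Complex.I by push_cast; ring]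
  exact Complex.norm_exp_ofReal_mul_I _

theorem gradD_add {f g : T3 → ℂ} (hf : SmoothOnTorus f) (hg : SmoothOnTorus g) (k : T3) :
    gradD ω (fun k => f k + g k) k = gradD ω f k + gradD ω g k := by
  simp only [gradD, torusD_add hf hg, mul_add, Finset.sum_add_distrib]

theorem gradD_mul {f g : T3 → ℂ} (hf : SmoothOnTorus f) (hg : SmoothOnTorus g) (k : T3) :
    gradD ω (fun k => f k * g k) k = gradD ω f k * g k + f k * gradD ω g k := by
  simp only [gradD, torusD_mul hf hg, Finset.sum_mul, Finset.mul_sum, ← Finset.sum_add_distrib]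
  exact Finset.sum_congr rfl fun i _ => by ring

theorem gradD_const_mul {f : T3 → ℂ} (hf : SmoothOnTorus f) (c : ℂ) (k : T3) :
    gradD ω (fun k => c * f k) k = c * gradD ω f k := by
  simp only [gradD, torusD_const_mul hf, Finset.mul_sum]
  exact Finset.sum_congr rfl fun i _ => by ring

theorem gradD_const (c : ℂ) (k : T3) : gradD ω (fun _ => c) k = 0 := by
  simp [gradD, torusD_const]

theorem gradD_phase (hω : SmoothOnTorus ω) (t : ℝ) (k : T3) :
    gradD ω (phase ω t) k = -Complex.I * t * gradSq ω k * phase ω t k := by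
  have h : ∀ i, torusD i (phase ω t) k = phase ω t k * (-Complex.I * t * gradC ω i k) := by
    intro i
    unfold phase
    rw [torusD_cexp ((smoothOnTorus_const (-Complex.I * (t : ℂ))).mul hω.ofReal),
      torusD_const_mul hω.ofReal]
    rfl
  simp only [gradD, h, gradSq_eq hω, Finset.sum_mul, Finset.mul_sum]
  exact Finset.sum_congr rfl fun i _ => by ring

theorem gradD_gradWeight (hω : SmoothOnTorus ω) {t : ℝ} (ht : 0 < t) (k : T3) :
    gradD ω (gradWeight ω t) k =
      -(gradWeight ω t k * (t * gradWeight ω t k * gradD ω (fun k => (gradSq ω k : ℂ)) k)) := by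
  have h : ∀ i, torusD i (gradWeight ω t) k =
      -(gradWeight ω t k * gradWeight ω t k * (t * torusD i (fun k => (gradSq ω k : ℂ)) k)) := by
    intro i
    unfold gradWeight
    rw [torusD_inv (smooth_one_add_mul_gradSq hω t) (one_add_mul_gradSq_ne_zero ω ht),
      torusD_add (smoothOnTorus_const 1) ((smoothOnTorus_const (t : ℂ)).mul (smooth_gradSq hω)),
      torusD_const, torusD_const_mul (smooth_gradSq hω), zero_add]
  simp only [gradD, h, Finset.mul_sum, ← Finset.sum_neg_distrib]
  exact Finset.sum_congr rfl fun i _ => by ring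

/-- Since `∇ω·∇` multiplies the phase by `-it|∇ω|²`, the operator `1 + i∇ω·∇` multiplies it by `1 +
t|∇ω|²`, which the weight cancels. The summand `1` keeps this operator usable at critical points,
where `∇ω·∇` alone gives nothing. -/
theorem phase_eq (hω : SmoothOnTorus ω) {t : ℝ} (ht : 0 < t) (k : T3) :
    phase ω t k =
      gradWeight ω t k * phase ω t k + Complex.I * gradWeight ω t k * gradD ω (phase ω t) k := by
  rw [gradD_phase hω, gradWeight]
  have := one_add_mul_gradSq_ne_zero ω ht k
  field_simp
  linear_combination ((t : ℂ) * gradSq ω k * phase ω t k) * Complex.I_sq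

theorem integral_mul_gradD (hω : SmoothOnTorus ω) {f g : T3 → ℂ} (hf : SmoothOnTorus f)
    (hg : SmoothOnTorus g) :
    ∫ k, f k * gradD ω g k = -∫ k, (gradD ω f k + laplC ω k * f k) * g k := by
  have hfG := fun i => hf.mul (smooth_gradC hω i)
  have h1 : ∀ k, f k * gradD ω g k = ∑ i, f k * gradC ω i k * torusD i g k := fun k => by
    simp only [gradD, Finset.mul_sum, mul_assoc]
  have h2 : ∀ k, (gradD ω f k + laplC ω k * f k) * g k =
      ∑ i, torusD i (fun k => f k * gradC ω i k) k * g k := fun k => by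
    simp only [gradD, laplC, Finset.sum_mul, ← Finset.sum_add_distrib]
    refine Finset.sum_congr rfl fun i _ => ?_
    rw [torusD_mul hf (smooth_gradC hω i)]
    ring
  simp_rw [h1, h2]
  rw [integral_finsetSum _ fun i _ => integrable_of_continuous _ ((hfG i).mul (hg.torusD i)).continuous,
    integral_finsetSum _ fun i _ => integrable_of_continuous _ (((hfG i).torusD i).mul hg).continuous,
    ← Finset.sum_neg_distrib]
  exact Finset.sum_congr rfl fun i _ => integral_torusD_mul (hfG i) hg i

/-- `t w (∇ω·∇)|∇ω|²` for the weight `w`. -/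
def weightLogD (ω : T3 → ℝ) (t : ℝ) (k : T3) : ℂ :=
  t * gradWeight ω t k * gradD ω (fun k => (gradSq ω k : ℂ)) k

theorem smooth_weightLogD (hω : SmoothOnTorus ω) {t : ℝ} (ht : 0 < t) :
    SmoothOnTorus (weightLogD ω t) :=
  ((smoothOnTorus_const (t : ℂ)).mul (smooth_gradWeight hω ht)).mul
    (smooth_gradD hω (smooth_gradSq hω))

theorem gradD_weightLogD (hω : SmoothOnTorus ω) {t : ℝ} (ht : 0 < t) (k : T3) :
    gradD ω (weightLogD ω t) k = -weightLogD ω t k ^ 2 +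
      t * gradWeight ω t k * gradD ω (gradD ω fun k => (gradSq ω k : ℂ)) k := by
  have h := smooth_gradWeight hω ht
  unfold weightLogD
  rw [gradD_mul ((smoothOnTorus_const (t : ℂ)).mul h) (smooth_gradD hω (smooth_gradSq hω)),
    gradD_const_mul h, gradD_gradWeight hω ht]
  ring

/-- The zeroth order coefficient of the transposed operator. -/
def transposeCoeff (ω : T3 → ℝ) (t : ℝ) (k : T3) : ℂ :=
  1 + -Complex.I * laplC ω k + Complex.I * weightLogD ω t k

theorem smooth_transposeCoeff (hω : SmoothOnTorus ω) {t : ℝ} (ht : 0 < t) :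
    SmoothOnTorus (transposeCoeff ω t) :=
  ((smoothOnTorus_const 1).add ((smoothOnTorus_const _).mul (smooth_laplC hω))).add
    ((smoothOnTorus_const _).mul (smooth_weightLogD hω ht))

theorem gradD_transposeCoeff (hω : SmoothOnTorus ω) {t : ℝ} (ht : 0 < t) (k : T3) :
    gradD ω (transposeCoeff ω t) k =
      -Complex.I * gradD ω (laplC ω) k + Complex.I * gradD ω (weightLogD ω t) k := by
  have h1 : SmoothOnTorus fun k => -Complex.I * laplC ω k :=
    (smoothOnTorus_const _).mul (smooth_laplC hω)
  have h2 : SmoothOnTorus fun k => Complex.I * weightLogD ω t k :=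
    (smoothOnTorus_const _).mul (smooth_weightLogD hω ht)
  unfold transposeCoeff
  rw [gradD_add ((smoothOnTorus_const 1).add h1) h2, gradD_add (smoothOnTorus_const 1) h1,
    gradD_const, gradD_const_mul (smooth_laplC hω), gradD_const_mul (smooth_weightLogD hω ht),
    zero_add]

/-- The transposed operator, divided by the weight. -/
def transposeOp (ω : T3 → ℝ) (t : ℝ) (f : T3 → ℂ) (k : T3) : ℂ :=
  transposeCoeff ω t k * f k + -Complex.I * gradD ω f k

theorem smooth_transposeOp (hω : SmoothOnTorus ω) {t : ℝ} (ht : 0 < t) {f : T3 → ℂ}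
    (hf : SmoothOnTorus f) : SmoothOnTorus (transposeOp ω t f) :=
  ((smooth_transposeCoeff hω ht).mul hf).add ((smoothOnTorus_const _).mul (smooth_gradD hω hf))

/-- Insert `phase_eq` and move the derivative off the phase. The derivative of the weight is again
the weight times `-weightLogD`, so one full factor of the weight can be pulled out. -/
theorem integral_mul_phase (hω : SmoothOnTorus ω) {t : ℝ} (ht : 0 < t) {f : T3 → ℂ}
    (hf : SmoothOnTorus f) :
    ∫ k, f k * phase ω t k = ∫ k, gradWeight ω t k * transposeOp ω t f k * phase ω t k := by
  have hw := smooth_gradWeight hω ht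
  have hp := smooth_phase hω t
  have hwf := hw.mul hf
  have h1 : ∀ k, f k * phase ω t k = gradWeight ω t k * f k * phase ω t k +
      Complex.I * (gradWeight ω t k * f k * gradD ω (phase ω t) k) := fun k => by
    linear_combination f k * phase_eq hω ht k
  have h2 : ∀ k, gradWeight ω t k * transposeOp ω t f k * phase ω t k =
      gradWeight ω t k * f k * phase ω t k - (Complex.I *
        ((gradD ω (fun k => gradWeight ω t k * f k) k + laplC ω k * (gradWeight ω t k * f k)) *
          phase ω t k)) := fun k => by
    rw [gradD_mul hw hf, gradD_gradWeight hω ht, transposeOp, transposeCoeff, weightLogD]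
    ring
  have i1 := integrable_of_continuous (volume : Measure T3) (hwf.mul hp).continuous
  have i2 := integrable_of_continuous (volume : Measure T3)
    ((smoothOnTorus_const Complex.I).mul (hwf.mul (smooth_gradD hω hp))).continuous
  have i3 := integrable_of_continuous (volume : Measure T3)
    ((smoothOnTorus_const Complex.I).mul (((smooth_gradD hω hwf).add
      ((smooth_laplC hω).mul hwf)).mul hp)).continuous
  simp_rw [h1, h2]
  rw [integral_add i1 i2, integral_sub i1 i3, integral_const_mul,
    integral_const_mul, integral_mul_gradD hω hwf hp]
  ring

/-- One factor of the weight is not enough: `(1 + t|x|²)⁻¹` is not integrable over `ℝ³` after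
rescaling, while its square is. -/
theorem integral_mul_phase_twice (hω : SmoothOnTorus ω) {t : ℝ} (ht : 0 < t) {f : T3 → ℂ}
    (hf : SmoothOnTorus f) :
    ∫ k, f k * phase ω t k = ∫ k, gradWeight ω t k ^ 2 *
      ((transposeCoeff ω t k + Complex.I * weightLogD ω t k) * transposeOp ω t f k +
        -Complex.I * gradD ω (transposeOp ω t f) k) * phase ω t k := by
  have hw := smooth_gradWeight hω ht
  have hM := smooth_transposeOp hω ht hf
  rw [integral_mul_phase hω ht hf, integral_mul_phase hω ht (hw.mul hM)]
  congr 1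
  ext k
  rw [transposeOp, gradD_mul hw hM, gradD_gradWeight hω ht, weightLogD]
  ring

theorem norm_gradWeight (ω : T3 → ℝ) {t : ℝ} (ht : 0 < t) (k : T3) :
    ‖gradWeight ω t k‖ = (1 + t * gradSq ω k)⁻¹ := by
  have h : 0 < 1 + t * gradSq ω k := by
    have := mul_nonneg ht.le (gradSq_nonneg ω k); linarith
  rw [gradWeight, norm_inv, show (1 + t * (gradSq ω k : ℂ)) = ((1 + t * gradSq ω k : ℝ) : ℂ) by
    push_cast; rfl, Complex.norm_of_nonneg h.le]

/-- With `q = |∇ω|²`, this is `tq / (1 + tq) ≤ 1`: the large factor `t` is harmless next to anything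
quadratic in the gradient. -/
theorem norm_weight_mul_le {t : ℝ} (ht : 0 < t) {z : ℂ} {C : ℝ} (hC : 0 ≤ C) {k : T3}
    (hz : ‖z‖ ≤ C * gradSq ω k) : ‖(t : ℂ) * gradWeight ω t k * z‖ ≤ C := by
  have hq := gradSq_nonneg ω k
  have h : 0 < 1 + t * gradSq ω k := by
    have := mul_nonneg ht.le hq; linarith
  rw [norm_mul, norm_mul, norm_gradWeight ω ht, Complex.norm_of_nonneg ht.le,
    mul_assoc, ← div_eq_inv_mul, ← mul_div_assoc, div_le_iff₀ h]
  nlinarith [mul_le_mul_of_nonneg_left hz ht.le]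

theorem exists_bound_quadratic (hω : SmoothOnTorus ω) {B : Fin 3 → Fin 3 → T3 → ℂ}
    (hB : ∀ i j, SmoothOnTorus (B i j)) :
    ∃ C : ℝ, 0 ≤ C ∧ ∀ k, ‖∑ i, ∑ j, gradC ω i k * gradC ω j k * B i j k‖ ≤ C * gradSq ω k := by
  choose C hC0 hC using fun i j => exists_bound_of_continuous (hB i j).continuous
  refine ⟨∑ i, ∑ j, C i j, Finset.sum_nonneg fun i _ => Finset.sum_nonneg fun j _ => hC0 i j,
    fun k => ?_⟩
  have hG : ∀ i, ‖gradC ω i k‖ ^ 2 ≤ gradSq ω k := fun i => by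
    rw [gradC_eq hω, Complex.norm_real, Real.norm_eq_abs, sq_abs]
    exact Finset.single_le_sum (f := fun i => torusD i ω k ^ 2) (fun _ _ => sq_nonneg _)
      (Finset.mem_univ i)
  simp only [Finset.sum_mul]
  refine norm_sum_le_of_le _ fun i _ => norm_sum_le_of_le _ fun j _ => ?_
  rw [norm_mul, norm_mul, mul_comm]
  refine mul_le_mul (hC i j k) ?_ (by positivity) (hC0 i j)
  nlinarith [hG i, hG j, sq_nonneg (‖gradC ω i k‖ - ‖gradC ω j k‖)]

/-- Differentiating a factor `∂_i ω` along `∇ω` produces `∑ l, ∂_l ω ∂_l ∂_i ω`, which is still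
linear in the gradient. Hence quadratic forms in the gradient are stable under `∇ω·∇`, and the bound
by `|∇ω|²` survives any number of such derivatives. -/
theorem gradD_quadratic (hω : SmoothOnTorus ω) {B : Fin 3 → Fin 3 → T3 → ℂ}
    (hB : ∀ i j, SmoothOnTorus (B i j)) :
    ∃ B' : Fin 3 → Fin 3 → T3 → ℂ, (∀ i j, SmoothOnTorus (B' i j)) ∧
      gradD ω (fun k => ∑ i, ∑ j, gradC ω i k * gradC ω j k * B i j k) =
        fun k => ∑ i, ∑ j, gradC ω i k * gradC ω j k * B' i j k := by
  have hG := smooth_gradC hω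
  refine ⟨fun i j k => (∑ l, torusD i (gradC ω l) k * B l j k) +
    (∑ l, torusD j (gradC ω l) k * B i l k) + gradD ω (B i j) k, fun i j => ?_, ?_⟩
  · exact ((SmoothOnTorus.sum fun l => ((hG l).torusD i).mul (hB l j)).add
      (SmoothOnTorus.sum fun l => ((hG l).torusD j).mul (hB i l))).add (smooth_gradD hω (hB i j))
  · ext k
    have hsm : ∀ i j, SmoothOnTorus fun k => gradC ω i k * gradC ω j k * B i j k :=
      fun i j => ((hG i).mul (hG j)).mul (hB i j)
    have e : ∀ l, torusD l (fun k => ∑ i, ∑ j, gradC ω i k * gradC ω j k * B i j k) k =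
        ∑ i, ∑ j, ((torusD l (gradC ω i) k * gradC ω j k + gradC ω i k * torusD l (gradC ω j) k) *
          B i j k + gradC ω i k * gradC ω j k * torusD l (B i j) k) := fun l => by
      rw [torusD_sum fun i => SmoothOnTorus.sum fun j => hsm i j]
      refine Finset.sum_congr rfl fun i _ => ?_
      rw [torusD_sum fun j => hsm i j]
      refine Finset.sum_congr rfl fun j _ => ?_
      rw [torusD_mul ((hG i).mul (hG j)) (hB i j), torusD_mul (hG i) (hG j)]
    rw [gradD]
    simp only [e]
    simp only [gradD, Fin.sum_univ_three]
    ring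

theorem exists_bound_gradD_gradSq (hω : SmoothOnTorus ω) :
    ∃ C : ℝ, 0 ≤ C ∧ (∀ k, ‖gradD ω (fun k => (gradSq ω k : ℂ)) k‖ ≤ C * gradSq ω k) ∧
      ∀ k, ‖gradD ω (gradD ω fun k => (gradSq ω k : ℂ)) k‖ ≤ C * gradSq ω k := by
  have h0 : (fun k => (gradSq ω k : ℂ)) = fun k => ∑ i, ∑ j, gradC ω i k * gradC ω j k *
      (fun _ : T3 => if i = j then (1 : ℂ) else 0) k := by
    ext k
    simp [gradSq_eq hω]
  obtain ⟨B₁, hB₁, h1⟩ := gradD_quadratic hω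
    (B := fun i j _ => if i = j then (1 : ℂ) else 0) fun i j => smoothOnTorus_const _
  obtain ⟨B₂, hB₂, h2⟩ := gradD_quadratic hω hB₁
  obtain ⟨C₁, hC₁, b1⟩ := exists_bound_quadratic hω hB₁
  obtain ⟨C₂, hC₂, b2⟩ := exists_bound_quadratic hω hB₂
  rw [h0, h1, h2]
  refine ⟨C₁ + C₂, by positivity, fun k => (b1 k).trans ?_, fun k => (b2 k).trans ?_⟩ <;>
    nlinarith [gradSq_nonneg ω k]

theorem exists_bound_gradD (hω : SmoothOnTorus ω) :
    ∃ C : ℝ, 0 ≤ C ∧ ∀ f : T3 → ℂ, SmoothOnTorus f → ∀ k,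
      ‖gradD ω f k‖ ≤ C * supNorm 2 f ∧ ‖gradD ω (gradD ω f) k‖ ≤ C * supNorm 2 f := by
  have hG := smooth_gradC hω
  choose C hC0 hC using fun i => exists_bound_of_continuous (hG i).continuous
  choose C' hC'0 hC' using fun i j => exists_bound_of_continuous ((hG j).torusD i).continuous
  have n1 : 0 ≤ ∑ i, C i := Finset.sum_nonneg fun i _ => hC0 i
  have n2 : 0 ≤ ∑ i, ∑ j, C i * (C' i j + C j) := Finset.sum_nonneg fun i _ =>
    Finset.sum_nonneg fun j _ => mul_nonneg (hC0 i) (add_nonneg (hC'0 i j) (hC0 j))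
  refine ⟨∑ i, C i + ∑ i, ∑ j, C i * (C' i j + C j), by positivity, fun f hf k => ?_⟩
  have hN : 0 ≤ supNorm 2 f := (norm_nonneg _).trans (norm_le_supNorm hf 2 k)
  constructor
  · refine le_trans ?_ (mul_le_mul_of_nonneg_right (le_add_of_nonneg_right n2) hN)
    rw [Finset.sum_mul]
    refine norm_sum_le_of_le _ fun i _ => ?_
    rw [norm_mul]
    exact mul_le_mul (hC i k) (norm_torusD_le_supNorm hf one_le_two i k) (norm_nonneg _) (hC0 i)
  · refine le_trans ?_ (mul_le_mul_of_nonneg_right (le_add_of_nonneg_left n1) hN)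
    have e : gradD ω (gradD ω f) k = ∑ i, ∑ j, gradC ω i k *
        (torusD i (gradC ω j) k * torusD j f k + gradC ω j k * torusD i (torusD j f) k) := by
      simp only [← Finset.mul_sum]
      refine Finset.sum_congr rfl fun i _ => ?_
      congr 1
      unfold gradD
      rw [torusD_sum fun j => (hG j).mul (hf.torusD j)]
      exact Finset.sum_congr rfl fun j _ => torusD_mul (hG j) (hf.torusD j) i k
    rw [e]
    simp only [Finset.sum_mul]
    refine norm_sum_le_of_le _ fun i _ => norm_sum_le_of_le _ fun j _ => ?_
    rw [norm_mul, mul_assoc]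
    refine mul_le_mul (hC i k) ?_ (norm_nonneg _) (hC0 i)
    rw [add_mul]
    refine (norm_add_le _ _).trans (add_le_add ?_ ?_)
    · rw [norm_mul]
      exact mul_le_mul (hC' i j k) (norm_torusD_le_supNorm hf one_le_two j k) (norm_nonneg _)
        (hC'0 i j)
    · rw [norm_mul]
      exact mul_le_mul (hC j k) (norm_torusD_torusD_le_supNorm hf le_rfl i j k) (norm_nonneg _)
        (hC0 j)

/-- The point is that `K` does not depend on `t`. The parameter enters the coefficients only through
`weightLogD` and its derivative along the gradient, and both are bounded because `∇ω·∇`, applied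
once or twice to `|∇ω|²`, is `O(|∇ω|²)`. -/
theorem exists_bound_transposeOp (hω : SmoothOnTorus ω) :
    ∃ K : ℝ, 0 ≤ K ∧ ∀ t : ℝ, 0 < t → ∀ f : T3 → ℂ, SmoothOnTorus f → ∀ k,
      ‖(transposeCoeff ω t k + Complex.I * weightLogD ω t k) * transposeOp ω t f k +
        -Complex.I * gradD ω (transposeOp ω t f) k‖ ≤ K * supNorm 2 f := by
  obtain ⟨C, hC0, hC1, hC2⟩ := exists_bound_gradD_gradSq hω
  obtain ⟨D, hD0, hD⟩ := exists_bound_gradD hω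
  obtain ⟨L, hL0, hL⟩ := exists_bound_of_continuous (smooth_laplC hω).continuous
  obtain ⟨L', hL'0, hL'⟩ :=
    exists_bound_of_continuous (smooth_gradD hω (smooth_laplC hω)).continuous
  set A := 1 + L + C with hA
  set A' := L' + (C ^ 2 + C) with hA'
  have hA0 : 0 ≤ A := by positivity
  have hA'0 : 0 ≤ A' := by positivity
  refine ⟨(A + C) * (A + D) + (A' + A * D + D), by positivity, fun t ht f hf k => ?_⟩
  have hN := norm_le_supNorm hf 2 k
  have hN0 : 0 ≤ supNorm 2 f := (norm_nonneg _).trans hN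
  obtain ⟨d1, d2⟩ := hD f hf k
  have hθ : ‖weightLogD ω t k‖ ≤ C := norm_weight_mul_le ht hC0 (hC1 k)
  have hθ' : ‖gradD ω (weightLogD ω t) k‖ ≤ C ^ 2 + C := by
    rw [gradD_weightLogD hω ht]
    refine (norm_add_le _ _).trans (add_le_add ?_ (norm_weight_mul_le ht hC0 (hC2 k)))
    rw [norm_neg, norm_pow]
    gcongr
  have hI : ∀ z : ℂ, ‖Complex.I * z‖ = ‖z‖ := fun z => by simp
  have hnI : ∀ z : ℂ, ‖-Complex.I * z‖ = ‖z‖ := fun z => by simp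
  have ha : ‖transposeCoeff ω t k‖ ≤ A := by
    refine (norm_add_le _ _).trans (add_le_add ((norm_add_le _ _).trans ?_) ?_)
    · rw [hnI, norm_one]; linarith [hL k]
    · rwa [hI]
  have ha' : ‖gradD ω (transposeCoeff ω t) k‖ ≤ A' := by
    rw [gradD_transposeCoeff hω ht]
    refine (norm_add_le _ _).trans (add_le_add ?_ ?_)
    · rw [hnI]; exact hL' k
    · rwa [hI]
  have hM : ‖transposeOp ω t f k‖ ≤ (A + D) * supNorm 2 f := by
    rw [add_mul]
    refine (norm_add_le _ _).trans (add_le_add ?_ ?_)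
    · rw [norm_mul]; exact mul_le_mul ha hN (norm_nonneg _) hA0
    · rwa [hnI]
  have hM' : ‖gradD ω (transposeOp ω t f) k‖ ≤ (A' + A * D + D) * supNorm 2 f := by
    have e : gradD ω (transposeOp ω t f) k = gradD ω (transposeCoeff ω t) k * f k +
        transposeCoeff ω t k * gradD ω f k + -Complex.I * gradD ω (gradD ω f) k := by
      unfold transposeOp
      rw [gradD_add ((smooth_transposeCoeff hω ht).mul hf)
        ((smoothOnTorus_const _).mul (smooth_gradD hω hf)),
        gradD_mul (smooth_transposeCoeff hω ht) hf, gradD_const_mul (smooth_gradD hω hf)]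
    rw [e, add_mul, add_mul]
    refine (norm_add_le _ _).trans (add_le_add ((norm_add_le _ _).trans (add_le_add ?_ ?_)) ?_)
    · rw [norm_mul]; exact mul_le_mul ha' hN (norm_nonneg _) hA'0
    · rw [norm_mul, mul_assoc]; exact mul_le_mul ha d1 (norm_nonneg _) hA0
    · rwa [hnI]
  rw [add_mul ((A + C) * (A + D))]
  refine (norm_add_le _ _).trans (add_le_add ?_ ?_)
  · rw [norm_mul, mul_assoc]
    refine mul_le_mul ((norm_add_le _ _).trans (add_le_add ha ?_)) hM (norm_nonneg _) (by positivity)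
    rwa [hI]
  · rwa [hnI]

theorem continuous_gradSq (hω : SmoothOnTorus ω) : Continuous (gradSq ω) :=
  continuous_finsetSum _ fun i _ => (hω.torusD i).continuous.pow 2

theorem norm_integral_mul_phase_le (hω : SmoothOnTorus ω) :
    ∃ K : ℝ, 0 ≤ K ∧ ∀ t : ℝ, 0 < t → ∀ f : T3 → ℂ, SmoothOnTorus f →
      ‖∫ k, f k * phase ω t k‖ ≤ K * supNorm 2 f * ∫ k, ((1 + t * gradSq ω k) ^ 2)⁻¹ := by
  obtain ⟨K, hK0, hK⟩ := exists_bound_transposeOp hω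
  refine ⟨K, hK0, fun t ht f hf => ?_⟩
  have hpos : ∀ k, 0 < 1 + t * gradSq ω k := fun k => by
    have := mul_nonneg ht.le (gradSq_nonneg ω k); linarith
  rw [integral_mul_phase_twice hω ht hf, ← integral_const_mul]
  refine norm_integral_le_of_norm_le (integrable_of_continuous _ ?_)
    (Filter.Eventually.of_forall fun k => ?_)
  · refine continuous_const.mul (Continuous.inv₀ ?_ fun k => (pow_pos (hpos k) 2).ne')
    exact (continuous_const.add (continuous_const.mul (continuous_gradSq hω))).pow 2
  · rw [norm_mul, norm_mul, norm_phase, mul_one, norm_pow, norm_gradWeight ω ht, inv_pow, mul_comm]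
    exact mul_le_mul_of_nonneg_right (hK t ht f hf k) (inv_nonneg.2 (pow_pos (hpos k) 2).le)

end

/-! ### The measure of the torus -/

theorem volume_unitAddCircle : (volume : Measure UnitAddCircle) = AddCircle.haarAddCircle := by
  rw [AddCircle.volume_eq_smul_haarAddCircle, ENNReal.ofReal_one, one_smul]

theorem volume_T3 : (volume : Measure T3) = Measure.pi fun _ => AddCircle.haarAddCircle := by
  rw [← volume_unitAddCircle]; rfl

instance isProbabilityMeasure_volume_unitAddCircle :
    IsProbabilityMeasure (volume : Measure UnitAddCircle) :=
  ⟨UnitAddCircle.measure_univ⟩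

instance isProbabilityMeasure_volume_T3 : IsProbabilityMeasure (volume : Measure T3) := by
  rw [volume_T3]; infer_instance

theorem lintegral_T3 (f : T3 → ENNReal) : ∫⁻ k, f k =
    ∫⁻ x in {x : Fin 3 → ℝ | ∀ i, x i ∈ Set.Ioc 0 (0 + 1)}, f (torusMk x) := by
  rw [volume_T3]
  exact UnitAddTorus.lintegral_preimage f 0

/-! ### Dispersivity of Morse functions -/

theorem differentiable_fderiv_periodicExt {ω : T3 → ℝ} (hω : SmoothOnTorus ω) :
    Differentiable ℝ (fderiv ℝ (periodicExt ω)) :=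
  (ContDiff.fderiv_right (m := (⊤ : ℕ∞)) hω (by simp)).differentiable (by simp)

/-- In finite dimension an injective linear map is bounded below; this quantifies non-degeneracy of
the Hessian. -/
theorem exists_antilipschitz_of_nondegenerate
    {A : (Fin 3 → ℝ) →L[ℝ] (Fin 3 → ℝ) →L[ℝ] ℝ} (hA : ∀ v, (∀ w, A v w = 0) → v = 0) :
    ∃ K > 0, AntilipschitzWith K A :=
  LinearMap.exists_antilipschitzWith (A : (Fin 3 → ℝ) →ₗ[ℝ] (Fin 3 → ℝ) →L[ℝ] ℝ)
    (LinearMap.ker_eq_bot'.2 fun v hv => hA v fun w => by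
      have h : A v = 0 := hv
      rw [h]; rfl)

/-- Non-degenerate critical points are isolated. -/
theorem IsMorse.of_nondegenerate {ω : T3 → ℝ} (hω : SmoothOnTorus ω)
    (h : ∀ x : Fin 3 → ℝ, fderiv ℝ (periodicExt ω) x = 0 → ∀ v : Fin 3 → ℝ,
      (∀ w : Fin 3 → ℝ, fderiv ℝ (fderiv ℝ (periodicExt ω)) x v w = 0) → v = 0) : IsMorse ω where
  smooth := hω
  isolated x hx := by
    obtain ⟨K, -, hK⟩ := exists_antilipschitz_of_nondegenerate (h x hx)
    exact (differentiable_fderiv_periodicExt hω x).hasFDerivAt.eventually_ne ⟨K, hK⟩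
  nondegenerate := h

theorem IsMorse.neg {ω : T3 → ℝ} (h : IsMorse ω) : IsMorse fun k => -ω k := by
  have e : periodicExt (fun k => -ω k) = -periodicExt ω := rfl
  have e1 : fderiv ℝ (-periodicExt ω) = -fderiv ℝ (periodicExt ω) := by
    ext1 x; rw [fderiv_neg]; rfl
  refine .of_nondegenerate (ContDiff.neg h.smooth) fun x hx v hv => ?_
  rw [e, e1] at hx
  refine h.nondegenerate x (neg_eq_zero.1 hx) v fun w => ?_
  have := hv w
  rw [e, e1, fderiv_neg] at this
  simpa using this

/-- `Fin 3 → ℝ` carries the sup norm, so the operator norm is bounded by the `ℓ¹` norm of the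
partial derivatives; Cauchy-Schwarz over three coordinates gives the factor `3`. -/
theorem norm_fderiv_sq_le {ω : T3 → ℝ} (hω : SmoothOnTorus ω) (x : Fin 3 → ℝ) :
    ‖fderiv ℝ (periodicExt ω) x‖ ^ 2 ≤ 3 * gradSq ω (torusMk x) := by
  set A := fderiv ℝ (periodicExt ω) x
  have hA : ‖A‖ ≤ ∑ i, |A (Pi.single i 1)| := by
    refine A.opNorm_le_bound (Finset.sum_nonneg fun _ _ => abs_nonneg _) fun v => ?_
    have hv : A v = ∑ i, v i * A (Pi.single i 1) := by
      conv_lhs => rw [pi_eq_sum_univ' v, map_sum]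
      refine Finset.sum_congr rfl fun i _ => ?_
      rw [map_smul, smul_eq_mul]
    rw [hv, Finset.sum_mul]
    refine norm_sum_le_of_le _ fun i _ => ?_
    rw [norm_mul, mul_comm]
    exact mul_le_mul_of_nonneg_left (norm_le_pi_norm v i) (abs_nonneg _)
  have hq : gradSq ω (torusMk x) = ∑ i, A (Pi.single i 1) ^ 2 := by
    simp only [gradSq, torusD_torusMk hω]; rfl
  calc ‖A‖ ^ 2 ≤ (∑ i, |A (Pi.single i 1)|) ^ 2 := by gcongr
    _ ≤ 3 * ∑ i, |A (Pi.single i 1)| ^ 2 := by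
        simpa using sq_sum_le_card_mul_sum_sq (s := Finset.univ) (f := fun i => |A (Pi.single i 1)|)
    _ = 3 * gradSq ω (torusMk x) := by simp only [sq_abs, hq]

theorem continuous_gradSq_torusMk {ω : T3 → ℝ} (hω : SmoothOnTorus ω) :
    Continuous fun x => gradSq ω (torusMk x) :=
  (continuous_gradSq hω).comp isOpenQuotientMap_torusMk.continuous

/-- Near every point, the gradient of a Morse function grows at least linearly. -/
theorem IsMorse.exists_gradSq_ge {ω : T3 → ℝ} (h : IsMorse ω) (x₀ : Fin 3 → ℝ) :
    ∃ c : ℝ, 0 < c ∧ ∀ᶠ x in 𝓝 x₀, (c * ‖x - x₀‖) ^ 2 ≤ gradSq ω (torusMk x) := by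
  have hω := h.smooth
  rcases (gradSq_nonneg ω (torusMk x₀)).eq_or_lt with h0 | h0
  · have hx : fderiv ℝ (periodicExt ω) x₀ = 0 := by
      have := norm_fderiv_sq_le hω x₀
      rw [← h0, mul_zero] at this
      simpa using this
    obtain ⟨K, hK0, hK⟩ := exists_antilipschitz_of_nondegenerate (h.nondegenerate x₀ hx)
    have hK0' : (0 : ℝ) < K := hK0
    -- The Hessian gives the slope `1/K`. Half of it is spent on the Taylor remainder, and a further
    -- factor `2 ≥ √3` absorbs the constant of `norm_fderiv_sq_le`.
    refine ⟨1 / (4 * K), by positivity, ?_⟩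
    have hd := (differentiable_fderiv_periodicExt hω x₀).hasFDerivAt.isLittleO.def
      (show 0 < 1 / (2 * (K : ℝ)) by positivity)
    filter_upwards [hd] with x hdx
    set A := fderiv ℝ (fderiv ℝ (periodicExt ω)) x₀
    have h1 : ‖x - x₀‖ ≤ K * ‖A (x - x₀)‖ := by simpa using hK.le_mul_dist (x - x₀) 0
    rw [hx, sub_zero] at hdx
    have h2 := norm_fderiv_sq_le hω x
    have h3 : ‖A (x - x₀)‖ ≤ ‖fderiv ℝ (periodicExt ω) x‖ + 1 / (2 * K) * ‖x - x₀‖ := by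
      have := norm_sub_norm_le (A (x - x₀)) (fderiv ℝ (periodicExt ω) x)
      rw [norm_sub_rev] at this
      linarith
    have h4 : 1 / (2 * K) * ‖x - x₀‖ ≤ ‖fderiv ℝ (periodicExt ω) x‖ := by
      have h5 : 1 / K * ‖x - x₀‖ ≤ ‖A (x - x₀)‖ := by
        rw [one_div, inv_mul_le_iff₀ hK0']; exact h1
      have h6 : 1 / K * ‖x - x₀‖ = 1 / (2 * K) * ‖x - x₀‖ + 1 / (2 * K) * ‖x - x₀‖ := by
        field_simp; ring
      linarith
    have h7 : (1 / (2 * K) * ‖x - x₀‖) ^ 2 ≤ ‖fderiv ℝ (periodicExt ω) x‖ ^ 2 := by gcongr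
    have h8 : (1 / (2 * K) * ‖x - x₀‖) ^ 2 = 4 * (1 / (4 * K) * ‖x - x₀‖) ^ 2 := by
      field_simp; ring
    nlinarith [sq_nonneg (1 / (4 * K) * ‖x - x₀‖)]
  -- Away from critical points `|∇ω|²` stays above half its value at `x₀`, and `‖x - x₀‖ ≤ 1` on the
  -- unit ball.
  · refine ⟨√(gradSq ω (torusMk x₀) / 2), by positivity, ?_⟩
    filter_upwards [Metric.ball_mem_nhds x₀ one_pos,
      (continuous_gradSq_torusMk hω).continuousAt.eventually (lt_mem_nhds (half_lt_self h0))]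
      with x hx1 hx2
    rw [mul_pow, Real.sq_sqrt (by positivity)]
    have : ‖x - x₀‖ ^ 2 ≤ 1 := pow_le_one₀ (norm_nonneg _) (mem_ball_iff_norm.1 hx1).le
    nlinarith

theorem rpow_neg_three_halves {t : ℝ} (ht : 0 < t) : (√t ^ 3)⁻¹ = t ^ (-(3 / 2) : ℝ) := by
  rw [Real.rpow_neg ht.le, Real.sqrt_eq_rpow, ← Real.rpow_natCast, ← Real.rpow_mul ht.le]
  norm_num

/-- The integral of `(1 + ‖y‖)⁻⁴` over `ℝ³`. -/
def japaneseConst : ℝ := ∫ y : Fin 3 → ℝ, (1 + ‖y‖) ^ (-4 : ℝ)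

/-- The substitution `y = √t c (x - x₀)` has Jacobian factor `(√t c)⁻³`, which is the origin of the
rate `t^(-3/2)`. The remaining integral converges since `(1 + ‖y‖)⁻⁴` is integrable in dimension
three. -/
theorem lintegral_local_le {c : ℝ} (hc : 0 < c) (x₀ : Fin 3 → ℝ) {t : ℝ} (ht : 0 < t) :
    ∫⁻ x : Fin 3 → ℝ, ENNReal.ofReal (((1 + t * (c * ‖x - x₀‖) ^ 2) ^ 2)⁻¹) ≤
      ENNReal.ofReal (4 * japaneseConst * (c ^ 3)⁻¹ * t ^ (-(3 / 2) : ℝ)) := by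
  set R := √t * c with hR
  have hR0 : 0 < R := by positivity
  have hint : Integrable fun y : Fin 3 → ℝ => (1 + ‖y‖) ^ (-4 : ℝ) :=
    integrable_one_add_norm (by simp; norm_num)
  have hint' : Integrable fun x : Fin 3 → ℝ => (1 + ‖R • (x - x₀)‖) ^ (-4 : ℝ) :=
    (hint.comp_smul hR0.ne').comp_sub_right x₀
  calc ∫⁻ x : Fin 3 → ℝ, ENNReal.ofReal (((1 + t * (c * ‖x - x₀‖) ^ 2) ^ 2)⁻¹)
      ≤ ∫⁻ x : Fin 3 → ℝ, ENNReal.ofReal (4 * (1 + ‖R • (x - x₀)‖) ^ (-4 : ℝ)) := by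
        refine lintegral_mono fun x => ENNReal.ofReal_le_ofReal ?_
        set s := ‖R • (x - x₀)‖ with hs
        have hs0 : 0 ≤ s := norm_nonneg _
        have e : t * (c * ‖x - x₀‖) ^ 2 = s ^ 2 := by
          rw [hs, norm_smul, Real.norm_of_nonneg hR0.le, hR, mul_pow, mul_pow, mul_pow,
            Real.sq_sqrt ht.le, mul_assoc]
        have e4 : (1 + s) ^ (-4 : ℝ) = ((1 + s) ^ 4)⁻¹ := by
          rw [Real.rpow_neg (by positivity)]
          congr 1
          exact_mod_cast Real.rpow_natCast (1 + s) 4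
        rw [e, e4, ← div_eq_mul_inv, inv_le_iff_one_le_mul₀ (by positivity), ← mul_div_right_comm,
          le_div_iff₀ (by positivity), one_mul]
        have : (1 + s) ^ 2 ≤ 2 * (1 + s ^ 2) := by nlinarith [sq_nonneg (1 - s)]
        calc (1 + s) ^ 4 = ((1 + s) ^ 2) ^ 2 := by ring
          _ ≤ (2 * (1 + s ^ 2)) ^ 2 := by gcongr
          _ = 4 * (1 + s ^ 2) ^ 2 := by ring
    _ = ENNReal.ofReal (∫ x : Fin 3 → ℝ, 4 * (1 + ‖R • (x - x₀)‖) ^ (-4 : ℝ)) :=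
        (ofReal_integral_eq_lintegral_ofReal (hint'.const_mul 4)
          (Filter.Eventually.of_forall fun x => by positivity)).symm
    _ = ENNReal.ofReal (4 * japaneseConst * (c ^ 3)⁻¹ * t ^ (-(3 / 2) : ℝ)) := by
        congr 1
        rw [integral_const_mul,
          integral_sub_right_eq_self (fun x : Fin 3 → ℝ => (1 + ‖R • x‖) ^ (-4 : ℝ)) x₀,
          Measure.integral_comp_smul volume (fun x : Fin 3 → ℝ => (1 + ‖x‖) ^ (-4 : ℝ)) R,
          ← rpow_neg_three_halves ht, abs_of_pos (by positivity), hR]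
        simp only [Module.finrank_fintype_fun_eq_card, Fintype.card_fin, smul_eq_mul, mul_pow,
          mul_inv, japaneseConst]
        ring

/-- The bound holds near each point of the closed unit cube, with a constant depending on the point;
compactness of the cube leaves finitely many constants to add. -/
theorem IsMorse.exists_integral_weight_le {ω : T3 → ℝ} (h : IsMorse ω) :
    ∃ C : ℝ, 0 ≤ C ∧ ∀ t : ℝ, 0 < t →
      ∫ k, ((1 + t * gradSq ω k) ^ 2)⁻¹ ≤ C * t ^ (-(3 / 2) : ℝ) := by
  set F : ℝ → T3 → ℝ := fun t k => ((1 + t * gradSq ω k) ^ 2)⁻¹ with hF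
  have hpos : ∀ t : ℝ, 0 < t → ∀ k, 0 < 1 + t * gradSq ω k := fun t ht k => by
    have := mul_nonneg ht.le (gradSq_nonneg ω k); linarith
  have key : ∃ C : NNReal, ∀ t : ℝ, 0 < t →
      ∫⁻ x in Set.Icc (0 : Fin 3 → ℝ) 1, ENNReal.ofReal (F t (torusMk x)) ≤
        C * ENNReal.ofReal (t ^ (-(3 / 2) : ℝ)) := by
    refine isCompact_Icc.induction_on (p := fun S => ∃ C : NNReal, ∀ t : ℝ, 0 < t →
      ∫⁻ x in S, ENNReal.ofReal (F t (torusMk x)) ≤ C * ENNReal.ofReal (t ^ (-(3 / 2) : ℝ)))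
      ⟨0, by simp⟩ ?_ ?_ ?_
    · rintro s s' hss ⟨C, hC⟩
      exact ⟨C, fun t ht => (lintegral_mono_set hss).trans (hC t ht)⟩
    · rintro s s' ⟨C, hC⟩ ⟨C', hC'⟩
      refine ⟨C + C', fun t ht => (lintegral_union_le _ _ _).trans ?_⟩
      rw [ENNReal.coe_add, add_mul]
      exact add_le_add (hC t ht) (hC' t ht)
    · intro x₀ _
      obtain ⟨c, hc, hev⟩ := h.exists_gradSq_ge x₀
      obtain ⟨U, hU, hUo, hxU⟩ := eventually_nhds_iff.1 hev
      refine ⟨U, mem_nhdsWithin_of_mem_nhds (hUo.mem_nhds hxU),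
        Real.toNNReal (4 * japaneseConst * (c ^ 3)⁻¹), fun t ht => ?_⟩
      have hJ : 0 ≤ japaneseConst := integral_nonneg fun y => by positivity
      calc ∫⁻ x in U, ENNReal.ofReal (F t (torusMk x))
          ≤ ∫⁻ x in U, ENNReal.ofReal (((1 + t * (c * ‖x - x₀‖) ^ 2) ^ 2)⁻¹) := by
            refine setLIntegral_mono' hUo.measurableSet fun x hx => ENNReal.ofReal_le_ofReal ?_
            have := hU x hx
            exact inv_anti₀ (by positivity) (by gcongr)
        _ ≤ ∫⁻ x, ENNReal.ofReal (((1 + t * (c * ‖x - x₀‖) ^ 2) ^ 2)⁻¹) :=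
            setLIntegral_le_lintegral _ _
        _ ≤ _ := lintegral_local_le hc x₀ ht
        _ = _ := by
            rw [ENNReal.ofReal_mul (by positivity)]; rfl
  obtain ⟨C, hC⟩ := key
  refine ⟨C, C.coe_nonneg, fun t ht => ?_⟩
  have hcont : Continuous (F t) := Continuous.inv₀
    ((continuous_const.add (continuous_const.mul (continuous_gradSq h.smooth))).pow 2)
    fun k => (pow_pos (hpos t ht k) 2).ne'
  have h0 : 0 ≤ C * t ^ (-(3 / 2) : ℝ) := by positivity
  rw [integral_eq_lintegral_of_nonneg_ae
    (Filter.Eventually.of_forall fun k => inv_nonneg.2 (pow_pos (hpos t ht k) 2).le)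
    hcont.aestronglyMeasurable]
  refine ENNReal.toReal_le_of_le_ofReal h0 ?_
  rw [lintegral_T3, ENNReal.ofReal_mul C.coe_nonneg, ENNReal.ofReal_coe_nnreal]
  refine le_trans (lintegral_mono_set fun x hx => ?_) (hC t ht)
  exact ⟨fun i => by simpa using (hx i).1.le, fun i => by simpa using (hx i).2⟩

theorem bracket_pos (x : ℝ) : 0 < bracket x := Real.sqrt_pos.2 (by positivity)

theorem bracket_le {t : ℝ} (ht : 1 ≤ t) : bracket t ≤ 2 * t := by
  rw [bracket, Real.sqrt_le_left (by positivity)]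
  nlinarith

theorem bracket_neg (t : ℝ) : bracket (-t) = bracket t := by simp [bracket]

/-- For `t ≥ 1` the bracket is comparable to `t`. Two derivatives of `f` enter, one for each
integration by parts. -/
theorem IsMorse.dispersive_of_one_le {ω : T3 → ℝ} (h : IsMorse ω) :
    ∃ c : ℝ, 0 < c ∧ ∀ t : ℝ, 1 ≤ t → ∀ f : T3 → ℂ, SmoothOnTorus f →
      ‖∫ k, f k * phase ω t k‖ ≤ c / bracket t ^ (3 / 2 : ℝ) * supNorm 2 f := by
  obtain ⟨K, hK0, hK⟩ := norm_integral_mul_phase_le h.smooth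
  obtain ⟨C, hC0, hC⟩ := h.exists_integral_weight_le
  refine ⟨K * C * 2 ^ (3 / 2 : ℝ) + 1, by positivity, fun t ht f hf => ?_⟩
  have ht0 : 0 < t := one_pos.trans_le ht
  have hb := bracket_pos t
  have hN : 0 ≤ supNorm 2 f := (norm_nonneg _).trans (norm_le_supNorm hf 2 0)
  have h1 : t ^ (-(3 / 2) : ℝ) ≤ 2 ^ (3 / 2 : ℝ) / bracket t ^ (3 / 2 : ℝ) := by
    rw [Real.rpow_neg ht0.le, le_div_iff₀ (by positivity), inv_mul_le_iff₀ (by positivity),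
      ← Real.mul_rpow ht0.le two_pos.le]
    exact Real.rpow_le_rpow hb.le (by linarith [bracket_le ht]) (by norm_num)
  calc ‖∫ k, f k * phase ω t k‖ ≤ K * supNorm 2 f * (C * t ^ (-(3 / 2) : ℝ)) :=
        (hK t ht0 f hf).trans (mul_le_mul_of_nonneg_left (hC t ht0) (by positivity))
    _ ≤ K * supNorm 2 f * (C * (2 ^ (3 / 2 : ℝ) / bracket t ^ (3 / 2 : ℝ))) := by gcongr
    _ = (K * C * 2 ^ (3 / 2 : ℝ)) / bracket t ^ (3 / 2 : ℝ) * supNorm 2 f := by ring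
    _ ≤ _ := by gcongr; linarith

/-- Smooth functions with non-degenerate critical points are dispersive. -/
theorem IsMorse.dispersive {ω : T3 → ℝ} (h : IsMorse ω) : Dispersive ω := by
  obtain ⟨c₁, hc₁, h1⟩ := h.dispersive_of_one_le
  obtain ⟨c₂, hc₂, h2⟩ := h.neg.dispersive_of_one_le
  refine ⟨2, c₁ + c₂ + 2 ^ (3 / 2 : ℝ), by positivity, fun t f hf => ?_⟩
  change ‖∫ k, f k * phase ω t k‖ ≤ _
  have hN : 0 ≤ supNorm 2 f := (norm_nonneg _).trans (norm_le_supNorm hf 2 0)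
  have hb := bracket_pos t
  have h3 : (0 : ℝ) < 2 ^ (3 / 2 : ℝ) := by positivity
  rcases le_or_gt 1 t with ht | ht
  · refine (h1 t ht f hf).trans ?_
    gcongr
    linarith
  -- The weight `(1 + t|∇ω|²)⁻¹` requires `t > 0`; negative times are traded for the Morse function
  -- `-ω`.
  rcases le_or_gt 1 (-t) with ht' | ht'
  · have e : phase ω t = phase (fun k => -ω k) (-t) := by
      ext k; simp [phase]
    rw [e]
    refine (h2 (-t) ht' f hf).trans ?_
    rw [bracket_neg]
    gcongr
    linarith
  -- For `|t| < 1` there is nothing to gain: the trivial bound suffices, at the price of the summand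
  -- `2^(3/2)` in the constant.
  · have hb2 : bracket t ≤ 2 := by
      rw [bracket, Real.sqrt_le_left two_pos.le]; nlinarith
    have h4 : bracket t ^ (3 / 2 : ℝ) ≤ 2 ^ (3 / 2 : ℝ) :=
      Real.rpow_le_rpow hb.le hb2 (by norm_num)
    have h5 : 1 ≤ (c₁ + c₂ + 2 ^ (3 / 2 : ℝ)) / bracket t ^ (3 / 2 : ℝ) := by
      rw [one_le_div (by positivity)]; linarith
    calc ‖∫ k, f k * phase ω t k‖ ≤ supNorm 2 f * volume.real (Set.univ : Set T3) :=
          norm_integral_le_of_norm_le_const (Filter.Eventually.of_forall fun k => by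
            rw [norm_mul, norm_phase, mul_one]; exact norm_le_supNorm hf 2 k)
      _ = 1 * supNorm 2 f := by simp [mul_comm]
      _ ≤ _ := by gcongr

/-! ### The square root of a dispersion relation -/

/-- In the second derivative of `√ω`, the term that differentiates the prefactor `1/(2√ω)` carries a
factor `∇ω`, which vanishes at a critical point. What is left is the Hessian of `ω` times a non-zero
number. -/
theorem IsMorse.sqrt {ω : T3 → ℝ} (h : IsMorse ω) (hpos : ∀ k, 0 < ω k) :
    IsMorse fun k => √(ω k) := by
  set F := periodicExt ω with hF
  have hFpos : ∀ x, 0 < F x := fun x => hpos (torusMk x)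
  have hFs : ContDiff ℝ (⊤ : ℕ∞) F := h.smooth
  have hFd : Differentiable ℝ F := hFs.differentiable (by simp)
  have hs : SmoothOnTorus fun k => √(ω k) := ContDiff.sqrt h.smooth fun x => (hFpos x).ne'
  have hd1 : fderiv ℝ (periodicExt fun k => √(ω k)) =
      fun x => (1 / (2 * √(F x))) • fderiv ℝ F x := by
    ext1 x
    exact ((hFd x).hasFDerivAt.sqrt (hFpos x).ne').fderiv
  have hc : ∀ x, 1 / (2 * √(F x)) ≠ 0 := fun x => by
    have := Real.sqrt_pos.2 (hFpos x)
    positivity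
  refine .of_nondegenerate hs fun x hx v hv => ?_
  rw [hd1] at hx hv
  have hx0 : fderiv ℝ F x = 0 := (smul_eq_zero.1 hx).resolve_left (hc x)
  refine h.nondegenerate x hx0 v fun w => ?_
  have hsd : DifferentiableAt ℝ (fun x => 1 / (2 * √(F x))) x := by
    have hg : DifferentiableAt ℝ (fun x => 2 * √(F x)) x :=
      ((hFd x).sqrt (hFpos x).ne').const_mul 2
    simp only [one_div]
    exact hg.fun_inv (mul_pos two_pos (Real.sqrt_pos.2 (hFpos x))).ne'
  have h2 := hv w
  have hFdd : DifferentiableAt ℝ (fderiv ℝ F) x := differentiable_fderiv_periodicExt h.smooth x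
  rw [fderiv_fun_smul hsd hFdd] at h2
  simp only [hx0, add_apply, smul_apply, ContinuousLinearMap.smulRight_apply, smul_zero,
    add_zero, smul_eq_mul] at h2
  exact (mul_eq_zero.1 h2).resolve_left (hc x)

/-- The distance `|x + iβ|`, for real `x` and `β`. -/
def resDenom (β x : ℝ) : ℝ := ‖(x : ℂ) + Complex.I * β‖

theorem resDenom_eq (β x : ℝ) : resDenom β x = √(x ^ 2 + β ^ 2) := by
  rw [resDenom, mul_comm, Complex.norm_add_mul_I]

theorem resDenom_pos {β : ℝ} (hβ : 0 < β) (x : ℝ) : 0 < resDenom β x := by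
  rw [resDenom_eq]; positivity

theorem abs_le_resDenom (β x : ℝ) : |x| ≤ resDenom β x := by
  rw [resDenom_eq, ← Real.sqrt_sq_eq_abs]
  exact Real.sqrt_le_sqrt (by nlinarith [sq_nonneg β])

theorem le_resDenom (β x : ℝ) : β ≤ resDenom β x := by
  rw [resDenom_eq]
  exact (le_abs_self β).trans
    ((Real.sqrt_sq_eq_abs β).symm.le.trans (Real.sqrt_le_sqrt (by nlinarith [sq_nonneg x])))

theorem resDenom_le {β : ℝ} (hβ : 0 ≤ β) (x : ℝ) : resDenom β x ≤ |x| + β := by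
  refine (norm_add_le _ _).trans (add_le_add ?_ ?_)
  · simp
  · simp [abs_of_nonneg hβ]

theorem continuous_resDenom (β : ℝ) : Continuous (resDenom β) := by
  unfold resDenom; fun_prop

/-- The integrand of the crossing estimate, with three dispersion relations `g i`. -/
def crossingIntegrand (β : ℝ) (u : T3) (g : Fin 3 → T3 → ℝ) (k : T3 × T3) : ℝ :=
  1 / (resDenom β (g 0 k.1) * resDenom β (g 1 k.2)) * (1 / resDenom β (g 2 (k.1 - k.2 + u)))

theorem integrable_crossingIntegrand {β : ℝ} (hβ : 0 < β) (u : T3) {g : Fin 3 → T3 → ℝ}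
    (hg : ∀ i, Continuous (g i)) : Integrable (crossingIntegrand β u g) := by
  refine integrable_of_continuous _ ?_
  have h0 := (continuous_resDenom β).comp
    ((hg 0).comp continuous_fst : Continuous fun k : T3 × T3 => g 0 k.1)
  have h1 := (continuous_resDenom β).comp
    ((hg 1).comp continuous_snd : Continuous fun k : T3 × T3 => g 1 k.2)
  have h2 := (continuous_resDenom β).comp ((hg 2).comp
    ((continuous_fst.sub continuous_snd).add continuous_const) :
      Continuous fun k : T3 × T3 => g 2 (k.1 - k.2 + u))
  exact (continuous_const.div (h0.mul h1) fun k =>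
    (mul_pos (resDenom_pos hβ _) (resDenom_pos hβ _)).ne').mul
    (continuous_const.div h2 fun k => (resDenom_pos hβ _).ne')

theorem crossingIntegrand_le {β : ℝ} (hβ : 0 < β) (u : T3) {g g' : Fin 3 → T3 → ℝ} {C : ℝ}
    (hC : 0 < C) (h : ∀ i k, resDenom β (g' i k) ≤ C * resDenom β (g i k)) (k : T3 × T3) :
    crossingIntegrand β u g k ≤ C ^ 3 * crossingIntegrand β u g' k := by
  have h1 : ∀ i k, 1 / resDenom β (g i k) ≤ C * (1 / resDenom β (g' i k)) := fun i k => by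
    rw [mul_one_div, div_le_div_iff₀ (resDenom_pos hβ _) (resDenom_pos hβ _), one_mul]
    exact h i k
  have h0 : ∀ x, 0 ≤ 1 / resDenom β x := fun x => (one_div_pos.2 (resDenom_pos hβ x)).le
  unfold crossingIntegrand
  simp only [← one_div_mul_one_div]
  calc _ ≤ C * (1 / resDenom β (g' 0 k.1)) * (C * (1 / resDenom β (g' 1 k.2))) *
        (C * (1 / resDenom β (g' 2 (k.1 - k.2 + u)))) :=
        mul_le_mul (mul_le_mul (h1 0 _) (h1 1 _) (h0 _) (mul_nonneg hC.le (h0 _))) (h1 2 _) (h0 _)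
          (mul_nonneg (mul_nonneg hC.le (h0 _)) (mul_nonneg hC.le (h0 _)))
    _ = _ := by ring

/-- Comparison of `|α - σ√w + iβ|` with `|α' - w + iβ|`. -/
theorem exists_resDenom_sqrt_le {M : ℝ} (hM : 0 < M) :
    ∃ C : ℝ, 0 < C ∧ ∀ α σ : ℝ, σ = 1 ∨ σ = -1 → ∃ α' : ℝ, ∀ w β : ℝ, 0 < w → w ≤ M → 0 < β →
      β ≤ 1 → resDenom β (α' - 1 * w) ≤ C * resDenom β (α - σ * √w) := by
  have hM' := Real.sqrt_pos.2 hM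
  -- The first two summands serve `|α| ≤ 2√M`, the last one serves `|α| > 2√M`.
  refine ⟨3 * √M + 1 + (M + 1) / √M, by positivity, fun α σ hσ => ?_⟩
  have hC : 0 < (M + 1) / √M := by positivity
  rcases le_or_gt |α| (2 * √M) with hα | hα
  -- Factor `α² - w`; the cofactor `α + σ√w` is at most `3√M`.
  · refine ⟨α ^ 2, fun w β hw hwM hβ hβ1 => ?_⟩
    have hs : √w ≤ √M := Real.sqrt_le_sqrt hwM
    have e : α ^ 2 - 1 * w = (α + σ * √w) * (α - σ * √w) := by
      have h2 : σ ^ 2 = 1 := by rcases hσ with rfl | rfl <;> norm_num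
      linear_combination (-√w ^ 2) * h2.symm + Real.sq_sqrt hw.le
    have h1 : |α + σ * √w| ≤ 3 * √M := by
      refine (abs_add_le _ _).trans ?_
      have : |σ * √w| = √w := by
        rw [abs_mul, abs_of_nonneg (Real.sqrt_nonneg w)]
        rcases hσ with rfl | rfl <;> simp
      linarith
    have h0 := (resDenom_pos hβ (α - σ * √w)).le
    calc resDenom β (α ^ 2 - 1 * w) ≤ |α ^ 2 - 1 * w| + β := resDenom_le hβ.le _
      _ ≤ 3 * √M * resDenom β (α - σ * √w) + 1 * resDenom β (α - σ * √w) := by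
          rw [e, abs_mul, one_mul]
          exact add_le_add (mul_le_mul h1 (abs_le_resDenom _ _) (abs_nonneg _) (by positivity))
            (le_resDenom _ _)
      _ ≤ _ := by nlinarith
  -- Here the right-hand denominator is at least `√M`, so any fixed `α'` would do; `0` makes the
  -- left side at most `M + 1`.
  · refine ⟨0, fun w β hw hwM hβ hβ1 => ?_⟩
    have hs : √w ≤ √M := Real.sqrt_le_sqrt hwM
    have h1 : √M ≤ resDenom β (α - σ * √w) := by
      refine le_trans ?_ (abs_le_resDenom _ _)
      have h3 := abs_sub_abs_le_abs_sub α (σ * √w)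
      have : |σ * √w| = √w := by
        rw [abs_mul, abs_of_nonneg (Real.sqrt_nonneg w)]
        rcases hσ with rfl | rfl <;> simp
      linarith
    calc resDenom β (0 - 1 * w) ≤ |0 - 1 * w| + β := resDenom_le hβ.le _
      _ ≤ M + 1 := by
          rw [zero_sub, one_mul, abs_neg, abs_of_pos hw]; linarith
      _ = (M + 1) / √M * √M := by field_simp
      _ ≤ (M + 1) / √M * resDenom β (α - σ * √w) := by gcongr
      _ ≤ _ := by nlinarith [resDenom_pos hβ (α - σ * √w)]

/-- The comparison value `α'` depends on `α` and `σ` only, not on `k` or `β`, so the estimate for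
`ω` can be used at `α'` with all signs `+1`. Each of the three factors costs a constant `C`, and the
power of `β` and of the logarithm is unchanged. -/
theorem CrossingsSuppressed.sqrt {ω : T3 → ℝ} {γ M : ℝ} (hω : Continuous ω) (hpos : ∀ k, 0 < ω k)
    (hM : ∀ k, ω k ≤ M) (h : CrossingsSuppressed ω γ) :
    CrossingsSuppressed (fun k => √(ω k)) γ := by
  obtain ⟨h0, h1, c, d, hc, h⟩ := h
  obtain ⟨C, hC0, hC⟩ := exists_resDenom_sqrt_le ((hpos 0).trans_le (hM 0))
  refine ⟨h0, h1, C ^ 3 * c, d, by positivity, fun u β hβ hβ1 α σ hσ => ?_⟩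
  choose α' hα' using fun i => hC (α i) (σ i) (hσ i)
  have hle := h u β hβ hβ1 α' (fun _ => 1) (fun _ => Or.inl rfl)
  have hcont : ∀ i, Continuous fun k => α i - σ i * √(ω k) := fun i => by fun_prop
  have hcont' : ∀ i, Continuous fun k => α' i - 1 * ω k := fun i => by fun_prop
  change ∫ k, crossingIntegrand β u (fun i k => α' i - 1 * ω k) k ≤ _ at hle
  change ∫ k, crossingIntegrand β u (fun i k => α i - σ i * √(ω k)) k ≤ _
  calc _ ≤ ∫ k, C ^ 3 * crossingIntegrand β u (fun i k => α' i - 1 * ω k) k :=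
        integral_mono (integrable_crossingIntegrand hβ u hcont)
          ((integrable_crossingIntegrand hβ u hcont').const_mul _)
          fun k => crossingIntegrand_le hβ u hC0
            (fun i k => hα' i (ω k) β (hpos k) (hM k) hβ hβ1) k
    _ ≤ C ^ 3 * (c * β ^ (γ - 1) * bracket (Real.log β) ^ d) := by
        rw [integral_const_mul]
        exact mul_le_mul_of_nonneg_left hle (by positivity)
    _ = _ := by ring

theorem DispersionAssumptions.sqrt {ω : T3 → ℝ} {γ : ℝ} (hm : IsMorse ω)
    (h : DispersionAssumptions ω γ) :
    IsMorse (fun k => √(ω k)) ∧ DispersionAssumptions (fun k => √(ω k)) γ := by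
  obtain ⟨k₀, hk₀, hk₀'⟩ := h.min_pos
  obtain ⟨k₁, hk₁⟩ := h.max_exists
  have hpos : ∀ k, 0 < ω k := fun k => hk₀'.trans_le (hk₀ k)
  have hms := hm.sqrt hpos
  exact ⟨hms, {
    smooth := hms.smooth
    symm := fun k => by rw [h.symm k]
    min_pos := ⟨k₀, fun k => Real.sqrt_le_sqrt (hk₀ k), Real.sqrt_pos.2 hk₀'⟩
    max_exists := ⟨k₁, fun k => Real.sqrt_le_sqrt (hk₁ k)⟩
    dispersive := hms.dispersive
    crossings := h.crossings.sqrt hm.smooth.continuous hpos hk₁ }⟩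

/-! ### The nearest-neighbour dispersion relation -/

theorem periodicExt_omegaNNSq (ω₀ : ℝ) : periodicExt (omegaNNSq ω₀) =
    fun x => ω₀ ^ 2 + ∑ ν, 2 * (1 - Real.cos (2 * Real.pi * x ν)) := by
  ext x
  simp [periodicExt, omegaNNSq, cosTwoPi_coe]

theorem smooth_omegaNNSq (ω₀ : ℝ) : SmoothOnTorus (omegaNNSq ω₀) := by
  rw [SmoothOnTorus, periodicExt_omegaNNSq]
  fun_prop

theorem hasFDerivAt_coord (ν : Fin 3) (x : Fin 3 → ℝ) :
    HasFDerivAt (fun x : Fin 3 → ℝ => x ν) (ContinuousLinearMap.proj ν : (Fin 3 → ℝ) →L[ℝ] ℝ) x :=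
  (ContinuousLinearMap.proj ν : (Fin 3 → ℝ) →L[ℝ] ℝ).hasFDerivAt

theorem fderiv_omegaNNSq (ω₀ : ℝ) : fderiv ℝ (periodicExt (omegaNNSq ω₀)) =
    fun x => ∑ ν, (4 * Real.pi * Real.sin (2 * Real.pi * x ν)) •
      (ContinuousLinearMap.proj ν : (Fin 3 → ℝ) →L[ℝ] ℝ) := by
  ext1 x
  rw [periodicExt_omegaNNSq]
  refine (HasFDerivAt.const_add _ (HasFDerivAt.fun_sum fun ν _ => ?_)).fderiv
  have h1 : HasDerivAt (fun y : ℝ => 2 * (1 - Real.cos (2 * Real.pi * y)))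
      (4 * Real.pi * Real.sin (2 * Real.pi * x ν)) (x ν) := by
    have := ((((hasDerivAt_id (x ν)).const_mul (2 * Real.pi)).cos).const_sub 1).const_mul 2
    refine this.congr_deriv ?_
    simp; ring
  have h2 := HasDerivAt.comp_hasFDerivAt (f := fun x : Fin 3 → ℝ => x ν) x h1
    (hasFDerivAt_coord ν x)
  exact h2

theorem fderiv_fderiv_omegaNNSq_apply (ω₀ : ℝ) (x v w : Fin 3 → ℝ) :
    fderiv ℝ (fderiv ℝ (periodicExt (omegaNNSq ω₀))) x v w =
      ∑ ν, 8 * Real.pi ^ 2 * Real.cos (2 * Real.pi * x ν) * v ν * w ν := by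
  rw [fderiv_omegaNNSq]
  have h : HasFDerivAt (fun x : Fin 3 → ℝ => ∑ ν, (4 * Real.pi * Real.sin (2 * Real.pi * x ν)) •
      (ContinuousLinearMap.proj ν : (Fin 3 → ℝ) →L[ℝ] ℝ))
      (∑ ν, ((8 * Real.pi ^ 2 * Real.cos (2 * Real.pi * x ν)) •
        (ContinuousLinearMap.proj ν : (Fin 3 → ℝ) →L[ℝ] ℝ)).smulRight
          (ContinuousLinearMap.proj ν : (Fin 3 → ℝ) →L[ℝ] ℝ)) x := by
    refine HasFDerivAt.fun_sum fun ν _ => ?_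
    have h1 : HasDerivAt (fun y : ℝ => 4 * Real.pi * Real.sin (2 * Real.pi * y))
        (8 * Real.pi ^ 2 * Real.cos (2 * Real.pi * x ν)) (x ν) := by
      have := (((hasDerivAt_id (x ν)).const_mul (2 * Real.pi)).sin).const_mul (4 * Real.pi)
      refine this.congr_deriv ?_
      simp; ring
    have h2 := HasDerivAt.comp_hasFDerivAt (f := fun x : Fin 3 → ℝ => x ν) x h1
      (hasFDerivAt_coord ν x)
    exact h2.smul_const (ContinuousLinearMap.proj ν : (Fin 3 → ℝ) →L[ℝ] ℝ)
  rw [h.fderiv]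
  simp

/-- The Hessian is diagonal with entries proportional to `cos(2πx_ν)`. At a critical point every
`sin(2πx_ν)` vanishes, so every cosine is `±1`. -/
theorem isMorse_omegaNNSq (ω₀ : ℝ) : IsMorse (omegaNNSq ω₀) := by
  refine .of_nondegenerate (smooth_omegaNNSq ω₀) fun x hx v hv => ?_
  ext ν
  have h1 := congrArg (fun A : (Fin 3 → ℝ) →L[ℝ] ℝ => A (Pi.single ν 1)) hx
  have h2 := hv (Pi.single ν 1)
  rw [fderiv_fderiv_omegaNNSq_apply] at h2
  rw [fderiv_omegaNNSq] at h1
  simp [Pi.single_apply, Real.pi_ne_zero] at h1 h2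
  have h3 := Real.sin_sq_add_cos_sq (2 * Real.pi * x ν)
  rcases h2 with h2 | h2
  · rw [h1, h2] at h3; norm_num at h3
  · exact h2

theorem cosTwoPi_neg (x : UnitAddCircle) : cosTwoPi (-x) = cosTwoPi x := by
  induction x using QuotientAddGroup.induction_on with
  | H x =>
    have h : cosTwoPi (-(x : UnitAddCircle)) = cosTwoPi ((-x : ℝ) : UnitAddCircle) := rfl
    rw [h, cosTwoPi_coe]
    exact (by rw [mul_neg, Real.cos_neg]; exact (cosTwoPi_coe x).symm)

theorem abs_cosTwoPi_le (x : UnitAddCircle) : |cosTwoPi x| ≤ 1 := by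
  induction x using QuotientAddGroup.induction_on with
  | H x =>
    have h : cosTwoPi (x : UnitAddCircle) = Real.cos (2 * Real.pi * x) := cosTwoPi_coe x
    exact h ▸ Real.abs_cos_le_one _

theorem omegaNNSq_ge (ω₀ : ℝ) (k : T3) : ω₀ ^ 2 ≤ omegaNNSq ω₀ k :=
  le_add_of_nonneg_right (Finset.sum_nonneg fun ν _ => by
    have := (abs_le.1 (abs_cosTwoPi_le (k ν))).2; linarith)

theorem dispersionAssumptions_omegaNNSq {ω₀ γ : ℝ} (h₀ : 0 < ω₀)
    (h : CrossingsSuppressed (omegaNNSq ω₀) γ) : DispersionAssumptions (omegaNNSq ω₀) γ := by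
  have hc := (smooth_omegaNNSq ω₀).continuous
  obtain ⟨k₀, -, hk₀⟩ := isCompact_univ.exists_isMinOn (s := (Set.univ : Set T3)) ⟨0, trivial⟩
    hc.continuousOn
  obtain ⟨k₁, -, hk₁⟩ := isCompact_univ.exists_isMaxOn (s := (Set.univ : Set T3)) ⟨0, trivial⟩
    hc.continuousOn
  exact {
    smooth := smooth_omegaNNSq ω₀
    symm := fun k => by simp [omegaNNSq, cosTwoPi_neg]
    min_pos := ⟨k₀, fun k => hk₀ trivial, (by positivity : 0 < ω₀ ^ 2).trans_le (omegaNNSq_ge ω₀ k₀)⟩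
    max_exists := ⟨k₁, fun k => hk₁ trivial⟩
    dispersive := (isMorse_omegaNNSq ω₀).dispersive
    crossings := h }

/-! ### A positive kernel with a positive Fourier transform -/

/-- The density `s^{p-1} e^{-βs}`. -/
def laplaceWeight (p β s : ℝ) : ℝ := s ^ (p - 1) * Real.exp (-(β * s))

theorem integrableOn_rpow_mul_exp {q β : ℝ} (hq : -1 < q) (hβ : 0 < β) :
    IntegrableOn (fun s : ℝ => s ^ q * Real.exp (-(β * s))) (Set.Ioi 0) := by
  simpa using integrableOn_rpow_mul_exp_neg_mul_rpow hq one_pos hβ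

theorem integrableOn_laplaceWeight {p β : ℝ} (hp : 0 < p) (hβ : 0 < β) :
    IntegrableOn (laplaceWeight p β) (Set.Ioi 0) :=
  integrableOn_rpow_mul_exp (by linarith) hβ

theorem laplaceWeight_nonneg (p β : ℝ) {s : ℝ} (hs : 0 < s) : 0 ≤ laplaceWeight p β s := by
  unfold laplaceWeight; positivity

theorem norm_cexp_I_mul (s y : ℝ) : ‖Complex.exp (Complex.I * s * y)‖ = 1 := by
  rw [show Complex.I * s * y = ((s * y : ℝ) : ℂ) * Complex.I by push_cast; ring]
  exact Complex.norm_exp_ofReal_mul_I _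

theorem integrableOn_rpow_mul_exp_mul_cexp {q β : ℝ} (hq : -1 < q) (hβ : 0 < β) (y : ℝ) :
    IntegrableOn (fun s : ℝ => ((s ^ q * Real.exp (-(β * s)) : ℝ) : ℂ) *
      Complex.exp (Complex.I * s * y)) (Set.Ioi 0) :=
  Integrable.mul_bdd (c := 1) (integrableOn_rpow_mul_exp hq hβ).ofReal
    (Continuous.aestronglyMeasurable (by fun_prop))
    (Filter.Eventually.of_forall fun s => (norm_cexp_I_mul s y).le)

/-- The Laplace transform `∫₀^∞ s^q e^{-(β-iy)s} ds`. -/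
def laplaceInt (q β y : ℝ) : ℂ :=
  ∫ s in Set.Ioi (0 : ℝ), ((s ^ q * Real.exp (-(β * s)) : ℝ) : ℂ) * Complex.exp (Complex.I * s * y)

theorem hasDerivAt_laplaceInt {p β : ℝ} (hp : 0 < p) (hβ : 0 < β) (y : ℝ) :
    HasDerivAt (laplaceInt (p - 1) β) (Complex.I * laplaceInt p β y) y := by
  have hm : ∀ y : ℝ, IntegrableOn (fun s : ℝ => ((s ^ (p - 1) * Real.exp (-(β * s)) : ℝ) : ℂ) *
      Complex.exp (Complex.I * s * y)) (Set.Ioi 0) :=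
    integrableOn_rpow_mul_exp_mul_cexp (by linarith) hβ
  have hm' := (integrableOn_rpow_mul_exp_mul_cexp (q := p) (by linarith) hβ y).const_mul Complex.I
  have key := (hasDerivAt_integral_of_dominated_loc_of_deriv_le
    (μ := volume.restrict (Set.Ioi (0 : ℝ))) (x₀ := y) (s := Set.univ)
    (F := fun (y s : ℝ) => ((s ^ (p - 1) * Real.exp (-(β * s)) : ℝ) : ℂ) *
      Complex.exp (Complex.I * s * y))
    (F' := fun (y s : ℝ) => Complex.I * (((s ^ p * Real.exp (-(β * s)) : ℝ) : ℂ) *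
      Complex.exp (Complex.I * s * y)))
    (bound := fun s => s ^ p * Real.exp (-(β * s))) Filter.univ_mem
    (Filter.Eventually.of_forall fun y => (hm y).aestronglyMeasurable) (hm y)
    hm'.aestronglyMeasurable ?_ (integrableOn_rpow_mul_exp (by linarith) hβ) ?_).2
  · rw [integral_const_mul] at key
    exact key
  · refine (ae_restrict_iff' measurableSet_Ioi).2 (Filter.Eventually.of_forall fun s hs y _ => ?_)
    have hs : 0 < s := hs
    rw [norm_mul, norm_mul, norm_cexp_I_mul, Complex.norm_I, one_mul, mul_one,
      Complex.norm_of_nonneg (by positivity)]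
  · refine (ae_restrict_iff' measurableSet_Ioi).2 (Filter.Eventually.of_forall fun s hs y _ => ?_)
    have hs : 0 < s := hs
    have h1 : HasDerivAt (fun y : ℝ => Complex.I * s * (y : ℂ)) (Complex.I * s) y := by
      simpa using (Complex.ofRealCLM.hasDerivAt (x := y)).const_mul (Complex.I * s)
    refine (h1.cexp.const_mul _).congr_deriv ?_
    rw [show s ^ p = s ^ (p - 1) * s by rw [← Real.rpow_add_one hs.ne', sub_add_cancel]]
    push_cast
    ring

/-- Integration by parts in `s`: the function `s^p e^(-(β-iy)s)` vanishes at `0` and at infinity, so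
its derivative integrates to zero. -/
theorem laplaceInt_succ {p β : ℝ} (hp : 0 < p) (hβ : 0 < β) (y : ℝ) :
    (β - Complex.I * y) * laplaceInt p β y = p * laplaceInt (p - 1) β y := by
  have hi := (integrableOn_rpow_mul_exp_mul_cexp (q := p - 1) (by linarith) hβ y).const_mul (p : ℂ)
  have hi' := (integrableOn_rpow_mul_exp_mul_cexp (q := p) (by linarith) hβ y).const_mul
    (β - Complex.I * y : ℂ)
  have h0 : ∫ s in Set.Ioi (0 : ℝ), ((p : ℂ) * (((s ^ (p - 1) * Real.exp (-(β * s)) : ℝ) : ℂ) *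
      Complex.exp (Complex.I * s * y)) - (β - Complex.I * y) *
      (((s ^ p * Real.exp (-(β * s)) : ℝ) : ℂ) * Complex.exp (Complex.I * s * y))) =
      0 - ((((0 : ℝ) ^ p * Real.exp (-(β * 0)) : ℝ) : ℂ) *
        Complex.exp (Complex.I * (0 : ℝ) * y)) := by
    refine integral_Ioi_of_hasDerivAt_of_tendsto
      (f := fun s : ℝ => (((s ^ p * Real.exp (-(β * s)) : ℝ) : ℂ) *
        Complex.exp (Complex.I * s * y))) ?_ ?_ (hi.sub hi') ?_
    · refine Continuous.continuousWithinAt ?_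
      have : Continuous fun s : ℝ => s ^ p := Real.continuous_rpow_const hp.le
      fun_prop
    · intro s hs
      have hs : 0 < s := hs
      have h1 : HasDerivAt (fun s : ℝ => s ^ p * Real.exp (-(β * s)))
          (p * s ^ (p - 1) * Real.exp (-(β * s)) + s ^ p * (Real.exp (-(β * s)) * (-β))) s := by
        have h2 : HasDerivAt (fun s : ℝ => -(β * s)) (-β) s := by
          simpa using ((hasDerivAt_id s).const_mul β).fun_neg
        exact (Real.hasDerivAt_rpow_const (Or.inl hs.ne')).mul h2.exp
      have h3 : HasDerivAt (fun s : ℝ => Complex.I * (s : ℂ) * y) (Complex.I * y) s := by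
        simpa using ((Complex.ofRealCLM.hasDerivAt (x := s)).const_mul Complex.I).mul_const (y : ℂ)
      refine (h1.ofReal_comp.mul h3.cexp).congr_deriv ?_
      push_cast
      ring
    · rw [tendsto_zero_iff_norm_tendsto_zero]
      have := (tendsto_rpow_mul_exp_neg_mul_atTop_nhds_zero p β hβ).norm
      rw [norm_zero] at this
      refine this.congr fun s => ?_
      rw [neg_mul, norm_mul (_ : ℂ), norm_cexp_I_mul, mul_one, Complex.norm_real]
  rw [integral_sub hi hi', integral_const_mul, integral_const_mul, Real.zero_rpow hp.ne'] at h0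
  simp only [zero_mul, Complex.ofReal_zero, sub_zero] at h0
  unfold laplaceInt
  linear_combination -h0

theorem sub_I_mul_re (β y : ℝ) : ((β : ℂ) - Complex.I * y).re = β := by simp

theorem sub_I_mul_mem_slitPlane {β : ℝ} (hβ : 0 < β) (y : ℝ) :
    (β : ℂ) - Complex.I * y ∈ Complex.slitPlane :=
  Or.inl (by rwa [sub_I_mul_re])

/-- Multiplied by `(β - iy)^p`, the left side has zero derivative in `y` by `laplaceInt_succ`, hence
is constant; at `y = 0` it is the real Gamma integral. This avoids rotating a contour. -/
theorem laplaceInt_eq {p β : ℝ} (hp : 0 < p) (hβ : 0 < β) (y : ℝ) :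
    laplaceInt (p - 1) β y = Real.Gamma p * (β - Complex.I * y) ^ ((-p : ℝ) : ℂ) := by
  set z : ℝ → ℂ := fun y => (β : ℂ) - Complex.I * y with hz
  have hzm : ∀ y, z y ∈ Complex.slitPlane := sub_I_mul_mem_slitPlane hβ
  have hz0 : ∀ y, z y ≠ 0 := fun y => Complex.slitPlane_ne_zero (hzm y)
  have hd : ∀ y, HasDerivAt (fun y => z y ^ (p : ℂ) * laplaceInt (p - 1) β y) 0 y := fun y => by
    have h1 : HasDerivAt z (-Complex.I) y := by
      simpa using ((Complex.ofRealCLM.hasDerivAt (x := y)).const_mul Complex.I).const_sub (β : ℂ)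
    have h2 : HasDerivAt (fun y => z y ^ (p : ℂ)) (p * z y ^ ((p : ℂ) - 1) * -Complex.I) y :=
      HasDerivAt.comp_of_eq (h₂ := fun w : ℂ => w ^ (p : ℂ)) y
        ((hasDerivAt_id (z y)).cpow_const (hzm y) |>.congr_deriv (by simp)) h1 rfl
    refine (h2.mul (hasDerivAt_laplaceInt hp hβ y)).congr_deriv ?_
    have h3 := laplaceInt_succ hp hβ y
    have h4 : z y ^ (p : ℂ) = z y ^ ((p : ℂ) - 1) * z y := by
      rw [Complex.cpow_sub _ _ (hz0 y), Complex.cpow_one, div_mul_cancel₀ _ (hz0 y)]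
    rw [h4]
    linear_combination (z y ^ ((p : ℂ) - 1) * Complex.I) * h3
  have hc := is_const_of_deriv_eq_zero (fun y => (hd y).differentiableAt) (fun y => (hd y).deriv) y 0
  have h0 : laplaceInt (p - 1) β 0 = ((1 / β) ^ p * Real.Gamma p : ℝ) := by
    rw [← Real.integral_rpow_mul_exp_neg_mul_Ioi hp hβ, laplaceInt, ← integral_complex_ofReal]
    simp
  have hz1 : z 0 = (β : ℂ) := by simp [hz]
  simp only [h0, hz1] at hc
  rw [Complex.ofReal_neg, Complex.cpow_neg, ← div_eq_mul_inv, eq_div_iff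
    (fun h => hz0 y (Complex.cpow_eq_zero_iff _ _ |>.1 h).1), mul_comm]
  rw [hc, ← Complex.ofReal_cpow hβ.le, ← Complex.ofReal_mul, ← mul_assoc,
    ← Real.mul_rpow hβ.le (by positivity), mul_one_div_cancel hβ.ne', Real.one_rpow, one_mul]

/-- The kernel `Re (β - iy)^{-p}`. -/
def resKernel (p β y : ℝ) : ℝ := (((β : ℂ) - Complex.I * y) ^ ((-p : ℝ) : ℂ)).re

theorem norm_sub_I_mul (β y : ℝ) : ‖(β : ℂ) - Complex.I * y‖ = resDenom β y := by
  rw [resDenom_eq, show (β : ℂ) - Complex.I * y = (β : ℂ) + ((-y : ℝ) : ℂ) * Complex.I by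
    push_cast; ring, Complex.norm_add_mul_I, neg_sq, add_comm]

theorem resKernel_eq (p β y : ℝ) : resKernel p β y =
    resDenom β y ^ (-p) * Real.cos (((β : ℂ) - Complex.I * y).arg * p) := by
  rw [resKernel, Complex.cpow_ofReal_re, norm_sub_I_mul, mul_neg, Real.cos_neg]

/-- The argument of a number with positive real part is at most `π/2` in absolute value. For `p < 1`
this keeps the kernel positive and comparable to `|β - iy|^(-p)`; the lower bound degenerates as `p
→ 1`. -/
theorem cos_arg_ge {p β : ℝ} (hp : 0 < p) (hp1 : p < 1) (hβ : 0 < β) (y : ℝ) :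
    Real.cos (Real.pi / 2 * p) ≤ Real.cos (((β : ℂ) - Complex.I * y).arg * p) := by
  have h : |((β : ℂ) - Complex.I * y).arg| ≤ Real.pi / 2 :=
    (Complex.abs_arg_lt_pi_div_two_iff.2 (Or.inl (by rwa [sub_I_mul_re]))).le
  rw [← Real.cos_abs (((β : ℂ) - Complex.I * y).arg * p), abs_mul, abs_of_pos hp]
  refine Real.cos_le_cos_of_nonneg_of_le_pi (by positivity) ?_ (by gcongr)
  nlinarith [Real.pi_pos]

theorem cos_half_pi_mul_pos {p : ℝ} (hp : 0 < p) (hp1 : p < 1) : 0 < Real.cos (Real.pi / 2 * p) :=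
  Real.cos_pos_of_mem_Ioo ⟨by nlinarith [Real.pi_pos], by nlinarith [Real.pi_pos]⟩

theorem resKernel_nonneg {p β : ℝ} (hp : 0 < p) (hp1 : p < 1) (hβ : 0 < β) (y : ℝ) :
    0 ≤ resKernel p β y := by
  rw [resKernel_eq]
  exact mul_nonneg (Real.rpow_nonneg (resDenom_pos hβ y).le _)
    ((cos_half_pi_mul_pos hp hp1).le.trans (cos_arg_ge hp hp1 hβ y))

theorem resKernel_le {p β : ℝ} (hp : 0 < p) (hβ : 0 < β) (y : ℝ) :
    resKernel p β y ≤ β ^ (-p) := by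
  rw [resKernel_eq]
  calc _ ≤ resDenom β y ^ (-p) * 1 :=
        mul_le_mul_of_nonneg_left (Real.cos_le_one _) (Real.rpow_nonneg (resDenom_pos hβ y).le _)
    _ ≤ β ^ (-p) := by
        rw [mul_one]
        exact Real.rpow_le_rpow_of_nonpos hβ (le_resDenom β y) (by linarith)

/-- Split `r⁻¹ = r^(p-1) r^(-p)` and use `r ≥ β` in the first factor. The loss `β^(p-1)` is small
for `p` close to `1`. -/
theorem one_div_resDenom_le {p β : ℝ} (hp : 0 < p) (hp1 : p < 1) (hβ : 0 < β) (y : ℝ) :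
    1 / resDenom β y ≤ (Real.cos (Real.pi / 2 * p))⁻¹ * β ^ (p - 1) * resKernel p β y := by
  have hr := resDenom_pos hβ y
  have hc := cos_half_pi_mul_pos hp hp1
  have h1 : 1 / resDenom β y = resDenom β y ^ (p - 1) * resDenom β y ^ (-p) := by
    rw [← Real.rpow_add hr, one_div, ← Real.rpow_neg_one]
    congr 1
    ring
  rw [resKernel_eq, h1]
  calc resDenom β y ^ (p - 1) * resDenom β y ^ (-p)
      ≤ β ^ (p - 1) * resDenom β y ^ (-p) :=
        mul_le_mul_of_nonneg_right
          (Real.rpow_le_rpow_of_nonpos hβ (le_resDenom β y) (by linarith)) (by positivity)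
    _ = (Real.cos (Real.pi / 2 * p))⁻¹ * β ^ (p - 1) *
        (resDenom β y ^ (-p) * Real.cos (Real.pi / 2 * p)) := by
          generalize Real.cos (Real.pi / 2 * p) = c at hc
          field_simp
    _ ≤ _ := by
        have := cos_arg_ge hp hp1 hβ y
        gcongr

theorem continuous_resKernel {β : ℝ} (p : ℝ) (hβ : 0 < β) : Continuous (resKernel p β) := by
  refine Complex.continuous_re.comp (continuous_iff_continuousAt.2 fun y => ?_)
  exact ContinuousAt.comp (f := fun y : ℝ => (β : ℂ) - Complex.I * y)
    (g := fun w : ℂ => w ^ ((-p : ℝ) : ℂ)) (continuousAt_cpow_const (sub_I_mul_mem_slitPlane hβ y))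
    (by fun_prop)

/-- The kernel is the cosine transform of the density `s^{p-1} e^{-βs}`. -/
theorem integral_laplaceWeight_mul_cos {p β : ℝ} (hp : 0 < p) (hβ : 0 < β) (y : ℝ) :
    ∫ s in Set.Ioi (0 : ℝ), laplaceWeight p β s * Real.cos (s * y) =
      Real.Gamma p * resKernel p β y := by
  have h := congrArg Complex.re (laplaceInt_eq hp hβ y)
  rw [Complex.re_ofReal_mul] at h
  rw [resKernel, ← h, laplaceInt]
  have hr := integral_re (𝕜 := ℂ) (integrableOn_rpow_mul_exp_mul_cexp (q := p - 1) (by linarith) hβ y)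
  refine Eq.trans ?_ hr
  refine integral_congr_ae (Filter.Eventually.of_forall fun s => ?_)
  change _ = Complex.re _
  rw [Complex.re_ofReal_mul, show Complex.I * s * y = ((s * y : ℝ) : ℂ) * Complex.I by
    push_cast; ring, Complex.exp_ofReal_mul_I_re]
  rfl

/-! ### One-dimensional oscillatory integrals -/

theorem continuous_cosTwoPi : Continuous cosTwoPi := by
  refine QuotientAddGroup.isOpenQuotientMap_mk.isQuotientMap.continuous_iff.2 ?_
  have h : cosTwoPi ∘ (QuotientAddGroup.mk : ℝ → UnitAddCircle) =
      fun x => Real.cos (2 * Real.pi * x) := funext cosTwoPi_coe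
  rw [h]
  fun_prop

theorem fourier_add_apply (m : ℤ) (x y : UnitAddCircle) :
    fourier m (x + y) = fourier m x * fourier m y := by
  simp [fourier_apply, smul_add, AddCircle.toCircle_add]

theorem norm_fourier_apply (m : ℤ) (x : UnitAddCircle) : ‖fourier m x‖ = 1 := by
  rw [fourier_apply]
  exact Circle.norm_coe _

theorem norm_cexp_I_ofReal (a : ℝ) : ‖Complex.exp (Complex.I * a)‖ = 1 := by
  rw [mul_comm]; exact Complex.norm_exp_ofReal_mul_I a

/-- The integrand `e^{-2πimx} e^{2is cos(2πx)}`. -/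
def oscIntegrand (m : ℤ) (s : ℝ) (x : UnitAddCircle) : ℂ :=
  fourier (-m) x * Complex.exp (Complex.I * (2 * s * cosTwoPi x : ℝ))

/-- The integral `∫₀¹ e^{-2πimx} e^{2is cos(2πx)} dx`. -/
def circleOsc (m : ℤ) (s : ℝ) : ℂ := ∫ x : UnitAddCircle, oscIntegrand m s x

theorem continuous_oscIntegrand (m : ℤ) :
    Continuous fun z : ℝ × UnitAddCircle => oscIntegrand m z.1 z.2 := by
  have := continuous_cosTwoPi
  unfold oscIntegrand
  fun_prop

theorem continuous_oscIntegrand_right (m : ℤ) (s : ℝ) : Continuous (oscIntegrand m s) :=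
  (continuous_oscIntegrand m).comp (Continuous.prodMk_right s)

theorem norm_oscIntegrand (m : ℤ) (s : ℝ) (x : UnitAddCircle) : ‖oscIntegrand m s x‖ = 1 := by
  rw [oscIntegrand, norm_mul, norm_fourier_apply, norm_cexp_I_ofReal, one_mul]

theorem norm_integral_le_one_of_norm_le_one {X : Type*} [MeasurableSpace X] {μ : Measure X}
    [IsProbabilityMeasure μ] {f : X → ℂ} {C : ℝ} (h : ∀ x, ‖f x‖ ≤ C) : ‖∫ x, f x ∂μ‖ ≤ C := by
  simpa using norm_integral_le_of_norm_le_const (μ := μ) (Filter.Eventually.of_forall h)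

theorem norm_circleOsc_le_one (m : ℤ) (s : ℝ) : ‖circleOsc m s‖ ≤ 1 :=
  norm_integral_le_one_of_norm_le_one fun x => (norm_oscIntegrand m s x).le

theorem continuous_circleOsc (m : ℤ) : Continuous (circleOsc m) :=
  continuous_of_dominated
    (fun s => (continuous_oscIntegrand_right m s).aestronglyMeasurable)
    (fun s => Filter.Eventually.of_forall fun x => (norm_oscIntegrand m s x).le)
    (integrable_const 1)
    (Filter.Eventually.of_forall fun x => (continuous_oscIntegrand m).comp (Continuous.prodMk_left x))

theorem conj_oscIntegrand (m : ℤ) (s : ℝ) (x : UnitAddCircle) :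
    (starRingEnd ℂ) (oscIntegrand m s x) =
      fourier m x * Complex.exp (Complex.I * (2 * -s * cosTwoPi x : ℝ)) := by
  rw [oscIntegrand, map_mul, ← fourier_neg, neg_neg, ← Complex.exp_conj]
  congr 2
  rw [map_mul, Complex.conj_I, Complex.conj_ofReal]
  push_cast
  ring

theorem conj_circleOsc (m : ℤ) (s : ℝ) : (starRingEnd ℂ) (circleOsc m s) = circleOsc m (-s) := by
  rw [circleOsc, ← integral_conj, circleOsc, ← integral_neg_eq_self]
  refine integral_congr_ae (Filter.Eventually.of_forall fun x => ?_)
  dsimp only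
  rw [conj_oscIntegrand, oscIntegrand, cosTwoPi_neg]
  simp [fourier_apply]

theorem norm_circleOsc_neg (m : ℤ) (s : ℝ) : ‖circleOsc m (-s)‖ = ‖circleOsc m s‖ := by
  rw [← conj_circleOsc, RCLike.norm_conj]

/-! #### Relation with the nearest-neighbour dispersion relation -/

theorem phase_omegaNNSq (ω₀ s : ℝ) (k : T3) : phase (omegaNNSq ω₀) s k =
    Complex.exp (Complex.I * (-(s * (ω₀ ^ 2 + 6)) : ℝ)) *
      ∏ ν, Complex.exp (Complex.I * (2 * s * cosTwoPi (k ν) : ℝ)) := by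
  rw [phase, ← Complex.exp_sum, ← Complex.exp_add]
  congr 1
  simp only [omegaNNSq, Fin.sum_univ_three]
  push_cast
  ring

/-- `ω_nn²` is a sum of functions of single coordinates, so its phase and the characters both
factor. This is why `ω_nn²` is treated first and `ω_nn` only through the square root. -/
theorem integral_mFourier_mul_phase (ω₀ s : ℝ) (n : Fin 3 → ℤ) :
    ∫ k : T3, UnitAddTorus.mFourier (-n) k * phase (omegaNNSq ω₀) s k =
      Complex.exp (Complex.I * (-(s * (ω₀ ^ 2 + 6)) : ℝ)) * ∏ ν, circleOsc (n ν) s := by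
  have h : ∀ k : T3, UnitAddTorus.mFourier (-n) k * phase (omegaNNSq ω₀) s k =
      Complex.exp (Complex.I * (-(s * (ω₀ ^ 2 + 6)) : ℝ)) * ∏ ν, oscIntegrand (n ν) s (k ν) := by
    intro k
    rw [phase_omegaNNSq]
    simp only [UnitAddTorus.mFourier, ContinuousMap.coe_mk, oscIntegrand, Finset.prod_mul_distrib,
      Pi.neg_apply]
    ring
  simp_rw [h]
  rw [integral_const_mul]
  congr 1
  exact integral_fintype_prod_volume_eq_prod fun ν (x : UnitAddCircle) => oscIntegrand (n ν) s x

theorem norm_integral_mFourier_mul_phase (ω₀ s : ℝ) (n : Fin 3 → ℤ) :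
    ‖∫ k : T3, UnitAddTorus.mFourier (-n) k * phase (omegaNNSq ω₀) s k‖ =
      ∏ ν, ‖circleOsc (n ν) s‖ := by
  rw [integral_mFourier_mul_phase, norm_mul, norm_cexp_I_ofReal, one_mul, norm_prod]

/-- Decay of the Bessel function `J₀`. -/
theorem exists_circleOsc_zero_le :
    ∃ C : ℝ, 1 ≤ C ∧ ∀ s : ℝ, s ≠ 0 → ‖circleOsc 0 s‖ ≤ C * |s| ^ (-(1 / 2) : ℝ) := by
  -- The three-dimensional dispersive estimate with `f = 1` bounds the cube of the one-dimensional
  -- integral by a multiple of `|s|^(-3/2)`. The Morse property holds for `ω₀ = 0` too.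
  obtain ⟨d, c, hc, h⟩ := (isMorse_omegaNNSq 0).dispersive
  set A := c * supNorm d (fun _ => (1 : ℂ)) with hA
  have hA0 : 0 ≤ A := mul_nonneg hc.le
    ((norm_nonneg _).trans (norm_le_supNorm (smoothOnTorus_const (1 : ℂ)) d 0))
  refine ⟨A + 1, by linarith, fun s hs => ?_⟩
  have hs' : 0 < |s| := abs_pos.2 hs
  have h1 := h s (fun _ => 1) (smoothOnTorus_const 1)
  have h2 : ‖∫ k : T3, 1 * Complex.exp (-Complex.I * s * omegaNNSq 0 k)‖ = ‖circleOsc 0 s‖ ^ 3 := by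
    have := norm_integral_mFourier_mul_phase 0 s 0
    simp only [neg_zero, UnitAddTorus.mFourier_zero, Pi.zero_apply, Finset.prod_const,
      Finset.card_univ, Fintype.card_fin] at this
    exact this
  have h3 : |s| ≤ bracket s := by
    rw [bracket, ← Real.sqrt_sq_eq_abs]; exact Real.sqrt_le_sqrt (by linarith)
  -- `A ≤ (A + 1)³` lets `A + 1` serve as the constant after the cube root.
  have h4 : ‖circleOsc 0 s‖ ^ 3 ≤ ((A + 1) * |s| ^ (-(1 / 2) : ℝ)) ^ 3 := by
    rw [← h2]
    refine h1.trans ?_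
    have e : (|s| ^ (-(1 / 2) : ℝ)) ^ 3 = (|s| ^ (3 / 2 : ℝ))⁻¹ := by
      rw [← Real.rpow_natCast, ← Real.rpow_mul hs'.le, ← Real.rpow_neg hs'.le]; norm_num
    rw [mul_pow, e, div_mul_eq_mul_div, ← hA, div_eq_mul_inv]
    have h5 : |s| ^ (3 / 2 : ℝ) ≤ bracket s ^ (3 / 2 : ℝ) :=
      Real.rpow_le_rpow hs'.le h3 (by norm_num)
    have h6 : 0 < |s| ^ (3 / 2 : ℝ) := by positivity
    refine mul_le_mul ?_ (inv_anti₀ h6 h5) (inv_nonneg.2 (h6.le.trans h5)) (by positivity)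
    nlinarith [sq_nonneg A, pow_nonneg hA0 3]
  exact le_of_pow_le_pow_left₀ three_ne_zero (by positivity) h4

/-! #### Estimates for non-zero frequencies -/

theorem abs_cosTwoPi_add_sub_le (x : UnitAddCircle) (a : ℝ) :
    |cosTwoPi (x + (a : UnitAddCircle)) - cosTwoPi x| ≤ 2 * Real.pi * |a| := by
  induction x using QuotientAddGroup.induction_on with
  | H x =>
    have h1 : cosTwoPi ((x : UnitAddCircle) + (a : UnitAddCircle)) =
      Real.cos (2 * Real.pi * (x + a)) := cosTwoPi_coe (x + a)
    have h2 : cosTwoPi (x : UnitAddCircle) = Real.cos (2 * Real.pi * x) := cosTwoPi_coe x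
    change |cosTwoPi ((x : UnitAddCircle) + (a : UnitAddCircle)) - cosTwoPi (x : UnitAddCircle)| ≤ _
    rw [h1, h2]
    refine (Real.abs_cos_sub_cos_le _ _).trans ?_
    rw [← mul_sub, add_sub_cancel_left, abs_mul, abs_of_pos Real.two_pi_pos]

/-- Shifting by half a period of the character flips its sign. Averaging the integral with its shift
leaves a difference of phases at distance `1/(2|m|)`, which is controlled by the Lipschitz constant
of the cosine. -/
theorem norm_circleOsc_le_div {m : ℤ} (hm : m ≠ 0) (s : ℝ) :
    ‖circleOsc m s‖ ≤ Real.pi * |s| / |(m : ℝ)| := by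
  have hm' : 0 < |(m : ℝ)| := abs_pos.2 (by exact_mod_cast hm)
  set a : ℝ := 1 / 2 / ((-m : ℤ) : ℝ) with ha
  have hF := continuous_oscIntegrand_right m s
  have h1 : (2 : ℂ) * circleOsc m s = ∫ x : UnitAddCircle,
      (oscIntegrand m s x + oscIntegrand m s (x + (a : UnitAddCircle))) := by
    have hF' : Continuous fun x : UnitAddCircle => oscIntegrand m s (x + (a : UnitAddCircle)) :=
      hF.comp (continuous_id.add continuous_const)
    rw [integral_add (integrable_of_continuous _ hF) (integrable_of_continuous _ hF'),
      integral_add_right_eq_self (oscIntegrand m s), two_mul, circleOsc]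
  have h2 : ∀ x : UnitAddCircle, ‖oscIntegrand m s x + oscIntegrand m s (x + (a : UnitAddCircle))‖ ≤
      2 * (Real.pi * |s| / |(m : ℝ)|) := by
    intro x
    have e : fourier (-m) (x + (a : UnitAddCircle)) = -fourier (-m) x :=
      fourier_add_half_inv_index (neg_ne_zero.2 hm) one_pos x
    rw [oscIntegrand, oscIntegrand, e, neg_mul, ← sub_eq_add_neg, ← mul_sub, norm_mul,
      norm_fourier_apply, one_mul]
    have e2 := Real.norm_exp_I_mul_ofReal_sub_one_le
      (x := 2 * s * cosTwoPi x - 2 * s * cosTwoPi (x + (a : UnitAddCircle)))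
    have e3 : Complex.exp (Complex.I * (2 * s * cosTwoPi x : ℝ)) -
        Complex.exp (Complex.I * (2 * s * cosTwoPi (x + (a : UnitAddCircle)) : ℝ)) =
        Complex.exp (Complex.I * (2 * s * cosTwoPi (x + (a : UnitAddCircle)) : ℝ)) *
        (Complex.exp (Complex.I * (2 * s * cosTwoPi x -
          2 * s * cosTwoPi (x + (a : UnitAddCircle)) : ℝ)) - 1) := by
      rw [mul_sub, ← Complex.exp_add, mul_one]
      congr 2
      push_cast
      ring
    rw [e3, norm_mul, norm_cexp_I_ofReal, one_mul]
    refine e2.trans ?_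
    rw [← mul_sub, Real.norm_eq_abs, abs_mul, abs_mul, abs_two, abs_sub_comm]
    have e4 : |a| = 1 / (2 * |(m : ℝ)|) := by
      rw [ha, Int.cast_neg, abs_div, abs_neg, abs_of_pos (by norm_num : (0 : ℝ) < 1 / 2)]
      field_simp
    calc 2 * |s| * |cosTwoPi (x + (a : UnitAddCircle)) - cosTwoPi x|
        ≤ 2 * |s| * (2 * Real.pi * |a|) :=
          mul_le_mul_of_nonneg_left (abs_cosTwoPi_add_sub_le x a) (by positivity)
      _ = 2 * (Real.pi * |s| / |(m : ℝ)|) := by rw [e4]; field_simp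
  have h3 := norm_integral_le_one_of_norm_le_one (μ := (volume : Measure UnitAddCircle)) h2
  rw [← h1, norm_mul, Complex.norm_ofNat] at h3
  linarith

theorem cosTwoPi_add_sub (y : UnitAddCircle) (a : ℝ) :
    cosTwoPi (y + (a : UnitAddCircle)) - cosTwoPi y =
      2 * Real.sin (Real.pi * a) * cosTwoPi (y + ((a / 2 + 1 / 4 : ℝ) : UnitAddCircle)) := by
  induction y using QuotientAddGroup.induction_on with
  | H y =>
    have h1 : cosTwoPi ((y : UnitAddCircle) + (a : UnitAddCircle)) =
      Real.cos (2 * Real.pi * (y + a)) := cosTwoPi_coe (y + a)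
    have h2 : cosTwoPi (y : UnitAddCircle) = Real.cos (2 * Real.pi * y) := cosTwoPi_coe y
    have h3 : cosTwoPi ((y : UnitAddCircle) + ((a / 2 + 1 / 4 : ℝ) : UnitAddCircle)) =
      Real.cos (2 * Real.pi * (y + (a / 2 + 1 / 4))) := cosTwoPi_coe _
    change cosTwoPi ((y : UnitAddCircle) + (a : UnitAddCircle)) - cosTwoPi (y : UnitAddCircle) =
      _ * cosTwoPi ((y : UnitAddCircle) + ((a / 2 + 1 / 4 : ℝ) : UnitAddCircle))
    rw [h1, h2, h3, Real.cos_sub_cos,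
      show 2 * Real.pi * (y + (a / 2 + 1 / 4)) = (2 * Real.pi * y + Real.pi * a) + Real.pi / 2 by
        ring, Real.cos_add_pi_div_two,
      show (2 * Real.pi * (y + a) + 2 * Real.pi * y) / 2 = 2 * Real.pi * y + Real.pi * a by ring,
      show (2 * Real.pi * (y + a) - 2 * Real.pi * y) / 2 = Real.pi * a by ring]
    ring

/-- A difference of two shifted cosines is again a shifted cosine, with amplitude `2 sin(πa)`.
Differencing therefore reduces every order `m` to order `0`, up to a unimodular constant. -/
theorem oscIntegrand_add_mul_conj (m : ℤ) (s a : ℝ) (y : UnitAddCircle) :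
    oscIntegrand m s (y + (a : UnitAddCircle)) * (starRingEnd ℂ) (oscIntegrand m s y) =
      fourier (-m) (a : UnitAddCircle) *
        oscIntegrand 0 (2 * s * Real.sin (Real.pi * a))
          (y + ((a / 2 + 1 / 4 : ℝ) : UnitAddCircle)) := by
  rw [conj_oscIntegrand, oscIntegrand, oscIntegrand, neg_zero, fourier_zero, one_mul,
    fourier_add_apply]
  have h1 : fourier (-m) y * fourier m y = 1 := by
    rw [← fourier_add, neg_add_cancel, fourier_zero]
  have h2 : Complex.exp (Complex.I * (2 * s * cosTwoPi (y + (a : UnitAddCircle)) : ℝ)) *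
      Complex.exp (Complex.I * (2 * -s * cosTwoPi y : ℝ)) =
      Complex.exp (Complex.I * (2 * (2 * s * Real.sin (Real.pi * a)) *
        cosTwoPi (y + ((a / 2 + 1 / 4 : ℝ) : UnitAddCircle)) : ℝ)) := by
    rw [← Complex.exp_add, ← mul_add, ← Complex.ofReal_add]
    congr 3
    linear_combination (2 * s) * cosTwoPi_add_sub y a
  rw [← h2]
  linear_combination (fourier (-m) (a : UnitAddCircle) *
    (Complex.exp (Complex.I * (2 * s * cosTwoPi (y + (a : UnitAddCircle)) : ℝ)) *
      Complex.exp (Complex.I * (2 * -s * cosTwoPi y : ℝ)))) * h1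

/-- Weyl differencing: write the squared modulus as a double integral and use the difference `h` of
the two variables. -/
theorem circleOsc_mul_conj (m : ℤ) (s : ℝ) :
    circleOsc m s * (starRingEnd ℂ) (circleOsc m s) =
      ∫ h : UnitAddCircle, ∫ y : UnitAddCircle,
        oscIntegrand m s (y + h) * (starRingEnd ℂ) (oscIntegrand m s y) := by
  have hF := continuous_oscIntegrand_right m s
  have hint : Integrable (Function.uncurry fun (y h : UnitAddCircle) =>
      oscIntegrand m s (y + h) * (starRingEnd ℂ) (oscIntegrand m s y)) (volume.prod volume) := by
    refine integrable_of_continuous _ ?_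
    exact (hF.comp (continuous_fst.add continuous_snd)).mul
      (Complex.continuous_conj.comp (hF.comp continuous_fst))
  rw [← integral_integral_swap hint]
  have h1 : ∀ y : UnitAddCircle, ∫ h : UnitAddCircle,
      oscIntegrand m s (y + h) * (starRingEnd ℂ) (oscIntegrand m s y) =
      circleOsc m s * (starRingEnd ℂ) (oscIntegrand m s y) := fun y => by
    rw [integral_mul_const, integral_add_left_eq_self (oscIntegrand m s) y, circleOsc]
  simp_rw [h1]
  rw [integral_const_mul, circleOsc, ← integral_conj]

theorem exists_abs_eq_norm (h : UnitAddCircle) :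
    ∃ a : ℝ, (a : UnitAddCircle) = h ∧ |a| = ‖h‖ ∧ |a| ≤ 1 / 2 := by
  induction h using QuotientAddGroup.induction_on with
  | H x =>
    refine ⟨x - round x, ?_, ?_, abs_sub_round x⟩
    · rw [AddCircle.coe_sub, sub_eq_self]
      exact (AddCircle.coe_eq_zero_iff 1).2 ⟨round x, by simp⟩
    · exact (UnitAddCircle.norm_eq (x := x)).symm

/-- Jordan's inequality, by concavity of the sine on `[0, π/2]`. -/
theorem two_mul_abs_le_abs_sin {a : ℝ} (ha : |a| ≤ 1 / 2) :
    2 * |a| ≤ |Real.sin (Real.pi * a)| := by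
  have h := Real.mul_le_sin (x := Real.pi * |a|) (by positivity) (by nlinarith [Real.pi_pos])
  have e : |Real.sin (Real.pi * a)| = |Real.sin (Real.pi * |a|)| := by
    rcases abs_choice a with h | h <;> rw [h]
    rw [mul_neg, Real.sin_neg, abs_neg]
  rw [e]
  refine le_trans (le_of_eq ?_) (h.trans (le_abs_self _))
  field_simp

/-- Decay of the Bessel functions, uniformly in their order. -/
theorem exists_circleOsc_le :
    ∃ C : ℝ, 1 ≤ C ∧ ∀ (m : ℤ) (s : ℝ), 0 < s → ‖circleOsc m s‖ ≤ C * s ^ (-(1 / 6) : ℝ) := by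
  obtain ⟨C, hC1, hC⟩ := exists_circleOsc_zero_le
  refine ⟨C + 2, by linarith, fun m s hs => ?_⟩
  -- Shifts within `θ` of zero are estimated trivially and have measure at most `2θ`; for the others
  -- the decay of order `0` gives `C (sθ)^(-1/2)`. The choice `θ = s^(-1/3)` makes this equal to
  -- `Cθ`, and the square root gives `s^(-1/6)`.
  set θ := s ^ (-(1 / 3) : ℝ) with hθ
  have hθ0 : 0 < θ := Real.rpow_pos_of_pos hs _
  set G : UnitAddCircle → ℂ := fun h => ∫ y : UnitAddCircle,
    oscIntegrand m s (y + h) * (starRingEnd ℂ) (oscIntegrand m s y) with hG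
  have hGle : ∀ h : UnitAddCircle,
      ‖G h‖ ≤ Set.indicator (Metric.closedBall (0 : UnitAddCircle) θ) (fun _ => 1) h + C * θ := by
    intro h
    have hCθ : 0 ≤ C * θ := by positivity
    obtain ⟨a, rfl, han, ha⟩ := exists_abs_eq_norm h
    have e : ‖G (a : UnitAddCircle)‖ = ‖circleOsc 0 (2 * s * Real.sin (Real.pi * a))‖ := by
      simp only [hG, oscIntegrand_add_mul_conj]
      rw [integral_const_mul, integral_add_right_eq_self
        (oscIntegrand 0 (2 * s * Real.sin (Real.pi * a))), norm_mul, norm_fourier_apply, one_mul,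
        circleOsc]
    rw [e]
    by_cases hmem : (a : UnitAddCircle) ∈ Metric.closedBall (0 : UnitAddCircle) θ
    · rw [Set.indicator_of_mem hmem]
      linarith [norm_circleOsc_le_one 0 (2 * s * Real.sin (Real.pi * a))]
    · rw [Set.indicator_of_notMem hmem, zero_add]
      rw [mem_closedBall_zero_iff, ← han, not_le] at hmem
      have h1 : s * θ ≤ |2 * s * Real.sin (Real.pi * a)| := by
        rw [abs_mul, abs_mul, abs_two, abs_of_pos hs]
        nlinarith [two_mul_abs_le_abs_sin ha]
      have h2 : 0 < s * θ := by positivity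
      have h3 : (s * θ) ^ (-(1 / 2) : ℝ) = θ := by
        rw [hθ]
        nth_rewrite 1 [← Real.rpow_one s]
        rw [← Real.rpow_add hs, ← Real.rpow_mul hs.le]
        norm_num
      calc _ ≤ C * |2 * s * Real.sin (Real.pi * a)| ^ (-(1 / 2) : ℝ) :=
            hC _ (abs_pos.1 (h2.trans_le h1))
        _ ≤ C * (s * θ) ^ (-(1 / 2) : ℝ) := mul_le_mul_of_nonneg_left
            (Real.rpow_le_rpow_of_nonpos h2 h1 (by norm_num)) (by linarith)
        _ = C * θ := by rw [h3]
  have hball : (volume : Measure UnitAddCircle).real (Metric.closedBall 0 θ) ≤ 2 * θ := by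
    rw [measureReal_def, AddCircle.volume_closedBall]
    refine ENNReal.toReal_le_of_le_ofReal (by positivity) (ENNReal.ofReal_le_ofReal (min_le_right _ _))
  have hsq : ‖circleOsc m s‖ ^ 2 ≤ (C + 2) * θ := by
    have h1 := congrArg norm (circleOsc_mul_conj m s)
    rw [norm_mul, RCLike.norm_conj, ← sq] at h1
    rw [h1]
    have hind : Integrable (Set.indicator (Metric.closedBall (0 : UnitAddCircle) θ)
        (fun _ => (1 : ℝ))) := (integrable_const 1).indicator measurableSet_closedBall
    refine (norm_integral_le_of_norm_le (hind.add (integrable_const (C * θ)))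
      (Filter.Eventually.of_forall hGle)).trans ?_
    simp only [Pi.add_apply]
    rw [integral_add hind (integrable_const _), integral_indicator_const _ measurableSet_closedBall]
    simp only [integral_const, smul_eq_mul, mul_one, probReal_univ, one_mul]
    linarith
  have h6 : (s ^ (-(1 / 6) : ℝ)) ^ 2 = θ := by
    rw [hθ, ← Real.rpow_natCast, ← Real.rpow_mul hs.le]; norm_num
  refine le_of_sq_le_sq ?_ (by positivity)
  rw [mul_pow, h6]
  refine hsq.trans (mul_le_mul_of_nonneg_right ?_ hθ0.le)
  nlinarith

/-! ### Fourier coefficients of the kernel -/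

section Swap

variable {X : Type*} [TopologicalSpace X] [MeasurableSpace X] [BorelSpace X]
  [SecondCountableTopology X] (μ : Measure X) [IsFiniteMeasure μ] {p β : ℝ} {Φ : ℝ → X → ℂ}

theorem integrable_laplaceWeight_mul_prod (hp : 0 < p) (hβ : 0 < β)
    (hΦ : Continuous (Function.uncurry Φ)) (hΦ1 : ∀ s x, ‖Φ s x‖ ≤ 1) :
    Integrable (Function.uncurry fun s x => (laplaceWeight p β s : ℂ) * Φ s x)
      ((volume.restrict (Set.Ioi (0 : ℝ))).prod μ) := by
  have h : Integrable (fun s => (laplaceWeight p β s : ℂ)) (volume.restrict (Set.Ioi (0 : ℝ))) :=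
    (integrableOn_laplaceWeight hp hβ).ofReal
  exact Integrable.mul_bdd (c := 1) (h.comp_fst μ) hΦ.aestronglyMeasurable
    (Filter.Eventually.of_forall fun z => hΦ1 z.1 z.2)

theorem integral_integral_laplaceWeight (hp : 0 < p) (hβ : 0 < β)
    (hΦ : Continuous (Function.uncurry Φ)) (hΦ1 : ∀ s x, ‖Φ s x‖ ≤ 1) :
    ∫ x, (∫ s in Set.Ioi (0 : ℝ), (laplaceWeight p β s : ℂ) * Φ s x) ∂μ =
      ∫ s in Set.Ioi (0 : ℝ), (laplaceWeight p β s : ℂ) * ∫ x, Φ s x ∂μ := by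
  rw [← integral_integral_swap (integrable_laplaceWeight_mul_prod μ hp hβ hΦ hΦ1)]
  simp_rw [integral_const_mul]

end Swap

theorem integral_laplaceWeight_mul_cos_complex {p β : ℝ} (hp : 0 < p) (hβ : 0 < β) (y : ℝ) (c : ℂ) :
    ∫ s in Set.Ioi (0 : ℝ), (laplaceWeight p β s : ℂ) * (c * (Real.cos (s * y) : ℂ)) =
      c * (Real.Gamma p * resKernel p β y : ℝ) := by
  rw [← integral_laplaceWeight_mul_cos hp hβ, ← integral_complex_ofReal, ← integral_const_mul]
  refine integral_congr_ae (Filter.Eventually.of_forall fun s => ?_)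
  dsimp only
  push_cast
  ring

theorem norm_ofReal_cos_le (x : ℝ) : ‖(Real.cos x : ℂ)‖ ≤ 1 := by
  rw [Complex.norm_real]; exact Real.abs_cos_le_one x

theorem integrableOn_laplaceWeight_mul {p β : ℝ} (hp : 0 < p) (hβ : 0 < β) {f : ℝ → ℝ}
    (hf : Continuous f) (hf1 : ∀ s, |f s| ≤ 1) :
    IntegrableOn (fun s => laplaceWeight p β s * f s) (Set.Ioi 0) :=
  Integrable.mul_bdd (c := 1) (integrableOn_laplaceWeight hp hβ) hf.aestronglyMeasurable
    (Filter.Eventually.of_forall hf1)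

theorem integral_laplaceWeight_mul_nonneg (p β : ℝ) {f : ℝ → ℝ} (hf : ∀ s, 0 ≤ f s) :
    0 ≤ ∫ s in Set.Ioi (0 : ℝ), laplaceWeight p β s * f s :=
  setIntegral_nonneg measurableSet_Ioi fun s hs => mul_nonneg (laplaceWeight_nonneg p β hs) (hf s)

/-! #### The second moment of the Bessel functions -/

/-- The squared modulus is even in `s`, so averaging over `±s` replaces the exponential by a cosine,
to which the cosine transform of the density applies. -/
theorem norm_circleOsc_sq (m : ℤ) (s : ℝ) : ((‖circleOsc m s‖ ^ 2 : ℝ) : ℂ) =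
    ∫ z : UnitAddCircle × UnitAddCircle, fourier (-m) z.1 * fourier m z.2 *
      (Real.cos (s * (2 * (cosTwoPi z.1 - cosTwoPi z.2))) : ℂ) := by
  have hF := fun s => continuous_oscIntegrand_right m s
  have h1 : ∀ s, ((‖circleOsc m s‖ ^ 2 : ℝ) : ℂ) = ∫ z : UnitAddCircle × UnitAddCircle,
      oscIntegrand m s z.1 * (starRingEnd ℂ) (oscIntegrand m s z.2) := fun s => by
    rw [Complex.ofReal_pow, ← Complex.mul_conj', circleOsc, ← integral_conj]
    exact (integral_prod_mul _ _).symm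
  have hi : ∀ s, Integrable fun z : UnitAddCircle × UnitAddCircle =>
      oscIntegrand m s z.1 * (starRingEnd ℂ) (oscIntegrand m s z.2) := fun s => by
    refine integrable_of_continuous _ ?_
    exact ((hF s).comp continuous_fst).mul
      (Complex.continuous_conj.comp ((hF s).comp continuous_snd))
  have h2 : ((‖circleOsc m s‖ ^ 2 : ℝ) : ℂ) =
      (((‖circleOsc m s‖ ^ 2 : ℝ) : ℂ) + ((‖circleOsc m (-s)‖ ^ 2 : ℝ) : ℂ)) / 2 := by
    rw [norm_circleOsc_neg]; ring
  rw [h2, h1 s, h1 (-s), ← integral_add (hi s) (hi (-s)), ← integral_div]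
  refine integral_congr_ae (Filter.Eventually.of_forall fun z => ?_)
  dsimp only
  rw [conj_oscIntegrand, conj_oscIntegrand, oscIntegrand, oscIntegrand, Complex.ofReal_cos,
    Complex.cos]
  have e1 : Complex.exp (Complex.I * (2 * s * cosTwoPi z.1 : ℝ)) *
      Complex.exp (Complex.I * (2 * -s * cosTwoPi z.2 : ℝ)) =
      Complex.exp (((s * (2 * (cosTwoPi z.1 - cosTwoPi z.2)) : ℝ) : ℂ) * Complex.I) := by
    rw [← Complex.exp_add]; congr 1; push_cast; ring
  have e2 : Complex.exp (Complex.I * (2 * -s * cosTwoPi z.1 : ℝ)) *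
      Complex.exp (Complex.I * (2 * - -s * cosTwoPi z.2 : ℝ)) =
      Complex.exp (-((s * (2 * (cosTwoPi z.1 - cosTwoPi z.2)) : ℝ) : ℂ) * Complex.I) := by
    rw [← Complex.exp_add]; congr 1; push_cast; ring
  rw [← e1, ← e2]
  ring

theorem integral_laplaceWeight_mul_norm_sq {p β : ℝ} (hp : 0 < p) (hβ : 0 < β) (m : ℤ) :
    ((∫ s in Set.Ioi (0 : ℝ), laplaceWeight p β s * ‖circleOsc m s‖ ^ 2 : ℝ) : ℂ) =
      ∫ z : UnitAddCircle × UnitAddCircle, fourier (-m) z.1 * fourier m z.2 *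
        (Real.Gamma p * resKernel p β (2 * (cosTwoPi z.1 - cosTwoPi z.2)) : ℝ) := by
  have hc := continuous_cosTwoPi
  simp_rw [← integral_laplaceWeight_mul_cos_complex hp hβ]
  rw [integral_integral_laplaceWeight volume hp hβ (Φ := fun s (z : UnitAddCircle × UnitAddCircle) =>
    fourier (-m) z.1 * fourier m z.2 *
      (Real.cos (s * (2 * (cosTwoPi z.1 - cosTwoPi z.2))) : ℂ))]
  · simp_rw [← norm_circleOsc_sq, ← Complex.ofReal_mul]
    exact integral_complex_ofReal.symm
  · simp only [Function.uncurry_def]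
    fun_prop
  · intro s z
    rw [norm_mul, norm_mul, norm_fourier_apply, norm_fourier_apply, one_mul, one_mul]
    exact norm_ofReal_cos_le _

/-- The weighted second moment is a Fourier coefficient on the two-torus of a non-negative function,
hence largest at frequency zero. This replaces pointwise decay in `s` that is uniform in `m`: the
rate `s^(-1/6)` is too weak to make the moment bounded for `p` near `1`. -/
theorem integral_laplaceWeight_mul_norm_sq_le {p β : ℝ} (hp : 0 < p) (hp1 : p < 1) (hβ : 0 < β)
    (m : ℤ) : ∫ s in Set.Ioi (0 : ℝ), laplaceWeight p β s * ‖circleOsc m s‖ ^ 2 ≤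
      ∫ s in Set.Ioi (0 : ℝ), laplaceWeight p β s * ‖circleOsc 0 s‖ ^ 2 := by
  have hm := congrArg norm (integral_laplaceWeight_mul_norm_sq hp hβ m)
  have h0 := integral_laplaceWeight_mul_norm_sq hp hβ 0
  rw [Complex.norm_of_nonneg (integral_laplaceWeight_mul_nonneg p β fun s => sq_nonneg _)] at hm
  simp only [neg_zero, fourier_zero, one_mul] at h0
  rw [integral_complex_ofReal, Complex.ofReal_inj] at h0
  rw [hm, h0]
  refine (norm_integral_le_integral_norm _).trans (le_of_eq ?_)
  refine integral_congr_ae (Filter.Eventually.of_forall fun z => ?_)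
  dsimp only
  rw [norm_mul, norm_mul, norm_fourier_apply, norm_fourier_apply, one_mul, one_mul,
    Complex.norm_of_nonneg (mul_nonneg (Real.Gamma_pos_of_pos hp).le
      (resKernel_nonneg hp hp1 hβ _))]

theorem integrableOn_rpow_mul_min {p : ℝ} (hp : 0 < p) (hp1 : p < 1) :
    IntegrableOn (fun s : ℝ => s ^ (p - 1) * min 1 s⁻¹) (Set.Ioi 0) := by
  rw [← Set.Ioc_union_Ioi_eq_Ioi zero_le_one]
  refine IntegrableOn.union ?_ ?_
  · have h : IntegrableOn (fun s : ℝ => s ^ (p - 1)) (Set.Ioc 0 1) :=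
      (intervalIntegrable_iff_integrableOn_Ioc_of_le zero_le_one).1
        (intervalIntegral.intervalIntegrable_rpow' (by linarith))
    refine h.congr_fun (fun s hs => ?_) measurableSet_Ioc
    dsimp only
    rw [min_eq_left ((one_le_inv₀ hs.1).2 hs.2), mul_one]
  · have h : IntegrableOn (fun s : ℝ => s ^ (p - 2)) (Set.Ioi 1) :=
      integrableOn_Ioi_rpow_of_lt (by linarith) one_pos
    refine h.congr_fun (fun s hs => ?_) measurableSet_Ioi
    have hs : 1 < s := hs
    have hs0 : 0 < s := one_pos.trans hs
    dsimp only
    rw [min_eq_right (inv_le_one_of_one_le₀ hs.le), ← Real.rpow_neg_one, ← Real.rpow_add hs0]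
    congr 1
    ring

theorem laplaceWeight_le {p β s : ℝ} (hβ : 0 < β) (hs : 0 < s) :
    laplaceWeight p β s ≤ s ^ (p - 1) := by
  have h : Real.exp (-(β * s)) ≤ 1 := Real.exp_le_one_iff.2 (by have := mul_pos hβ hs; linarith)
  exact mul_le_of_le_one_right (Real.rpow_nonneg hs.le _) h

theorem continuous_norm_circleOsc_sq (m : ℤ) : Continuous fun s => ‖circleOsc m s‖ ^ 2 :=
  (continuous_circleOsc m).norm.pow 2

/-- By the reduction to order zero, the integrand is at most a multiple of `s^(p-1) min(1, 1/s)`,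
which is integrable exactly because `0 < p < 1`. Dropping `e^(-βs)` makes the bound uniform in `β`.
-/
theorem exists_secondMoment_le {p : ℝ} (hp : 0 < p) (hp1 : p < 1) :
    ∃ D : ℝ, 0 ≤ D ∧ ∀ β : ℝ, 0 < β → ∀ m : ℤ,
      ∫ s in Set.Ioi (0 : ℝ), laplaceWeight p β s * ‖circleOsc m s‖ ^ 2 ≤ D := by
  obtain ⟨C, hC1, hC⟩ := exists_circleOsc_zero_le
  refine ⟨∫ s in Set.Ioi (0 : ℝ), C ^ 2 * (s ^ (p - 1) * min 1 s⁻¹),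
    setIntegral_nonneg measurableSet_Ioi fun s hs => ?_, fun β hβ m => ?_⟩
  · have hs : 0 < s := hs
    positivity
  refine (integral_laplaceWeight_mul_norm_sq_le hp hp1 hβ m).trans ?_
  refine setIntegral_mono_on (integrableOn_laplaceWeight_mul hp hβ
    (continuous_norm_circleOsc_sq 0) fun s => ?_)
    ((integrableOn_rpow_mul_min hp hp1).const_mul _) measurableSet_Ioi fun s hs => ?_
  · rw [abs_of_nonneg (sq_nonneg _)]
    exact pow_le_one₀ (norm_nonneg _) (norm_circleOsc_le_one 0 s)
  · have hs : 0 < s := hs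
    have h1 : ‖circleOsc 0 s‖ ^ 2 ≤ C ^ 2 * min 1 s⁻¹ := by
      rw [mul_min_of_nonneg _ _ (sq_nonneg C), le_min_iff, mul_one]
      constructor
      · exact pow_le_pow_left₀ (norm_nonneg _) ((norm_circleOsc_le_one 0 s).trans hC1) 2
      · have h2 := pow_le_pow_left₀ (norm_nonneg _) (hC s hs.ne') 2
        rw [abs_of_pos hs, mul_pow, ← Real.rpow_natCast (s ^ _), ← Real.rpow_mul hs.le] at h2
        norm_num [Real.rpow_neg_one] at h2
        exact h2
    calc _ ≤ s ^ (p - 1) * (C ^ 2 * min 1 s⁻¹) :=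
          mul_le_mul (laplaceWeight_le hβ hs) h1 (sq_nonneg _) (by positivity)
      _ = _ := by ring

/-! #### Products of three Bessel functions -/

theorem mul_mul_le_sum_cubes {a b c : ℝ} (ha : 0 ≤ a) (hb : 0 ≤ b) (hc : 0 ≤ c) :
    a * b * c ≤ a ^ 3 + b ^ 3 + c ^ 3 := by
  nlinarith [mul_nonneg (add_nonneg (add_nonneg ha hb) hc)
    (add_nonneg (add_nonneg (sq_nonneg (a - b)) (sq_nonneg (b - c))) (sq_nonneg (c - a))),
    mul_nonneg (mul_nonneg ha hb) hc]

/-- The cube is left as one factor times a square: the square goes into the second moment, the spare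
factor supplies smallness. -/
theorem prod_norm_circleOsc_le (n : Fin 3 → ℤ) (s : ℝ) :
    ∏ ν, ‖circleOsc (n ν) s‖ ≤ ∑ ν, ‖circleOsc (n ν) s‖ * ‖circleOsc (n ν) s‖ ^ 2 := by
  rw [Fin.prod_univ_three, Fin.sum_univ_three]
  refine (mul_mul_le_sum_cubes (norm_nonneg _) (norm_nonneg _) (norm_nonneg _)).trans (le_of_eq ?_)
  ring

theorem continuous_prod_norm_circleOsc (n : Fin 3 → ℤ) :
    Continuous fun s => ∏ ν, ‖circleOsc (n ν) s‖ :=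
  continuous_finsetProd _ fun ν _ => (continuous_circleOsc (n ν)).norm

theorem prod_norm_circleOsc_nonneg (n : Fin 3 → ℤ) (s : ℝ) : 0 ≤ ∏ ν, ‖circleOsc (n ν) s‖ :=
  Finset.prod_nonneg fun _ _ => norm_nonneg _

theorem prod_norm_circleOsc_le_norm (n : Fin 3 → ℤ) (s : ℝ) (ν : Fin 3) :
    ∏ ν, ‖circleOsc (n ν) s‖ ≤ ‖circleOsc (n ν) s‖ := by
  rw [← Finset.mul_prod_erase _ _ (Finset.mem_univ ν)]
  exact mul_le_of_le_one_right (norm_nonneg _)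
    (Finset.prod_le_one (fun _ _ => norm_nonneg _) fun _ _ => norm_circleOsc_le_one _ s)

theorem integrableOn_laplaceWeight_mul_prod {p β : ℝ} (hp : 0 < p) (hβ : 0 < β) (n : Fin 3 → ℤ) :
    IntegrableOn (fun s => laplaceWeight p β s * ∏ ν, ‖circleOsc (n ν) s‖) (Set.Ioi 0) :=
  integrableOn_laplaceWeight_mul hp hβ (continuous_prod_norm_circleOsc n) fun s => by
    rw [abs_of_nonneg (prod_norm_circleOsc_nonneg n s)]
    exact (prod_norm_circleOsc_le_norm n s 0).trans (norm_circleOsc_le_one _ s)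

theorem integrableOn_laplaceWeight_mul_norm_sq {p β : ℝ} (hp : 0 < p) (hβ : 0 < β) (m : ℤ) :
    IntegrableOn (fun s => laplaceWeight p β s * ‖circleOsc m s‖ ^ 2) (Set.Ioi 0) :=
  integrableOn_laplaceWeight_mul hp hβ (continuous_norm_circleOsc_sq m) fun s => by
    rw [abs_of_nonneg (sq_nonneg _)]
    exact pow_le_one₀ (norm_nonneg _) (norm_circleOsc_le_one m s)

theorem integral_laplaceWeight_mul_sum_norm_sq_le {p β D : ℝ} (hp : 0 < p) (hβ : 0 < β)
    (hD : ∀ m : ℤ, ∫ s in Set.Ioi (0 : ℝ), laplaceWeight p β s * ‖circleOsc m s‖ ^ 2 ≤ D)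
    (n : Fin 3 → ℤ) :
    ∫ s in Set.Ioi (0 : ℝ), ∑ ν, laplaceWeight p β s * ‖circleOsc (n ν) s‖ ^ 2 ≤ 3 * D := by
  rw [integral_finsetSum _ fun ν _ => integrableOn_laplaceWeight_mul_norm_sq hp hβ (n ν)]
  calc _ ≤ ∑ ν : Fin 3, D := Finset.sum_le_sum fun ν _ => hD (n ν)
    _ = 3 * D := by simp

/-- For the second bound, split at `s = S`. Below `S`, a factor with large index is at most `πS/R`;
above `S`, one factor of each cube is `O(S^(-1/6))` and the remaining squares have bounded second
moments. -/
theorem exists_integral_prod_le {p : ℝ} (hp : 0 < p) (hp1 : p < 1) :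
    ∃ K : ℝ, 0 ≤ K ∧ ∀ β : ℝ, 0 < β → ∀ n : Fin 3 → ℤ,
      ∫ s in Set.Ioi (0 : ℝ), laplaceWeight p β s * ∏ ν, ‖circleOsc (n ν) s‖ ≤ K ∧
      ∀ S R : ℝ, 1 ≤ S → 0 < R → (∃ ν, R ≤ |(n ν : ℝ)|) →
        ∫ s in Set.Ioi (0 : ℝ), laplaceWeight p β s * ∏ ν, ‖circleOsc (n ν) s‖ ≤
          K * (S ^ 2 / R + S ^ (-(1 / 6) : ℝ)) := by
  obtain ⟨D, hD0, hD⟩ := exists_secondMoment_le hp hp1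
  obtain ⟨C, hC1, hC⟩ := exists_circleOsc_le
  have hΓ := Real.Gamma_pos_of_pos hp
  have hC0 : 0 ≤ C := by linarith
  refine ⟨Real.pi * Real.exp 1 * Real.Gamma p + C * (3 * D), by positivity,
    fun β hβ n => ⟨?_, fun S R hS hR hn => ?_⟩⟩
  · calc _ ≤ ∫ s in Set.Ioi (0 : ℝ), ∑ ν, laplaceWeight p β s * ‖circleOsc (n ν) s‖ ^ 2 := by
          refine setIntegral_mono_on (integrableOn_laplaceWeight_mul_prod hp hβ n)
            (integrable_finsetSum _ fun ν _ => integrableOn_laplaceWeight_mul_norm_sq hp hβ (n ν))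
            measurableSet_Ioi fun s hs => ?_
          rw [← Finset.mul_sum]
          refine mul_le_mul_of_nonneg_left ((prod_norm_circleOsc_le n s).trans
            (Finset.sum_le_sum fun ν _ => ?_)) (laplaceWeight_nonneg p β hs)
          exact mul_le_of_le_one_left (sq_nonneg _) (norm_circleOsc_le_one _ s)
      _ ≤ 3 * D := integral_laplaceWeight_mul_sum_norm_sq_le hp hβ (hD β hβ) n
      _ ≤ C * (3 * D) := le_mul_of_one_le_left (by positivity) hC1
      _ ≤ _ := le_add_of_nonneg_left (by positivity)
  · have hS0 : 0 < S := one_pos.trans_le hS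
    set A := Real.pi * S / R * Real.exp 1 with hA
    have hA0 : 0 ≤ A := by positivity
    set B := C * S ^ (-(1 / 6) : ℝ) with hB
    have hB0 : 0 ≤ B := by positivity
    have hpt : ∀ s ∈ Set.Ioi (0 : ℝ), laplaceWeight p β s * ∏ ν, ‖circleOsc (n ν) s‖ ≤
        A * (s ^ (p - 1) * Real.exp (-(1 / S * s))) +
          B * ∑ ν, laplaceWeight p β s * ‖circleOsc (n ν) s‖ ^ 2 := by
      intro s hs
      have hw := laplaceWeight_nonneg p β hs
      have hw' := laplaceWeight_le (p := p) hβ hs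
      have hs : 0 < s := hs
      have h2 : 0 ≤ B * ∑ ν, laplaceWeight p β s * ‖circleOsc (n ν) s‖ ^ 2 :=
        mul_nonneg hB0 (Finset.sum_nonneg fun ν _ => mul_nonneg hw (sq_nonneg _))
      rcases le_or_gt s S with hsS | hsS
      · obtain ⟨ν, hν⟩ := hn
        have hν0 : n ν ≠ 0 := by
          intro h0
          rw [h0, Int.cast_zero, abs_zero] at hν
          linarith
        have h1 : ∏ ν, ‖circleOsc (n ν) s‖ ≤ Real.pi * S / R := by
          refine (prod_norm_circleOsc_le_norm n s ν).trans ((norm_circleOsc_le_div hν0 s).trans ?_)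
          rw [abs_of_pos hs]
          gcongr
        -- The sharp cutoff `s ≤ S` is replaced by `e · e^(-s/S)`, so that the Gamma integral
        -- evaluates the first part as a multiple of `S^p ≤ S`.
        have h3 : 1 ≤ Real.exp 1 * Real.exp (-(1 / S * s)) := by
          rw [← Real.exp_add, Real.one_le_exp_iff, one_div, inv_mul_eq_div]
          have := (div_le_one hS0).2 hsS
          linarith
        refine le_add_of_le_of_nonneg ?_ h2
        calc _ ≤ s ^ (p - 1) * (Real.pi * S / R) :=
              mul_le_mul hw' h1 (prod_norm_circleOsc_nonneg n s) (by positivity)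
          _ ≤ s ^ (p - 1) * (Real.pi * S / R) * (Real.exp 1 * Real.exp (-(1 / S * s))) :=
              le_mul_of_one_le_right (by positivity) h3
          _ = _ := by rw [hA]; ring
      · refine le_add_of_nonneg_of_le (by positivity) ?_
        rw [← Finset.mul_sum, mul_left_comm, Finset.mul_sum]
        refine mul_le_mul_of_nonneg_left ((prod_norm_circleOsc_le n s).trans
          (Finset.sum_le_sum fun ν _ => mul_le_mul_of_nonneg_right ?_ (sq_nonneg _))) hw
        refine (hC (n ν) s hs).trans (mul_le_mul_of_nonneg_left ?_ hC0)
        exact Real.rpow_le_rpow_of_nonpos hS0 hsS.le (by norm_num)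
    have hi1 := (integrableOn_rpow_mul_exp (q := p - 1) (by linarith)
      (one_div_pos.2 hS0)).const_mul A
    have hi2 := (integrable_finsetSum (μ := volume.restrict (Set.Ioi (0 : ℝ))) Finset.univ fun ν _ =>
      integrableOn_laplaceWeight_mul_norm_sq hp hβ (n ν)).const_mul B
    refine (setIntegral_mono_on (integrableOn_laplaceWeight_mul_prod hp hβ n) (hi1.add hi2)
      measurableSet_Ioi hpt).trans ?_
    simp only [Pi.add_apply]
    rw [integral_add hi1 hi2, integral_const_mul, integral_const_mul,
      Real.integral_rpow_mul_exp_neg_mul_Ioi hp (one_div_pos.2 hS0), one_div_one_div]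
    have hSp : S ^ p ≤ S := by
      simpa using Real.rpow_le_rpow_of_exponent_le hS hp1.le
    have hD' := integral_laplaceWeight_mul_sum_norm_sq_le hp hβ (hD β hβ) n
    have hX : 0 ≤ S ^ 2 / R := by positivity
    have hY : 0 ≤ S ^ (-(1 / 6) : ℝ) := by positivity
    calc _ ≤ A * (S * Real.Gamma p) + B * (3 * D) := by gcongr
      _ = Real.pi * Real.exp 1 * Real.Gamma p * (S ^ 2 / R) +
          C * (3 * D) * S ^ (-(1 / 6) : ℝ) := by rw [hA, hB]; field_simp
      _ ≤ _ := by
          have h1 : 0 ≤ Real.pi * Real.exp 1 * Real.Gamma p * S ^ (-(1 / 6) : ℝ) := by positivity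
          have h2 : 0 ≤ C * (3 * D) * (S ^ 2 / R) := by positivity
          linarith

/-! #### The Fourier coefficients -/

/-- Fourier coefficients on the torus. -/
def torusCoeff (f : T3 → ℝ) (n : Fin 3 → ℤ) : ℂ := ∫ k, UnitAddTorus.mFourier (-n) k * (f k : ℂ)

theorem norm_mFourier_apply (n : Fin 3 → ℤ) (k : T3) : ‖UnitAddTorus.mFourier n k‖ = 1 := by
  simp only [UnitAddTorus.mFourier, ContinuousMap.coe_mk, norm_prod, norm_fourier_apply,
    Finset.prod_const_one]

theorem ofReal_cos_eq_phase (ω : T3 → ℝ) (α s : ℝ) (k : T3) :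
    (Real.cos (s * (α - ω k)) : ℂ) = Complex.exp (Complex.I * (s * α : ℝ)) / 2 * phase ω s k +
      Complex.exp (Complex.I * (-(s * α) : ℝ)) / 2 * phase ω (-s) k := by
  rw [Complex.ofReal_cos, Complex.cos, phase, phase, div_mul_eq_mul_div, div_mul_eq_mul_div,
    ← Complex.exp_add, ← Complex.exp_add, ← add_div]
  congr 3 <;> · push_cast; ring

theorem norm_integral_mFourier_mul_cos_le (ω₀ α s : ℝ) (n : Fin 3 → ℤ) :
    ‖∫ k, UnitAddTorus.mFourier (-n) k * (Real.cos (s * (α - omegaNNSq ω₀ k)) : ℂ)‖ ≤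
      ∏ ν, ‖circleOsc (n ν) s‖ := by
  have hω := smooth_omegaNNSq ω₀
  have hi : ∀ (c : ℂ) (t : ℝ), Integrable fun k : T3 =>
      c * (UnitAddTorus.mFourier (-n) k * phase (omegaNNSq ω₀) t k) := fun c t =>
    integrable_of_continuous _ (continuous_const.mul
      ((UnitAddTorus.mFourier (-n)).continuous.mul (smooth_phase hω t).continuous))
  have h1 : ∀ k, UnitAddTorus.mFourier (-n) k * (Real.cos (s * (α - omegaNNSq ω₀ k)) : ℂ) =
      Complex.exp (Complex.I * (s * α : ℝ)) / 2 *
        (UnitAddTorus.mFourier (-n) k * phase (omegaNNSq ω₀) s k) +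
      Complex.exp (Complex.I * (-(s * α) : ℝ)) / 2 *
        (UnitAddTorus.mFourier (-n) k * phase (omegaNNSq ω₀) (-s) k) := fun k => by
    rw [ofReal_cos_eq_phase]; ring
  simp_rw [h1]
  rw [integral_add (hi _ _) (hi _ _), integral_const_mul, integral_const_mul]
  refine (norm_add_le _ _).trans (le_of_eq ?_)
  rw [norm_mul, norm_mul, norm_integral_mFourier_mul_phase, norm_integral_mFourier_mul_phase,
    norm_div, norm_div, norm_cexp_I_ofReal, norm_cexp_I_ofReal]
  simp only [norm_circleOsc_neg, Complex.norm_ofNat]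
  ring

/-- Expand the kernel as a cosine transform and integrate over the torus first. The shift `α` enters
only through unimodular factors, so the bound is uniform in it. -/
theorem norm_torusCoeff_resKernel_le {p β : ℝ} (hp : 0 < p) (hβ : 0 < β) (ω₀ α : ℝ)
    (n : Fin 3 → ℤ) :
    Real.Gamma p * ‖torusCoeff (fun k => resKernel p β (α - omegaNNSq ω₀ k)) n‖ ≤
      ∫ s in Set.Ioi (0 : ℝ), laplaceWeight p β s * ∏ ν, ‖circleOsc (n ν) s‖ := by
  have hω := (smooth_omegaNNSq ω₀).continuous
  have h1 : (Real.Gamma p : ℂ) * torusCoeff (fun k => resKernel p β (α - omegaNNSq ω₀ k)) n =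
      ∫ s in Set.Ioi (0 : ℝ), (laplaceWeight p β s : ℂ) *
        ∫ k, UnitAddTorus.mFourier (-n) k * (Real.cos (s * (α - omegaNNSq ω₀ k)) : ℂ) := by
    rw [← integral_integral_laplaceWeight volume hp hβ
      (Φ := fun s (k : T3) => UnitAddTorus.mFourier (-n) k *
        (Real.cos (s * (α - omegaNNSq ω₀ k)) : ℂ))]
    · simp_rw [integral_laplaceWeight_mul_cos_complex hp hβ]
      rw [torusCoeff, ← integral_const_mul]
      refine integral_congr_ae (Filter.Eventually.of_forall fun k => ?_)
      dsimp only
      push_cast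
      ring
    · have := (UnitAddTorus.mFourier (-n)).continuous
      simp only [Function.uncurry_def]
      fun_prop
    · intro s k
      rw [norm_mul, norm_mFourier_apply, one_mul]
      exact norm_ofReal_cos_le _
  have h2 := congrArg norm h1
  rw [norm_mul, Complex.norm_of_nonneg (Real.Gamma_pos_of_pos hp).le] at h2
  rw [h2]
  refine norm_integral_le_of_norm_le (integrableOn_laplaceWeight_mul_prod hp hβ n)
    ((ae_restrict_iff' measurableSet_Ioi).2 (Filter.Eventually.of_forall fun s hs => ?_))
  have hw := laplaceWeight_nonneg p β hs
  rw [norm_mul, Complex.norm_of_nonneg hw]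
  exact mul_le_mul_of_nonneg_left (norm_integral_mFourier_mul_cos_le ω₀ α s n) hw

/-! ### Parseval's identity and convolutions -/

theorem hasSum_conj_torusCoeff_mul {f g : T3 → ℝ} (hf : Continuous f) (hg : Continuous g) :
    HasSum (fun n => (starRingEnd ℂ) (torusCoeff f n) * torusCoeff g n)
      ((∫ k, f k * g k : ℝ) : ℂ) := by
  have key : ∀ {f : T3 → ℝ} (hf : Continuous f), ∃ F : Lp ℂ 2 (Measure.pi fun _ : Fin 3 =>
      (AddCircle.haarAddCircle : Measure UnitAddCircle)),
      (F =ᵐ[Measure.pi fun _ : Fin 3 => AddCircle.haarAddCircle] fun k => (f k : ℂ)) ∧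
      ∀ n, UnitAddTorus.mFourierCoeff F n = torusCoeff f n := by
    intro f hf
    let F : C(T3, ℂ) := ⟨fun k => (f k : ℂ), Complex.continuous_ofReal.comp hf⟩
    refine ⟨ContinuousMap.toLp (E := ℂ) 2 _ ℂ F, ContinuousMap.coeFn_toLp _ F, fun n => ?_⟩
    rw [torusCoeff, volume_T3]
    exact UnitAddTorus.mFourierCoeff_toLp F n
  obtain ⟨F, hF, hFc⟩ := key hf
  obtain ⟨G, hG, hGc⟩ := key hg
  have h := UnitAddTorus.hasSum_prod_mFourierCoeff F G
  simp only [hFc, hGc] at h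
  convert! h using 1
  rw [volume_T3, ← integral_complex_ofReal]
  refine integral_congr_ae ?_
  filter_upwards [hF, hG] with k h1 h2
  rw [h1, h2, Complex.conj_ofReal, Complex.ofReal_mul]

theorem hasSum_norm_torusCoeff_sq {f : T3 → ℝ} (hf : Continuous f) :
    HasSum (fun n => ‖torusCoeff f n‖ ^ 2) (∫ k, f k ^ 2) := by
  rw [← Complex.hasSum_ofReal]
  convert! hasSum_conj_torusCoeff_mul hf hf using 2 with n
  · rw [Complex.conj_mul', Complex.ofReal_pow]
  · simp only [sq]

theorem mFourier_add_apply (n : Fin 3 → ℤ) (x y : T3) :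
    UnitAddTorus.mFourier n (x + y) = UnitAddTorus.mFourier n x * UnitAddTorus.mFourier n y := by
  simp only [UnitAddTorus.mFourier, ContinuousMap.coe_mk, Pi.add_apply, fourier_add_apply,
    Finset.prod_mul_distrib]

theorem continuous_convolution {f g : T3 → ℝ} (hf : Continuous f) (hg : Continuous g) (u : T3) :
    Continuous fun k => ∫ l, f l * g (k - l + u) := by
  have h : Continuous (Function.uncurry fun k l : T3 => f l * g (k - l + u)) := by
    simp only [Function.uncurry_def]; fun_prop
  simpa using continuous_parametric_integral_of_continuous (μ := (volume : Measure T3)) h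
    isCompact_univ

theorem torusCoeff_convolution {f g : T3 → ℝ} (hf : Continuous f) (hg : Continuous g) (u : T3)
    (n : Fin 3 → ℤ) : torusCoeff (fun k => ∫ l, f l * g (k - l + u)) n =
      torusCoeff f n * torusCoeff g n * UnitAddTorus.mFourier (-n) (-u) := by
  have hm := (UnitAddTorus.mFourier (-n)).continuous
  have hi : Integrable (Function.uncurry fun k l : T3 =>
      UnitAddTorus.mFourier (-n) k * ((f l * g (k - l + u) : ℝ) : ℂ)) (volume.prod volume) := by
    refine integrable_of_continuous _ ?_
    simp only [Function.uncurry_def]; fun_prop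
  calc _ = ∫ k, ∫ l, UnitAddTorus.mFourier (-n) k * ((f l * g (k - l + u) : ℝ) : ℂ) := by
        simp_rw [integral_const_mul, integral_complex_ofReal]; rfl
    _ = ∫ l, ∫ k, UnitAddTorus.mFourier (-n) k * ((f l * g (k - l + u) : ℝ) : ℂ) :=
        integral_integral_swap hi
    _ = ∫ l, UnitAddTorus.mFourier (-n) l * (f l : ℂ) *
          (torusCoeff g n * UnitAddTorus.mFourier (-n) (-u)) := by
        refine integral_congr_ae (Filter.Eventually.of_forall fun l => ?_)
        dsimp only
        rw [← integral_comp_add_right _ (l - u), torusCoeff, ← integral_mul_const,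
          ← integral_const_mul]
        refine integral_congr_ae (Filter.Eventually.of_forall fun k => ?_)
        dsimp only
        rw [show k + (l - u) - l + u = k by abel, sub_eq_add_neg, mFourier_add_apply,
          mFourier_add_apply, Complex.ofReal_mul]
        ring
    _ = _ := by rw [integral_mul_const, ← mul_assoc]; rfl

/-- By Parseval, the integral is a sum over `n` of products of three coefficients, with `u` entering
only through a unimodular factor. On `s` each term is at most `M³`; off `s` the third coefficient is
at most `δ`, and `ab ≤ (a² + b²)/2` returns the other two to `L²` norms. -/
theorem integral_convolution_le {H : Fin 3 → T3 → ℝ} (hH : ∀ i, Continuous (H i)) (u : T3)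
    (s : Finset (Fin 3 → ℤ)) {M δ E : ℝ} (hδ : 0 ≤ δ) (hM : ∀ i n, ‖torusCoeff (H i) n‖ ≤ M)
    (hs : ∀ n ∉ s, ‖torusCoeff (H 2) n‖ ≤ δ) (hE : ∀ i, ∫ k, H i k ^ 2 ≤ E) :
    ∫ k : T3 × T3, H 0 k.1 * H 1 k.2 * H 2 (k.1 - k.2 + u) ≤ s.card * M ^ 3 + δ * E := by
  have hF := continuous_convolution (hH 1) (hH 2) u
  have hM0 : 0 ≤ M := (norm_nonneg _).trans (hM 0 0)
  have h1 : ∫ k : T3 × T3, H 0 k.1 * H 1 k.2 * H 2 (k.1 - k.2 + u) =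
      ∫ k, H 0 k * ∫ l, H 1 l * H 2 (k - l + u) := by
    have h0 := hH 0
    have h1 := hH 1
    have h2 := hH 2
    rw [Measure.volume_eq_prod, integral_prod _ (integrable_of_continuous _ (by fun_prop))]
    simp_rw [mul_assoc, integral_const_mul]
  have hsum := hasSum_conj_torusCoeff_mul (hH 0) hF
  have hlow : HasSum (fun n => if n ∈ s then M ^ 3 else 0) (∑ n ∈ s, if n ∈ s then M ^ 3 else 0) :=
    hasSum_sum_of_ne_finset_zero fun n hn => if_neg hn
  have hbound := hlow.add (((hasSum_norm_torusCoeff_sq (hH 0)).add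
    (hasSum_norm_torusCoeff_sq (hH 1))).mul_left (δ / 2))
  have hle := hsum.norm_le_of_bounded hbound fun n => by
    have e : ‖UnitAddTorus.mFourier (-n) (-u)‖ = 1 := norm_mFourier_apply _ _
    rw [torusCoeff_convolution (hH 1) (hH 2), norm_mul, norm_mul, norm_mul, RCLike.norm_conj, e,
      mul_one]
    have a0 := norm_nonneg (torusCoeff (H 0) n)
    have a1 := norm_nonneg (torusCoeff (H 1) n)
    have a2 := norm_nonneg (torusCoeff (H 2) n)
    by_cases hn : n ∈ s
    · rw [if_pos hn]
      refine le_add_of_le_of_nonneg ?_ (by positivity)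
      calc _ ≤ M * (M * M) := mul_le_mul (hM 0 n) (mul_le_mul (hM 1 n) (hM 2 n) a2 hM0)
            (mul_nonneg a1 a2) hM0
        _ = _ := by ring
    · rw [if_neg hn, zero_add, ← mul_assoc]
      calc _ ≤ ‖torusCoeff (H 0) n‖ * ‖torusCoeff (H 1) n‖ * δ :=
            mul_le_mul_of_nonneg_left (hs n hn) (mul_nonneg a0 a1)
        _ ≤ _ := by
            nlinarith [mul_nonneg hδ (sq_nonneg (‖torusCoeff (H 0) n‖ - ‖torusCoeff (H 1) n‖))]
  rw [h1]
  refine (le_abs_self _).trans ?_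
  rw [← Real.norm_eq_abs, ← Complex.norm_real]
  refine hle.trans ?_
  rw [Finset.sum_congr rfl fun n hn => if_pos hn, Finset.sum_const, nsmul_eq_mul]
  have := mul_le_mul_of_nonneg_left (add_le_add (hE 0) (hE 1)) (div_nonneg hδ zero_le_two)
  linarith

/-! ### The crossing estimate for the nearest-neighbour dispersion relation -/

theorem exists_norm_torusCoeff_resKernel_le {p : ℝ} (hp : 0 < p) (hp1 : p < 1) :
    ∃ M : ℝ, 0 ≤ M ∧ ∀ β : ℝ, 0 < β → ∀ (ω₀ α : ℝ) (n : Fin 3 → ℤ),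
      ‖torusCoeff (fun k => resKernel p β (α - omegaNNSq ω₀ k)) n‖ ≤ M ∧
      ∀ S R : ℝ, 1 ≤ S → 0 < R → (∃ ν, R ≤ |(n ν : ℝ)|) →
        ‖torusCoeff (fun k => resKernel p β (α - omegaNNSq ω₀ k)) n‖ ≤
          M * (S ^ 2 / R + S ^ (-(1 / 6) : ℝ)) := by
  obtain ⟨K, hK0, hK⟩ := exists_integral_prod_le hp hp1
  have hΓ := Real.Gamma_pos_of_pos hp
  refine ⟨K / Real.Gamma p, by positivity, fun β hβ ω₀ α n => ?_⟩
  have h := norm_torusCoeff_resKernel_le hp hβ ω₀ α n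
  rw [mul_comm, ← le_div_iff₀ hΓ] at h
  refine ⟨h.trans (div_le_div_of_nonneg_right (hK β hβ n).1 hΓ.le), fun S R hS hR hn =>
    h.trans ?_⟩
  rw [div_mul_eq_mul_div]
  exact div_le_div_of_nonneg_right ((hK β hβ n).2 S R hS hR hn) hΓ.le

/-- The sup norm of the kernel is at most `β^(-p)`, and by positivity its integral is its zeroth
Fourier coefficient. -/
theorem integral_resKernel_sq_le {p β M : ℝ} (hp : 0 < p) (hp1 : p < 1) (hβ : 0 < β) {g : T3 → ℝ}
    (hg : Continuous g) (hM : ‖torusCoeff (fun k => resKernel p β (g k)) 0‖ ≤ M) :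
    ∫ k, resKernel p β (g k) ^ 2 ≤ β ^ (-p) * M := by
  have hc : Continuous fun k => resKernel p β (g k) := (continuous_resKernel p hβ).comp hg
  have h0 := fun k => resKernel_nonneg hp hp1 hβ (g k)
  have h1 : torusCoeff (fun k => resKernel p β (g k)) 0 = ((∫ k, resKernel p β (g k) : ℝ) : ℂ) := by
    rw [torusCoeff, ← integral_complex_ofReal]
    simp [UnitAddTorus.mFourier_zero]
  rw [h1, Complex.norm_of_nonneg (integral_nonneg h0)] at hM
  calc _ ≤ ∫ k, β ^ (-p) * resKernel p β (g k) :=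
        integral_mono (integrable_of_continuous _ (hc.pow 2))
          (integrable_of_continuous _ (continuous_const.mul hc)) fun k => by
            dsimp only
            rw [sq]
            exact mul_le_mul_of_nonneg_right (resKernel_le hp hβ _) (h0 k)
    _ ≤ _ := by
        rw [integral_const_mul]
        exact mul_le_mul_of_nonneg_left hM (by positivity)

theorem card_box_le {R : ℝ} (hR : 1 ≤ R) :
    ((Fintype.piFinset fun _ : Fin 3 => Finset.Icc (-(⌊R⌋₊ : ℤ)) ⌊R⌋₊).card : ℝ) ≤ 27 * R ^ 3 := by
  have h1 : (⌊R⌋₊ : ℝ) ≤ R := Nat.floor_le (by linarith)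
  have h2 : ((⌊R⌋₊ : ℤ) + 1 - -(⌊R⌋₊ : ℤ)).toNat = 2 * ⌊R⌋₊ + 1 := by omega
  rw [Fintype.card_piFinset, Finset.prod_const, Finset.card_univ, Fintype.card_fin, Int.card_Icc, h2]
  push_cast
  calc _ ≤ (3 * R) ^ 3 := by gcongr; linarith
    _ = _ := by ring

theorem exists_le_abs_of_notMem_box {R : ℝ} {n : Fin 3 → ℤ}
    (hn : n ∉ Fintype.piFinset fun _ : Fin 3 => Finset.Icc (-(⌊R⌋₊ : ℤ)) ⌊R⌋₊) :
    ∃ ν, R ≤ |(n ν : ℝ)| := by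
  simp only [Fintype.mem_piFinset, not_forall, Finset.mem_Icc, ← abs_le, not_le] at hn
  obtain ⟨ν, hν⟩ := hn
  refine ⟨ν, (Nat.lt_floor_add_one R).le.trans ?_⟩
  exact_mod_cast hν

theorem exists_integral_resKernel_le {p : ℝ} (hp : 0 < p) (hp1 : p < 1) :
    ∃ C : ℝ, 0 ≤ C ∧ ∀ (u : T3) (β : ℝ), 0 < β → β ≤ 1 → ∀ (ω₀ : ℝ) (α : Fin 3 → ℝ),
      ∫ k : T3 × T3, resKernel p β (α 0 - omegaNNSq ω₀ k.1) *
        resKernel p β (α 1 - omegaNNSq ω₀ k.2) *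
        resKernel p β (α 2 - omegaNNSq ω₀ (k.1 - k.2 + u)) ≤ C * β ^ (-(71 / 72) : ℝ) := by
  obtain ⟨M, hM0, hM⟩ := exists_norm_torusCoeff_resKernel_le hp hp1
  refine ⟨27 * M ^ 3 + 2 * M ^ 2, by positivity, fun u β hβ hβ1 ω₀ α => ?_⟩
  have hmono : ∀ {a b : ℝ}, b ≤ a → β ^ a ≤ β ^ b := fun h =>
    Real.rpow_le_rpow_of_exponent_ge hβ hβ1 h
  have hone : ∀ {a : ℝ}, a ≤ 0 → 1 ≤ β ^ a := fun h =>
    Real.one_le_rpow_of_pos_of_le_one_of_nonpos hβ hβ1 h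
  have hg : ∀ i, Continuous fun k => α i - omegaNNSq ω₀ k := fun i =>
    continuous_const.sub (smooth_omegaNNSq ω₀).continuous
  -- With `R = β^(-1/4)` the box has `O(β^(-3/4))` points. With `S = β^(-1/12)` the two error terms
  -- are `β^(1/12)` and `β^(1/72)`, so the high frequencies contribute `β^(1/72 - p)`, which
  -- dominates the final bound.
  have hδ : (β ^ (-(1 / 12) : ℝ)) ^ 2 / β ^ (-(1 / 4) : ℝ) +
      (β ^ (-(1 / 12) : ℝ)) ^ (-(1 / 6) : ℝ) ≤ 2 * β ^ (1 / 72 : ℝ) := by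
    rw [← Real.rpow_natCast, ← Real.rpow_mul hβ.le, ← Real.rpow_mul hβ.le, ← Real.rpow_sub hβ,
      two_mul]
    exact add_le_add (hmono (by norm_num)) (hmono (by norm_num))
  have h := integral_convolution_le (H := fun i k => resKernel p β (α i - omegaNNSq ω₀ k))
    (fun i => (continuous_resKernel p hβ).comp (hg i)) u _
    (δ := M * (2 * β ^ (1 / 72 : ℝ))) (E := β ^ (-p) * M) (by positivity)
    (fun i n => (hM β hβ ω₀ (α i) n).1)
    (fun n hn => ((hM β hβ ω₀ (α 2) n).2 (β ^ (-(1 / 12) : ℝ)) (β ^ (-(1 / 4) : ℝ))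
      (hone (by norm_num)) (by positivity) (exists_le_abs_of_notMem_box hn)).trans
        (mul_le_mul_of_nonneg_left hδ hM0))
    (fun i => integral_resKernel_sq_le hp hp1 hβ (hg i) (hM β hβ ω₀ (α i) 0).1)
  refine h.trans ?_
  have h1 : (β ^ (-(1 / 4) : ℝ)) ^ 3 ≤ β ^ (-(71 / 72) : ℝ) := by
    rw [← Real.rpow_natCast, ← Real.rpow_mul hβ.le]
    exact hmono (by norm_num)
  have h2 : β ^ (1 / 72 : ℝ) * β ^ (-p) ≤ β ^ (-(71 / 72) : ℝ) := by
    rw [← Real.rpow_add hβ]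
    exact hmono (by linarith)
  calc _ ≤ 27 * (β ^ (-(1 / 4) : ℝ)) ^ 3 * M ^ 3 +
        2 * M ^ 2 * (β ^ (1 / 72 : ℝ) * β ^ (-p)) := by
        refine add_le_add (mul_le_mul_of_nonneg_right (card_box_le (hone (by norm_num)))
          (by positivity)) (le_of_eq (by ring))
    _ ≤ 27 * β ^ (-(71 / 72) : ℝ) * M ^ 3 + 2 * M ^ 2 * β ^ (-(71 / 72) : ℝ) := by gcongr
    _ = _ := by ring

theorem exists_resDenom_sub_mul_eq (α : ℝ) {σ : ℝ} (hσ : σ = 1 ∨ σ = -1) :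
    ∃ α' : ℝ, ∀ β w : ℝ, resDenom β (α - σ * w) = resDenom β (α' - w) := by
  rcases hσ with rfl | rfl
  · exact ⟨α, fun β w => by rw [one_mul]⟩
  · refine ⟨-α, fun β w => ?_⟩
    rw [resDenom_eq, resDenom_eq]
    congr 2
    ring

theorem crossingIntegrand_le_resKernel {p β : ℝ} (hp : 0 < p) (hp1 : p < 1) (hβ : 0 < β) (u : T3)
    (g : Fin 3 → T3 → ℝ) (k : T3 × T3) : crossingIntegrand β u g k ≤
      ((Real.cos (Real.pi / 2 * p))⁻¹ * β ^ (p - 1)) ^ 3 * (resKernel p β (g 0 k.1) *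
        resKernel p β (g 1 k.2) * resKernel p β (g 2 (k.1 - k.2 + u))) := by
  have h0 : ∀ x, 0 ≤ 1 / resDenom β x := fun x => (one_div_pos.2 (resDenom_pos hβ x)).le
  have h1 := one_div_resDenom_le hp hp1 hβ
  have h2 := fun x => (h0 x).trans (h1 x)
  rw [crossingIntegrand, ← one_div_mul_one_div]
  refine (mul_le_mul (mul_le_mul (h1 _) (h1 _) (h0 _) (h2 _)) (h1 _) (h0 _)
    (mul_nonneg (h2 _) (h2 _))).trans (le_of_eq ?_)
  ring

/-- With `p = 431/432`, passing to the kernel costs `β^(-1/432)` three times, that is `β^(-1/144)`.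
This is half of the gain `β^(1/72)`; the other half is the exponent `γ = 1/144`. No logarithm is
needed. -/
theorem crossingsSuppressed_omegaNNSq (ω₀ : ℝ) : CrossingsSuppressed (omegaNNSq ω₀) (1 / 144) := by
  have hp : (0 : ℝ) < 431 / 432 := by norm_num
  have hp1 : (431 / 432 : ℝ) < 1 := by norm_num
  obtain ⟨C, hC0, hC⟩ := exists_integral_resKernel_le hp hp1
  set c := (Real.cos (Real.pi / 2 * (431 / 432)))⁻¹
  have hc : 0 < c := inv_pos.2 (cos_half_pi_mul_pos hp hp1)
  refine ⟨by norm_num, by norm_num, c ^ 3 * (C + 1), 0, by positivity,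
    fun u β hβ hβ1 α σ hσ => ?_⟩
  have hω := (smooth_omegaNNSq ω₀).continuous
  choose α' hα' using fun i => exists_resDenom_sub_mul_eq (α i) (hσ i)
  have hcont : ∀ i, Continuous fun k => α' i - omegaNNSq ω₀ k := fun i => continuous_const.sub hω
  have e : ∀ k : T3 × T3, crossingIntegrand β u (fun i k => α i - σ i * omegaNNSq ω₀ k) k =
      crossingIntegrand β u (fun i k => α' i - omegaNNSq ω₀ k) k := fun k => by
    simp only [crossingIntegrand, hα']
  change ∫ k, crossingIntegrand β u (fun i k => α i - σ i * omegaNNSq ω₀ k) k ≤ _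
  simp_rw [e]
  have hr := fun i => (continuous_resKernel (431 / 432) hβ).comp (hcont i)
  have hi : Integrable fun k : T3 × T3 => resKernel (431 / 432) β (α' 0 - omegaNNSq ω₀ k.1) *
      resKernel (431 / 432) β (α' 1 - omegaNNSq ω₀ k.2) *
      resKernel (431 / 432) β (α' 2 - omegaNNSq ω₀ (k.1 - k.2 + u)) :=
    integrable_of_continuous _ ((((hr 0).comp continuous_fst).mul
      ((hr 1).comp continuous_snd)).mul
        ((hr 2).comp ((continuous_fst.sub continuous_snd).add continuous_const)))
  calc _ ≤ ∫ k : T3 × T3, (c * β ^ (431 / 432 - 1 : ℝ)) ^ 3 *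
        (resKernel (431 / 432) β (α' 0 - omegaNNSq ω₀ k.1) *
          resKernel (431 / 432) β (α' 1 - omegaNNSq ω₀ k.2) *
          resKernel (431 / 432) β (α' 2 - omegaNNSq ω₀ (k.1 - k.2 + u))) :=
        integral_mono (integrable_crossingIntegrand hβ u hcont) (hi.const_mul _) fun k =>
          crossingIntegrand_le_resKernel hp hp1 hβ u _ k
    _ ≤ (c * β ^ (431 / 432 - 1 : ℝ)) ^ 3 * (C * β ^ (-(71 / 72) : ℝ)) := by
        rw [integral_const_mul]
        exact mul_le_mul_of_nonneg_left (hC u β hβ hβ1 ω₀ α') (by positivity)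
    _ = c ^ 3 * C * β ^ (1 / 144 - 1 : ℝ) := by
        rw [mul_pow, ← Real.rpow_natCast (β ^ _), ← Real.rpow_mul hβ.le,
          show (1 / 144 - 1 : ℝ) = (431 / 432 - 1) * (3 : ℕ) + -(71 / 72) by norm_num,
          Real.rpow_add hβ]
        ring
    _ ≤ _ := by
        rw [pow_zero, mul_one]
        gcongr
        linarith

end Dispersion

end

theorem mainTheorem3 :
    (∀ (ω : Dispersion.T3 → ℝ) (γ : ℝ),
      Dispersion.IsMorse ω → Dispersion.DispersionAssumptions ω γ →
        Dispersion.IsMorse (fun k => √(ω k)) ∧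
          Dispersion.DispersionAssumptions (fun k => √(ω k)) γ) ∧
    (∀ ω₀ : ℝ, 0 < ω₀ →
      ∃ γ : ℝ,
        (Dispersion.IsMorse (Dispersion.omegaNNSq ω₀) ∧
          Dispersion.DispersionAssumptions (Dispersion.omegaNNSq ω₀) γ) ∧
        (Dispersion.IsMorse (Dispersion.omegaNN ω₀) ∧
          Dispersion.DispersionAssumptions (Dispersion.omegaNN ω₀) γ)) := by
  refine ⟨fun ω γ hm h => h.sqrt hm, fun ω₀ h₀ => ⟨1 / 144, ?_⟩⟩
  have hm := Dispersion.isMorse_omegaNNSq ω₀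
  have h := Dispersion.dispersionAssumptions_omegaNNSq h₀
    (Dispersion.crossingsSuppressed_omegaNNSq ω₀)
  -- `omegaNN ω₀` is by definition the square root of `omegaNNSq ω₀`, so the first half of the
  -- theorem applies to it directly, with the same exponent.
  exact ⟨⟨hm, h⟩, h.sqrt hm⟩
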